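/- Let $P_1,\dots,P_N\in\mathbb{C}$ ($N\ge 1$) be distinct points, let $n_1,\dots,n_N\ge 1$ be integers, let $D=\sum_i n_iP_i$, and let $r\ge 0$. For a commutative $\mathbb{C}$-algebra $R$ put $$A_R=\{f\in R[z] : f(P_i)=f(P_j)\ \forall i,j,\quad f^{(l)}(P_i)=0 \text{ for } 1\le l\le n_i-1\}.$$ Let $\Sigma=\Sigma_D^{proj}$ be the projective curve obtained from $\operatorname{Spec} A_{\mathbb{C}}$ by adding one smooth point $\infty$. It is covered by the affine chart $\operatorname{Spec}A_{\mathbb{C}}$ and by the complement $\mathbb{P}^1\setminus\{P_1,\dots,P_N\}$ of the singular point. (If $N=1$ and $n_1=1$, then $\Sigma=\mathbb{P}^1$.) The degree of a coherent sheaf $F$ on $\Sigma$ is $\deg F=\chi(F)-\operatorname{rk}(F)\,\chi(\mathcal{O}_\Sigma)$. A vector bundle $E$ is semistable if $\deg F\cdot\operatorname{rk}E\le\deg E\cdot\operatorname{rk}F$ for all coherent subsheaves $F\subseteq E$. Let $\mathbf{\Lambda}(R)$ be the set of tuples $\Lambda=(\Lambda_i,\Lambda_k^j)$ with $\Lambda_i\in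 GL_r(R)$ for $2\le i\le N$, and $\Lambda_k^j\in Mat_r(R)$ arbitrary for $1\le k\le N$, $1\le j\le n_k-1$. The group $GL_r(R)$ acts on it by simultaneous conjugation. For $\Lambda\in\mathbf{\Lambda}(R)$ let $M_\Lambda$ be the sheaf on $\Sigma\times\operatorname{Spec}R$ which over the affine chart is the $A_R$-module $$\{s\in R[z]^r : s(P_1)=\Lambda_i s(P_i)\ (2\le i\le N),\quad s^{(j)}(P_k)=\Lambda_k^j s(P_k)\ (1\le k\le N,\ 1\le j\le n_k-1)\},$$ over the other chart is the trivial module of rank $r$, and on the overlap of the charts is glued by the inclusion of $R[z]^r$ into $R[z,\prod_i(z-P_i)^{-1}]^r$. Let $\mathcal{M}^{ss}$ be the space of isomorphism classes of semistable vector bundles of degree $0$ and rank $r$ on $\Sigma$. A subset of it is called open if, for every algebraic family of such bundles parametrized by an affine scheme $T$ of finite type over $\mathbb{C}$, the set of closed points of $T$ whose fibre lies in the subset is Zariski open. Then: 1. For $\Lambda,\Lambda'\in\mathbf{\Lambda}(\mathbb{C})$, the bundles $M_\Lambda$ and $M_{\Lambda'}$ are isomorphic if and only if there is a constant matrix $K\in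 GL_r(\mathbb{C})$ such that $\Lambda_i=K\Lambda'_iK^{-1}$ and $\Lambda_k^j=K\Lambda'^{\,j}_kK^{-1}$ for all $i,j,k$. 2. For every $\Lambda\in\mathbf{\Lambda}(\mathbb{C})$, $M_\Lambda$ is a semistable vector bundle of degree $0$ and rank $r$. The map $\Lambda\mapsto[M_\Lambda]$ induces an open embedding $\mathbf{\Lambda}(\mathbb{C})/GL_r(\mathbb{C})\hookrightarrow\mathcal{M}^{ss}$, where the left side has the quotient of the Zariski topology. In other words, this map is a homeomorphism onto an open subset. 3. This identification is algebraic. For every commutative $\mathbb{C}$-algebra $R$ and every $\Lambda\in\mathbf{\Lambda}(R)$, $M_\Lambda$ is a vector bundle of rank $r$ on $\Sigma\times\operatorname{Spec}R$, and its formation commutes with base change $R\to S$. For $\Lambda,\Lambda'\in\mathbf{\Lambda}(R)$, $M_\Lambda\cong M_{\Lambda'}$ if and only if $\Lambda$ and $\Lambda'$ are simultaneously conjugate by an element of $GL_r(R)$. If $R$ is finitely generated over $\mathbb{C}$, and $E$ is a vector bundle of rank $r$ on $\Sigma\times\operatorname{Spec}R$ whose fibre at every closed point is isomorphic to some $M_\Lambda$,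 then every closed point of $\operatorname{Spec} R$ has a neighbourhood $\operatorname{Spec}R_x$ over which $E$ is isomorphic to $M_\Lambda$ for some $\Lambda\in\mathbf{\Lambda}(R_x)$. -/

import Mathlib

open Polynomial
open scoped Topology

noncomputable section

namespace GluedCurve

/-- An effective divisor `D = ∑ n_i P_i` on the affine line over `ℂ`: distinct points
`P_1, …, P_N` (indexed by `Fin (k + 1)` with `N = k + 1`, so `P_1` is `P 0`) and multiplicities
`n_i > 0`. -/
structure Divisor where
  k : ℕ
  P : Fin (k + 1) → ℂ
  P_injective : Function.Injective P
  n : Fin (k + 1) → ℕ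
  n_pos : ∀ i, 0 < n i

section Rings

variable (D : Divisor) (R : Type) [CommRing R] [Algebra ℂ R]

/-- The value at `P_i` of the `l`-th derivative of a polynomial over `R`. -/
def jet (i : Fin (D.k + 1)) (l : ℕ) (f : R[X]) : R :=
  (derivative^[l] f).eval (algebraMap ℂ R (D.P i))

variable {R} in
theorem jet_add (i : Fin (D.k + 1)) (l : ℕ) (f g : R[X]) :
    jet D R i l (f + g) = jet D R i l f + jet D R i l g := by
  simp [jet]

variable {R} in
theorem jet_mul (i : Fin (D.k + 1)) (l : ℕ) (f g : R[X])
    (hf : ∀ j, 1 ≤ j → j ≤ l → jet D R i j f = 0) :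
    jet D R i l (f * g) = jet D R i 0 f * jet D R i l g := by
  unfold jet at *
  rw [iterate_derivative_mul, eval_finsetSum, Finset.sum_eq_single l]
  · simp
  · intro b hb hbl
    have hb' : b < l + 1 := Finset.mem_range.mp hb
    simp [hf (l - b) (by omega) (by omega)]
  · intro h
    exact absurd (Finset.mem_range.mpr (Nat.lt_succ_self l)) h

/-- The coordinate ring of (affine part of `Σ_D`) × Spec `R`:
`{f ∈ R[z] | f(P_i) = f(P_j), f^{(l)}(P_i) = 0 for 1 ≤ l ≤ n_i - 1}`.
For `R = ℂ` this is the coordinate ring of the affine curve obtained by gluing the points `P_i`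
of the affine line with multiplicities `n_i`. -/
def affRing : Subalgebra R R[X] where
  carrier := {f | (∀ i j, jet D R i 0 f = jet D R j 0 f) ∧
    ∀ i l, 1 ≤ l → l < D.n i → jet D R i l f = 0}
  mul_mem' := by
    rintro f g ⟨hf, hf'⟩ ⟨hg, hg'⟩
    refine ⟨fun i j => ?_, fun i l h1 hl => ?_⟩
    · rw [jet_mul D i 0 f g (by omega), jet_mul D j 0 f g (by omega), hf i j, hg i j]
    · rw [jet_mul D i l f g (fun j h1 h2 => hf' i j h1 (by omega)), hg' i l h1 hl, mul_zero]
  add_mem' := by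
    rintro f g ⟨hf, hf'⟩ ⟨hg, hg'⟩
    refine ⟨fun i j => ?_, fun i l h1 hl => ?_⟩
    · rw [jet_add, jet_add, hf i j, hg i j]
    · rw [jet_add, hf' i l h1 hl, hg' i l h1 hl, add_zero]
  algebraMap_mem' := by
    intro c
    refine ⟨fun i j => ?_, fun i l h1 hl => ?_⟩
    · simp [jet]
    · obtain ⟨m, rfl⟩ : ∃ m, l = m + 1 := ⟨l - 1, by omega⟩
      simp [jet]

/-- The polynomial `q = ∏ (z - P_i)`. -/
def nodePoly : R[X] := ∏ i, (X - C (algebraMap ℂ R (D.P i)))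

/-- `R[z, 1/q]`: the functions on `(ℙ¹ ∖ {P_1, …, P_N, ∞}) × Spec R`, i.e. the coordinate ring of
the overlap of the two affine charts. -/
def overlapRing : Type := Localization.Away (nodePoly D R)

instance : CommRing (overlapRing D R) :=
  inferInstanceAs (CommRing (Localization.Away (nodePoly D R)))

instance : Algebra R[X] (overlapRing D R) :=
  inferInstanceAs (Algebra R[X] (Localization.Away (nodePoly D R)))

instance : IsLocalization.Away (nodePoly D R) (overlapRing D R) :=
  inferInstanceAs (IsLocalization.Away (nodePoly D R) (Localization.Away (nodePoly D R)))

instance : Algebra R (overlapRing D R) :=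
  inferInstanceAs (Algebra R (Localization.Away (nodePoly D R)))

instance : IsScalarTower R R[X] (overlapRing D R) :=
  inferInstanceAs (IsScalarTower R R[X] (Localization.Away (nodePoly D R)))

theorem natDegree_nodePoly_pow_le (m : ℕ) :
    (nodePoly D R ^ m).natDegree ≤ m * (D.k + 1) := by
  refine natDegree_pow_le.trans (Nat.mul_le_mul_left _ ?_)
  refine (natDegree_prod_le _ _).trans ((Finset.sum_le_card_nsmul _ _ 1 ?_).trans ?_)
  · intro i _
    exact natDegree_X_sub_C_le _
  · simp

/-- The coordinate ring of the chart at infinity `(ℙ¹ ∖ {P_1, …, P_N}) × Spec R`: the elements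
`f / q ^ m` of `R[z, 1/q]` that are regular at infinity, i.e. `deg f ≤ deg (q ^ m)`. -/
def infRing : Subalgebra R (overlapRing D R) where
  carrier := {x | ∃ (m : ℕ) (f : R[X]), f.natDegree ≤ m * (D.k + 1) ∧
    algebraMap R[X] (overlapRing D R) (nodePoly D R ^ m) * x =
      algebraMap R[X] (overlapRing D R) f}
  mul_mem' := by
    rintro x y ⟨m, f, hf, hx⟩ ⟨m', f', hf', hy⟩
    refine ⟨m + m', f * f', ?_, ?_⟩
    · rw [add_mul]
      exact natDegree_mul_le.trans (Nat.add_le_add hf hf')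
    · rw [pow_add, map_mul, map_mul, ← hx, ← hy]
      ring
  add_mem' := by
    rintro x y ⟨m, f, hf, hx⟩ ⟨m', f', hf', hy⟩
    refine ⟨m + m', f * nodePoly D R ^ m' + f' * nodePoly D R ^ m, ?_, ?_⟩
    · refine natDegree_add_le_of_degree_le ?_ ?_
      · rw [add_mul]
        exact natDegree_mul_le.trans
          (Nat.add_le_add hf (natDegree_nodePoly_pow_le D R m'))
      · rw [add_mul, add_comm (m * _)]
        exact natDegree_mul_le.trans
          (Nat.add_le_add hf' (natDegree_nodePoly_pow_le D R m))
    · rw [pow_add, map_add, map_mul, map_mul, map_mul, ← hx, ← hy]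
      ring
  algebraMap_mem' := by
    intro c
    refine ⟨0, C c, by simp, ?_⟩
    rw [pow_zero, map_one, one_mul, IsScalarTower.algebraMap_apply R R[X] (overlapRing D R)]
    rfl

/-- The restriction of functions from the affine part to the overlap. -/
def affToOverlap : affRing D R →+* overlapRing D R :=
  (algebraMap R[X] (overlapRing D R)).comp (affRing D R).val.toRingHom

/-- The restriction of functions from the chart at infinity to the overlap. -/
def infToOverlap : infRing D R →+* overlapRing D R := (infRing D R).val.toRingHom

variable {R} in
theorem exists_aff_mul (x : overlapRing D R) :
    ∃ (a : affRing D R) (f : R[X]), IsUnit (affToOverlap D R a) ∧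
      (∀ i l, l < D.n i → jet D R i l f = 0) ∧
      algebraMap R[X] (overlapRing D R) f = affToOverlap D R a * x := by
  obtain ⟨m, g, hg⟩ := IsLocalization.Away.surj (nodePoly D R) x
  set e := ∑ i, D.n i with he
  have hle : ∀ i, D.n i ≤ e := fun i =>
    Finset.single_le_sum (f := D.n) (fun _ _ => Nat.zero_le _) (Finset.mem_univ i)
  have key : ∀ (h : R[X]) (i : Fin (D.k + 1)) (l : ℕ), l < D.n i →
      jet D R i l (nodePoly D R ^ e * h) = 0 := by
    intro h i l hl
    have h0 : (X - C (algebraMap ℂ R (D.P i))) ∣ nodePoly D R :=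
      Finset.dvd_prod_of_mem (fun j => X - C (algebraMap ℂ R (D.P j))) (Finset.mem_univ i)
    have h1 : (X - C (algebraMap ℂ R (D.P i))) ^ (D.n i) ∣ nodePoly D R ^ e * h :=
      dvd_mul_of_dvd_left ((pow_dvd_pow _ (hle i)).trans (pow_dvd_pow_of_dvd h0 e)) h
    have h2 := pow_sub_dvd_iterate_derivative_of_pow_dvd l h1
    have h3 : (X - C (algebraMap ℂ R (D.P i))) ∣ derivative^[l] (nodePoly D R ^ e * h) :=
      (dvd_pow_self _ (by omega)).trans h2
    exact dvd_iff_isRoot.mp h3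
  have hu : IsUnit (algebraMap R[X] (overlapRing D R) (nodePoly D R)) :=
    IsLocalization.Away.algebraMap_isUnit (nodePoly D R)
  refine ⟨⟨nodePoly D R ^ e * nodePoly D R ^ m, ?_, ?_⟩, nodePoly D R ^ e * g, ?_, ?_, ?_⟩
  · intro i j
    rw [key _ i 0 (D.n_pos i), key _ j 0 (D.n_pos j)]
  · intro i l _ hl
    exact key _ i l hl
  · change IsUnit (algebraMap R[X] (overlapRing D R) (nodePoly D R ^ e * nodePoly D R ^ m))
    rw [map_mul, map_pow, map_pow]
    exact (hu.pow e).mul (hu.pow m)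
  · exact fun i l hl => key g i l hl
  · change _ = algebraMap R[X] (overlapRing D R) (nodePoly D R ^ e * nodePoly D R ^ m) * x
    rw [map_mul, map_mul, map_pow _ (nodePoly D R) m, ← hg]
    ring

variable {R} in
theorem exists_inf_mul {ι : Type} [Finite ι] (x : ι → overlapRing D R) :
    ∃ b : infRing D R, IsUnit (infToOverlap D R b) ∧
      ∀ i, infToOverlap D R b * x i ∈ infRing D R := by
  cases nonempty_fintype ι
  choose m g hg using fun i => IsLocalization.Away.surj (nodePoly D R) (x i)
  set e := ∑ i, (g i).natDegree with he
  have hle : ∀ i, (g i).natDegree ≤ e := fun i =>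
    Finset.single_le_sum (f := fun i => (g i).natDegree) (fun _ _ => Nat.zero_le _)
      (Finset.mem_univ i)
  have hu : IsUnit (algebraMap R[X] (overlapRing D R) (nodePoly D R)) :=
    IsLocalization.Away.algebraMap_isUnit (nodePoly D R)
  obtain ⟨v, hv⟩ := hu.exists_right_inv
  have hv' : algebraMap R[X] (overlapRing D R) (nodePoly D R) ^ e * v ^ e = 1 := by
    rw [← mul_pow, hv, one_pow]
  refine ⟨⟨v ^ e, e, 1, by simp, by rw [map_pow, map_one, hv']⟩, ?_, fun i => ?_⟩
  · exact IsUnit.of_mul_eq_one _ ((mul_comm _ _).trans hv')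
  · refine ⟨m i + e, g i, (hle i).trans ?_, ?_⟩
    · nlinarith [Nat.zero_le (m i * (D.k + 1)), Nat.zero_le (e * D.k)]
    · change _ * (v ^ e * x i) = _
      rw [pow_add, map_mul, map_pow, map_pow, ← hg i]
      linear_combination
        (algebraMap R[X] (overlapRing D R) (nodePoly D R)) ^ (m i) * x i * hv'

end Rings

section BaseChangeRings

variable (D : Divisor) {R S : Type} [CommRing R] [Algebra ℂ R] [CommRing S] [Algebra ℂ S]
  (φ : R →ₐ[ℂ] S)

theorem jet_map (i : Fin (D.k + 1)) (l : ℕ) (f : R[X]) :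
    jet D S i l (f.map φ.toRingHom) = φ (jet D R i l f) := by
  have h : algebraMap ℂ S (D.P i) = φ.toRingHom (algebraMap ℂ R (D.P i)) :=
    (φ.commutes (D.P i)).symm
  rw [jet, jet, iterate_derivative_map, h, eval_map_apply]
  rfl

theorem nodePoly_map : (nodePoly D R).map φ.toRingHom = nodePoly D S := by
  simp [nodePoly, Polynomial.map_prod]

/-- The map on coordinate rings of the affine chart induced by `φ : R → S`
(apply `φ` to all coefficients). -/
def affMap : affRing D R →+* affRing D S :=
  (mapRingHom φ.toRingHom).restrict (affRing D R) (affRing D S) (by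
    rintro f ⟨hf, hf'⟩
    refine ⟨fun i j => ?_, fun i l h1 hl => ?_⟩
    · rw [coe_mapRingHom, jet_map, jet_map, hf i j]
    · rw [coe_mapRingHom, jet_map, hf' i l h1 hl, map_zero])

/-- The map on coordinate rings of the overlap induced by `φ : R → S`. -/
def overlapMap : overlapRing D R →+* overlapRing D S :=
  IsLocalization.Away.lift (nodePoly D R)
    (g := (algebraMap S[X] (overlapRing D S)).comp (mapRingHom φ.toRingHom)) (by
      rw [RingHom.comp_apply, coe_mapRingHom, nodePoly_map]
      exact IsLocalization.Away.algebraMap_isUnit (nodePoly D S))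

theorem overlapMap_algebraMap (f : R[X]) :
    overlapMap D φ (algebraMap R[X] (overlapRing D R) f) =
      algebraMap S[X] (overlapRing D S) (f.map φ.toRingHom) :=
  IsLocalization.Away.lift_eq _ _ _

/-- The map on coordinate rings of the chart at infinity induced by `φ : R → S`. -/
def infMap : infRing D R →+* infRing D S :=
  (overlapMap D φ).restrict (infRing D R) (infRing D S) (by
    rintro x ⟨m, f, hf, hx⟩
    refine ⟨m, f.map φ.toRingHom, natDegree_map_le.trans hf, ?_⟩
    rw [← overlapMap_algebraMap, ← hx, map_mul, overlapMap_algebraMap, Polynomial.map_pow,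
      nodePoly_map])

end BaseChangeRings

/-- A quasi-coherent sheaf on `Σ_D^{proj} × Spec R`, where `Σ_D^{proj}` is the projective curve
covered by the affine curve `Σ_D^{aff} = Spec (affRing D ℂ)` and the chart at infinity
`Spec (infRing D ℂ)` (the complement of the singular point), whose intersection is
`Spec (overlapRing D ℂ)`.
It consists of the modules `M`, `N`, `L` of sections over the two charts and over the overlap,
with restriction maps `ρ : M → L` and `σ : N → L` which exhibit `L` as the localization of `M`
and of `N` (at the functions that are invertible on the overlap). -/
structure QCoh (D : Divisor) (R : Type) [CommRing R] [Algebra ℂ R] where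
  M : Type
  N : Type
  L : Type
  [addM : AddCommGroup M]
  [addN : AddCommGroup N]
  [addL : AddCommGroup L]
  [modM : Module (affRing D R) M]
  [modN : Module (infRing D R) N]
  [modL : Module (overlapRing D R) L]
  [baseM : Module R M]
  [baseN : Module R N]
  [baseL : Module R L]
  [towerM : IsScalarTower R (affRing D R) M]
  [towerN : IsScalarTower R (infRing D R) N]
  [towerL : IsScalarTower R (overlapRing D R) L]
  ρ : M →ₛₗ[affToOverlap D R] L
  σ : N →ₛₗ[infToOverlap D R] L
  ρ_surj : ∀ x : L, ∃ a : affRing D R, IsUnit (affToOverlap D R a) ∧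
    ∃ m, ρ m = affToOverlap D R a • x
  ρ_inj : ∀ m : M, ρ m = 0 → ∃ a : affRing D R, IsUnit (affToOverlap D R a) ∧ a • m = 0
  σ_surj : ∀ x : L, ∃ b : infRing D R, IsUnit (infToOverlap D R b) ∧
    ∃ m, σ m = infToOverlap D R b • x
  σ_inj : ∀ m : N, σ m = 0 → ∃ b : infRing D R, IsUnit (infToOverlap D R b) ∧ b • m = 0

attribute [instance] QCoh.addM QCoh.addN QCoh.addL QCoh.modM QCoh.modN QCoh.modL
  QCoh.baseM QCoh.baseN QCoh.baseL QCoh.towerM QCoh.towerN QCoh.towerL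

theorem smul_eq_of_tower {R A M : Type} [CommRing R] [CommRing A] [Algebra R A] [AddCommGroup M]
    [Module R M] [Module A M] [IsScalarTower R A M] (c : R) (m : M) : c • m = algebraMap R A c • m :=
  (algebraMap_smul A c m).symm

section Sheaves

variable {D : Divisor} {R : Type} [CommRing R] [Algebra ℂ R]

/-- Two sheaves are isomorphic: there are isomorphisms of modules over each chart which agree on
the overlap. -/
def QCoh.Iso (E F : QCoh D R) : Prop :=
  ∃ (u : E.M ≃ₗ[affRing D R] F.M) (v : E.N ≃ₗ[infRing D R] F.N)
    (w : E.L ≃ₗ[overlapRing D R] F.L),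
    (∀ m, F.ρ (u m) = w (E.ρ m)) ∧ ∀ m, F.σ (v m) = w (E.σ m)

/-- `F` embeds into `E` as a subsheaf. -/
def QCoh.Embeds (F E : QCoh D R) : Prop :=
  ∃ (u : F.M →ₗ[affRing D R] E.M) (v : F.N →ₗ[infRing D R] E.N)
    (w : F.L →ₗ[overlapRing D R] E.L),
    (∀ m, E.ρ (u m) = w (F.ρ m)) ∧ (∀ m, E.σ (v m) = w (F.σ m)) ∧
    Function.Injective u ∧ Function.Injective v

/-- Coherent sheaves: the modules of sections over the charts are finitely generated (used over
`R = ℂ`, where the coordinate rings are Noetherian). -/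
def QCoh.IsCoherent (E : QCoh D R) : Prop :=
  Module.Finite (affRing D R) E.M ∧ Module.Finite (infRing D R) E.N

/-- A vector bundle of rank `r` is a sheaf of finitely generated projective modules of constant
rank `r`. -/
def QCoh.IsVectorBundle (E : QCoh D R) (r : ℕ) : Prop :=
  (Module.Finite (affRing D R) E.M ∧ Module.Projective (affRing D R) E.M ∧
    ∀ p, Module.rankAtStalk (R := affRing D R) E.M p = r) ∧
  (Module.Finite (infRing D R) E.N ∧ Module.Projective (infRing D R) E.N ∧
    ∀ p, Module.rankAtStalk (R := infRing D R) E.N p = r)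

/-- The Čech differential `(m, n) ↦ ρ m - σ n` of the covering of the curve by its two charts. -/
def QCoh.cech (E : QCoh D R) : (E.M × E.N) →ₗ[R] E.L where
  toFun x := E.ρ x.1 - E.σ x.2
  map_add' x y := by
    simp only [Prod.fst_add, Prod.snd_add, map_add]
    abel
  map_smul' c x := by
    simp only [Prod.smul_fst, Prod.smul_snd, RingHom.id_apply]
    rw [smul_eq_of_tower (A := affRing D R) c x.1, smul_eq_of_tower (A := infRing D R) c x.2,
      map_smulₛₗ, map_smulₛₗ, smul_sub, smul_eq_of_tower (A := overlapRing D R) c (E.ρ x.1),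
      smul_eq_of_tower (A := overlapRing D R) c (E.σ x.2)]
    congr 2

/-- The structure sheaf. -/
def structureSheaf (D : Divisor) (R : Type) [CommRing R] [Algebra ℂ R] : QCoh D R where
  M := affRing D R
  N := infRing D R
  L := overlapRing D R
  ρ := { toFun := affToOverlap D R, map_add' := map_add _, map_smul' := map_mul _ }
  σ := { toFun := infToOverlap D R, map_add' := map_add _, map_smul' := map_mul _ }
  ρ_surj x := by
    obtain ⟨a, f, ha, hf, h⟩ := exists_aff_mul D x
    refine ⟨a, ha, ⟨f, ?_, ?_⟩, h⟩
    · intro i j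
      rw [hf i 0 (D.n_pos i), hf j 0 (D.n_pos j)]
    · exact fun i l _ hl => hf i l hl
  ρ_inj m hm := by
    obtain ⟨⟨c, e, rfl⟩, hc⟩ := (IsLocalization.map_eq_zero_iff
      (Submonoid.powers (nodePoly D R)) (overlapRing D R) m.1).mp hm
    refine ⟨1, by simp, ?_⟩
    have hmon : (nodePoly D R).Monic := monic_prod_of_monic _ _ fun i _ => monic_X_sub_C _
    have hz : (m : R[X]) = 0 := by
      have := (hmon.pow e).mul_right_eq_zero_iff.mp hc
      exact this
    rw [one_smul]
    exact Subtype.ext hz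
  σ_surj x := by
    obtain ⟨b, hb, h⟩ := exists_inf_mul D (fun _ : Unit => x)
    exact ⟨b, hb, ⟨_, h ()⟩, rfl⟩
  σ_inj m hm := ⟨1, by simp, by
    rw [one_smul]
    exact Subtype.ext hm⟩

end Sheaves

section Degree

variable {D : Divisor}

/-- `dim H⁰ - dim H¹`, computed by the Čech complex of the affine covering. -/
def QCoh.eulerChar (E : QCoh D ℂ) : ℤ :=
  (Module.finrank ℂ (LinearMap.ker E.cech) : ℤ) -
    Module.finrank ℂ (E.L ⧸ LinearMap.range E.cech)

/-- The (generic) rank of a coherent sheaf on the integral curve `Σ_D^{proj}`. -/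
def QCoh.rank (E : QCoh D ℂ) : ℕ := Module.finrank (affRing D ℂ) E.M

/-- The degree `deg E = χ(E) - rk(E) χ(𝒪)`. -/
def QCoh.degree (E : QCoh D ℂ) : ℤ :=
  E.eulerChar - E.rank * (structureSheaf D ℂ).eulerChar

/-- Slope semistability: `deg F / rk F ≤ deg E / rk E` for all nonzero coherent subsheaves `F`
(for `F = 0` the inequality below reads `0 ≤ 0`). -/
def QCoh.IsSemistable (E : QCoh D ℂ) : Prop :=
  ∀ F : QCoh D ℂ, F.IsCoherent → F.Embeds E → F.degree * E.rank ≤ E.degree * F.rank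

end Degree

section Pullback

/-- `u : M → M'` exhibits the `A'`-module `M'` as the base change of the `A`-module `M` along the
ring homomorphism `θ : A → A'`, i.e. `A' ⊗_A M ≅ M'`. -/
def IsBaseChangeAlong {A A' M M' : Type} [CommRing A] [CommRing A'] [AddCommGroup M]
    [AddCommGroup M'] [Module A M] [Module A' M'] (θ : A →+* A') (u : M →ₛₗ[θ] M') : Prop :=
  letI : Algebra A A' := θ.toAlgebra
  letI : Module A M' := Module.compHom M' θ
  haveI : IsScalarTower A A' M' := ⟨fun a b m => mul_smul (θ a) b m⟩
  IsBaseChange A'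
    ({ toFun := u, map_add' := map_add u, map_smul' := fun a m => map_smulₛₗ u a m } : M →ₗ[A] M')

/-- The sheaf `F` on `Σ_D^{proj} × Spec S` is the pullback of the sheaf `E` on
`Σ_D^{proj} × Spec R` along the morphism `Spec S → Spec R` given by `φ`. For `S = ℂ`: `F` is the
fibre of the family `E` at the closed point `φ`. -/
def IsPullback {D : Divisor} {R S : Type} [CommRing R] [Algebra ℂ R] [CommRing S] [Algebra ℂ S]
    (φ : R →ₐ[ℂ] S) (E : QCoh D R) (F : QCoh D S) : Prop :=
  ∃ (u : E.M →ₛₗ[affMap D φ] F.M) (v : E.N →ₛₗ[infMap D φ] F.N)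
    (w : E.L →ₛₗ[overlapMap D φ] F.L),
    (∀ m, F.ρ (u m) = w (E.ρ m)) ∧ (∀ m, F.σ (v m) = w (E.σ m)) ∧
    IsBaseChangeAlong (affMap D φ) u ∧ IsBaseChangeAlong (infMap D φ) v ∧
    IsBaseChangeAlong (overlapMap D φ) w

end Pullback

section Tuples

/-- The tuples `Λ`: invertible matrices `Λ_i`, `i = 2, …, N` (here `glue i` belongs to the point
`P i.succ`), and arbitrary matrices `Λ_i^l`, `i = 1, …, N`, `l = 1, …, n_i - 1` (here
`deriv i l` is `Λ_i^{l + 1}`), with entries in `R`. -/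
@[ext] structure Tuple (D : Divisor) (r : ℕ) (R : Type) [CommRing R] where
  glue : Fin D.k → GL (Fin r) R
  deriv : (i : Fin (D.k + 1)) → Fin (D.n i - 1) → Matrix (Fin r) (Fin r) R

variable {D : Divisor} {r : ℕ} {R : Type} [CommRing R]

/-- `GL_r` acts on the tuples by simultaneous conjugation. -/
instance : MulAction (GL (Fin r) R) (Tuple D r R) where
  smul g Λ :=
    { glue := fun i => g * Λ.glue i * g⁻¹
      deriv := fun i l => g.1 * Λ.deriv i l * (g⁻¹).1 }
  one_smul Λ := by
    ext i : 2
    · change 1 * Λ.glue i * 1⁻¹ = Λ.glue i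
      simp
    · ext1 l
      change (1 : GL (Fin r) R).1 * Λ.deriv i l * (1⁻¹ : GL (Fin r) R).1 = Λ.deriv i l
      simp
  mul_smul g h Λ := by
    ext i : 2
    · change g * h * Λ.glue i * (g * h)⁻¹ = g * (h * Λ.glue i * h⁻¹) * g⁻¹
      simp [mul_assoc]
    · ext1 l
      change (g * h).1 * Λ.deriv i l * ((g * h)⁻¹).1 =
        g.1 * (h.1 * Λ.deriv i l * (h⁻¹).1) * (g⁻¹).1
      rw [mul_inv_rev, Units.val_mul, Units.val_mul]
      simp only [mul_assoc]

/-- Apply a ring homomorphism to all matrix entries of a tuple. -/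
def Tuple.map {S : Type} [CommRing S] (φ : R →+* S) (Λ : Tuple D r R) : Tuple D r S where
  glue i := Matrix.GeneralLinearGroup.map φ (Λ.glue i)
  deriv i l := (Λ.deriv i l).map φ

variable [Algebra ℂ R]

/-- The vector `s^{(l)}(P_i)`. -/
def vjet (D : Divisor) (i : Fin (D.k + 1)) (l : ℕ) (s : Fin r → R[X]) : Fin r → R :=
  fun a => jet D R i l (s a)

theorem vjet_add (i : Fin (D.k + 1)) (l : ℕ) (s t : Fin r → R[X]) :
    vjet D i l (s + t) = vjet D i l s + vjet D i l t :=
  funext fun _ => jet_add D i l _ _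

theorem vjet_smul (i : Fin (D.k + 1)) (l : ℕ) (hl : l < D.n i) (f : affRing D R)
    (s : Fin r → R[X]) : vjet D i l (f • s) = jet D R i 0 f.1 • vjet D i l s :=
  funext fun _ => jet_mul D i l _ _ fun j h1 h2 => f.2.2 i j h1 (by omega)

/-- The module `M_Λ` over the affine chart: the vector-valued polynomials `s` with
`s(P_1) = Λ_i s(P_i)` and `s^{(l)}(P_i) = Λ_i^l s(P_i)`. -/
def Tuple.module (Λ : Tuple D r R) : Submodule (affRing D R) (Fin r → R[X]) where
  carrier := {s | (∀ i, vjet D 0 0 s = (Λ.glue i).1.mulVec (vjet D i.succ 0 s)) ∧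
    ∀ i (l : Fin (D.n i - 1)), vjet D i (l + 1) s = (Λ.deriv i l).mulVec (vjet D i 0 s)}
  zero_mem' := by
    have h : ∀ i l, vjet D i l (0 : Fin r → R[X]) = 0 := fun i l => by
      ext a
      simp [vjet, jet]
    exact ⟨fun i => by simp [h], fun i l => by simp [h]⟩
  add_mem' := by
    rintro s t ⟨hs, hs'⟩ ⟨ht, ht'⟩
    refine ⟨fun i => ?_, fun i l => ?_⟩
    · rw [vjet_add, vjet_add, Matrix.mulVec_add, ← hs i, ← ht i]
    · rw [vjet_add, vjet_add, Matrix.mulVec_add, ← hs' i l, ← ht' i l]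
  smul_mem' := by
    rintro f s ⟨hs, hs'⟩
    refine ⟨fun i => ?_, fun i l => ?_⟩
    · rw [vjet_smul _ _ (D.n_pos _), vjet_smul _ _ (D.n_pos _), Matrix.mulVec_smul, ← hs i,
        f.2.1 0 i.succ]
    · have hl := l.2
      rw [vjet_smul _ _ (by omega), vjet_smul _ _ (D.n_pos _), Matrix.mulVec_smul, ← hs' i l]

/-- The sheaf `M_Λ` on `Σ_D^{proj} × Spec R`: the module `M_Λ` over the affine chart and the
trivial rank `r` module over the chart at infinity, glued on the overlap inside `R[z, 1/q]^r`. -/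
def Tuple.bundle (Λ : Tuple D r R) : QCoh D R where
  M := Λ.module
  N := Fin r → infRing D R
  L := Fin r → overlapRing D R
  ρ :=
    { toFun := fun s a => algebraMap R[X] (overlapRing D R) (s.1 a)
      map_add' := fun s t => funext fun a => map_add _ _ _
      map_smul' := fun f s => funext fun a => map_mul _ _ _ }
  σ :=
    { toFun := fun s a => infToOverlap D R (s a)
      map_add' := fun s t => funext fun a => map_add _ _ _
      map_smul' := fun f s => funext fun a => map_mul _ _ _ }
  ρ_surj x := by
    choose b f hb hf h using fun a => exists_aff_mul D (x a)
    have hprod : ∀ a, ∃ c : affRing D R, ∏ a, b a = c * b a := fun a =>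
      ⟨∏ a' ∈ Finset.univ.erase a, b a', (Finset.prod_erase_mul _ _ (Finset.mem_univ a)).symm⟩
    choose c hc using hprod
    have hz : ∀ i l, l < D.n i → vjet D i l (fun a => (c a).1 * f a) = 0 := by
      intro i l hl
      ext a
      change jet D R i l ((c a).1 * f a) = 0
      rw [jet_mul D i l _ _ fun j h1 h2 => (c a).2.2 i j h1 (by omega), hf a i l hl, mul_zero]
    refine ⟨∏ a, b a, ?_, ⟨fun a => (c a).1 * f a, ?_, ?_⟩, ?_⟩
    · rw [map_prod]
      exact (IsUnit.prod_univ_iff).mpr hb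
    · intro i
      rw [hz _ _ (D.n_pos _), hz _ _ (D.n_pos _), Matrix.mulVec_zero]
    · intro i l
      have hl := l.2
      rw [hz _ _ (by omega), hz _ _ (D.n_pos _), Matrix.mulVec_zero]
    · ext a
      change algebraMap R[X] (overlapRing D R) ((c a).1 * f a) =
        affToOverlap D R (∏ a, b a) * x a
      rw [map_mul, h a, hc a, map_mul, mul_assoc]
      rfl
  ρ_inj m hm := by
    refine ⟨1, by simp, ?_⟩
    have hmon : (nodePoly D R).Monic := monic_prod_of_monic _ _ fun i _ => monic_X_sub_C _
    rw [one_smul]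
    refine Subtype.ext (funext fun a => ?_)
    obtain ⟨⟨d, e, rfl⟩, hd⟩ := (IsLocalization.map_eq_zero_iff
      (Submonoid.powers (nodePoly D R)) (overlapRing D R) (m.1 a)).mp (congrFun hm a)
    exact (hmon.pow e).mul_right_eq_zero_iff.mp hd
  σ_surj x := by
    obtain ⟨b, hb, h⟩ := exists_inf_mul D x
    exact ⟨b, hb, fun a => ⟨_, h a⟩, rfl⟩
  σ_inj m hm := ⟨1, by simp, by
    rw [one_smul]
    exact funext fun a => Subtype.ext (congrFun hm a)⟩

end Tuples

section Moduli

/-- The Zariski topology on the closed points of `Spec R`, for `R` a finitely generated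
`ℂ`-algebra; a closed point is a homomorphism `R → ℂ`, identified with its kernel. -/
@[reducible] def pointTopology (R : Type) [CommRing R] [Algebra ℂ R] : TopologicalSpace (R →ₐ[ℂ] ℂ) :=
  TopologicalSpace.induced
    (fun φ => (⟨RingHom.ker φ, RingHom.ker_isPrime φ⟩ : PrimeSpectrum R)) inferInstance

variable (D : Divisor) (r : ℕ)

/-- The matrix entries of a complex tuple, as coordinates of a point of an affine space. -/
def Tuple.coord {D : Divisor} {r : ℕ} (Λ : Tuple D r ℂ) :
    (Fin D.k × Fin r × Fin r) ⊕ ((Σ i : Fin (D.k + 1), Fin (D.n i - 1)) × Fin r × Fin r) → ℂ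
  | .inl (i, a, b) => (Λ.glue i).1 a b
  | .inr (il, a, b) => Λ.deriv il.1 il.2 a b

/-- The Zariski topology on the complex tuples: generated by the sets where a polynomial in the
matrix entries does not vanish. -/
instance : TopologicalSpace (Tuple D r ℂ) :=
  TopologicalSpace.generateFrom
    {U | ∃ p, U = {Λ : Tuple D r ℂ | MvPolynomial.eval Λ.coord p ≠ 0}}

/-- Semistable vector bundles of degree zero and rank `r` on `Σ_D^{proj}`. -/
def SemistableBundle : Type 1 :=
  {E : QCoh D ℂ // E.IsVectorBundle r ∧ E.degree = 0 ∧ E.IsSemistable}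

/-- Isomorphism of semistable bundles. -/
instance semistableSetoid : Setoid (SemistableBundle D r) where
  r E F := E.1.Iso F.1
  iseqv :=
    { refl := fun E => ⟨LinearEquiv.refl _ _, LinearEquiv.refl _ _, LinearEquiv.refl _ _,
        fun _ => rfl, fun _ => rfl⟩
      symm := by
        rintro E F ⟨u, v, w, h1, h2⟩
        refine ⟨u.symm, v.symm, w.symm, fun m => ?_, fun m => ?_⟩
        · rw [LinearEquiv.eq_symm_apply, ← h1, LinearEquiv.apply_symm_apply]
        · rw [LinearEquiv.eq_symm_apply, ← h2, LinearEquiv.apply_symm_apply]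
      trans := by
        rintro E F G ⟨u, v, w, h1, h2⟩ ⟨u', v', w', h1', h2'⟩
        exact ⟨u.trans u', v.trans v', w.trans w', fun m => by simp [h1, h1'],
          fun m => by simp [h2, h2']⟩ }

/-- The space of isomorphism classes of semistable vector bundles of degree zero and rank `r`
on `Σ_D^{proj}`. -/
def ModuliSpace : Type 1 := Quotient (semistableSetoid D r)

variable {D r}

/-- `E` is an algebraic family, parametrized by `Spec R`, of semistable vector bundles of degree
zero and rank `r`, and `c` sends a closed point of `Spec R` to the isomorphism class of the fibre
of `E` at this point. -/
def IsClassifyingMap {R : Type} [CommRing R] [Algebra ℂ R] (E : QCoh D R)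
    (c : (R →ₐ[ℂ] ℂ) → ModuliSpace D r) : Prop :=
  E.IsVectorBundle r ∧
    ∀ φ, ∃ F : SemistableBundle D r, IsPullback φ E F.1 ∧ c φ = Quotient.mk _ F

/-- The topology of the moduli space: a set of isomorphism classes is open if, in every algebraic
family over an affine scheme of finite type over `ℂ`, the set of closed points whose fibre
belongs to it is Zariski open. -/
instance : TopologicalSpace (ModuliSpace D r) where
  IsOpen U := ∀ (R : Type) [CommRing R] [Algebra ℂ R] [Algebra.FiniteType ℂ R] (E : QCoh D R)
    (c : (R →ₐ[ℂ] ℂ) → ModuliSpace D r), IsClassifyingMap E c →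
      IsOpen[pointTopology R] (c ⁻¹' U)
  isOpen_univ R _ _ _ E c _ := by
    let := pointTopology R
    exact isOpen_univ
  isOpen_inter U V hU hV R _ _ _ E c h := by
    let := pointTopology R
    exact IsOpen.inter (hU R E c h) (hV R E c h)
  isOpen_sUnion 𝒰 h𝒰 R _ _ _ E c h := by
    let := pointTopology R
    rw [Set.preimage_sUnion]
    exact isOpen_biUnion fun U hU => h𝒰 U hU R E c h

/-- The quotient `Λ / GL_r` of the complex tuples by simultaneous conjugation, with the quotient
of the Zariski topology. -/
abbrev TupleQuotient (D : Divisor) (r : ℕ) : Type :=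
  MulAction.orbitRel.Quotient (GL (Fin r) ℂ) (Tuple D r ℂ)

/-- The orbit of a tuple. -/
def Tuple.orbit (Λ : Tuple D r ℂ) : TupleQuotient D r :=
  Quotient.mk (MulAction.orbitRel (GL (Fin r) ℂ) (Tuple D r ℂ)) Λ

/-- The isomorphism class of a semistable bundle. -/
def isoClass (E : QCoh D ℂ) (h : E.IsVectorBundle r ∧ E.degree = 0 ∧ E.IsSemistable) :
    ModuliSpace D r :=
  Quotient.mk (semistableSetoid D r) ⟨E, h⟩

end Moduli

end GluedCurve

end

/-! Write q for `nodePoly`, the product of the z - P_i, and Q for `fatPoly`, the product of the (z -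
P_i)^{n_i}. The affine coordinate ring is R + Q R[z] (`mem_affRing_iff`), so the curve differs from
the projective line only modulo Q. Correspondingly a bundle M_Λ is a trivial bundle on the
projective line together with gluing data modulo Q. If S is a matrix of polynomials whose jets at
the P_i are those prescribed by Λ, normalized to be 1 at P_1, then the sections over the affine
chart are S R^r + Q R[z]^r (`Tuple.mem_module_iff_exists`). Such an S exists by Hermite
interpolation, and it is invertible modulo Q because its values at the P_i are invertible. A
partition of unity between Q h and 1 - Q h then makes M_Λ a direct summand of a free module of rank
2r, by maps that commute with every change of base ring. This gives the vector bundle property and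
the base change statement.

Isomorphisms. The sections of M_Λ generate R[z]^r over R[z], so an isomorphism of M_Λ with M_Λ'
preserves R[z]^r, and it also preserves regularity at infinity. Its matrix is therefore constant,
and a constant matrix matches the two sets of jets exactly when it conjugates one tuple into the
other (`Tuple.iso_iff`).

Degree and semistability. Inside the trivial bundle, which has Euler characteristic r, the bundle
M_Λ has codimension r (∑ n_i - 1); hence it has degree 0. For a coherent subsheaf F of rank s,
consider the polynomial vectors that lie in F over the overlap. The constants among them have
dimension at most s. At least s (∑ n_i - 1) dimensions of these vectors are lost in passing to F,
since a section of M_Λ that vanishes at P_1 is divisible by Q. This bounds the Euler characteristic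
of F and gives degree at most 0 (`Tuple.eulerChar_le_of_embeds`).

Openness. Let a family E have a fibre M_Λ at a closed point. The `polySpan` of E and its sections at
infinity form a bundle on the projective line over the base whose fibre there is trivial. Its first
cohomology vanishes near the point by Nakayama, so the constant basis vectors of the fibre lift
(`exists_lift_single`). The lifts generate after multiplication by functions that are 1 in the
fibre; a resultant, and a computation at infinity, replace these functions by one scalar x of the
base, nonzero at the point. Over the locus where x is invertible the bundle on the projective line
is trivial, and E is recovered from the jets of r further sections; hence E is M_Λ' there
(`QCoh.LocalFrame.exists_iso`).

Topology. The universal tuple over the coordinate ring of the space of tuples gives continuity of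
the map to the moduli space. The local form of families gives that it is open, and the criterion for
isomorphism gives injectivity. -/

noncomputable section

namespace GluedCurve

/-! ### Base change of modules along a ring homomorphism -/

section BaseChangeAlong

variable {A A' A'' M M' M'' P : Type} [CommRing A] [CommRing A'] [CommRing A'']
  [AddCommGroup M] [AddCommGroup M'] [AddCommGroup M''] [AddCommGroup P]
  [Module A M] [Module A' M'] [Module A'' M''] [Module A' P]
  {θ : A →+* A'} {u : M →ₛₗ[θ] M'}

theorem IsBaseChangeAlong.exists_lift (h : IsBaseChangeAlong θ u) (g : M →ₛₗ[θ] P) :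
    ∃ g' : M' →ₗ[A'] P, ∀ m, g' (u m) = g m := by
  let : Algebra A A' := θ.toAlgebra
  let : Module A M' := Module.compHom M' θ
  let : Module A P := Module.compHom P θ
  have : IsScalarTower A A' M' := ⟨fun a b m => mul_smul (θ a) b m⟩
  have : IsScalarTower A A' P := ⟨fun a b m => mul_smul (θ a) b m⟩
  exact ⟨IsBaseChange.lift h
    ({ toFun := g, map_add' := map_add g, map_smul' := fun a m => map_smulₛₗ g a m } : M →ₗ[A] P),
    fun m => IsBaseChange.lift_eq h _ m⟩

theorem IsBaseChangeAlong.span_range (h : IsBaseChangeAlong θ u) :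
    Submodule.span A' (Set.range u) = ⊤ := by
  let : Algebra A A' := θ.toAlgebra
  let : Module A M' := Module.compHom M' θ
  have : IsScalarTower A A' M' := ⟨fun a b m => mul_smul (θ a) b m⟩
  rw [eq_top_iff]
  rintro x -
  induction x using IsBaseChange.inductionOn h with
  | zero => exact zero_mem _
  | tmul m => exact Submodule.subset_span ⟨m, rfl⟩
  | smul a n hn => exact Submodule.smul_mem _ _ hn
  | add x y hx hy => exact add_mem hx hy

theorem IsBaseChangeAlong.ext {τ : A' →+* A''} (h : IsBaseChangeAlong θ u)
    {g g' : M' →ₛₗ[τ] M''} (hg : ∀ m, g (u m) = g' (u m)) (x : M') : g x = g' x := by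
  have hx : x ∈ Submodule.span A' (Set.range u) := h.span_range ▸ Submodule.mem_top
  induction hx using Submodule.span_induction with
  | mem _ hx => obtain ⟨m, rfl⟩ := hx; exact hg m
  | zero => simp
  | add x y _ _ hx hy => rw [map_add, map_add, hx, hy]
  | smul a x _ hx => rw [map_smulₛₗ, map_smulₛₗ, hx]

/-- A base change can be recognized by its universal property, tested on `A' ⊗ M`. -/
theorem IsBaseChangeAlong.of_section (hspan : Submodule.span A' (Set.range u) = ⊤)
    (hlift : ∀ (P : Type) [AddCommGroup P] [Module A' P] (g : M →ₛₗ[θ] P),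
      ∃ g' : M' →ₗ[A'] P, ∀ m, g' (u m) = g m) : IsBaseChangeAlong θ u := by
  let : Algebra A A' := θ.toAlgebra
  let : Module A M' := Module.compHom M' θ
  have : IsScalarTower A A' M' := ⟨fun a b m => mul_smul (θ a) b m⟩
  obtain ⟨g, hg⟩ := hlift (TensorProduct A A' M)
    { toFun := fun m => 1 ⊗ₜ[A] m
      map_add' := fun x y => TensorProduct.tmul_add _ _ _
      map_smul' := fun a m => by
        rw [TensorProduct.tmul_smul, ← algebraMap_smul A' a]; rfl }
  set u' : M →ₗ[A] M' :=
    { toFun := u, map_add' := map_add u, map_smul' := fun a m => map_smulₛₗ u a m } with hu'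
  let f : TensorProduct A A' M →ₗ[A'] M' :=
    (TensorProduct.isBaseChange A M A').lift u'
  have hf : ∀ m, f (1 ⊗ₜ m) = u m := fun m =>
    (TensorProduct.isBaseChange A M A').lift_eq u' m
  -- An endomorphism of M' is determined on the image of u, which spans, and one of the tensor
  -- product on the elements 1 ⊗ m. So both composites are identities.
  have hfg : f ∘ₗ g = LinearMap.id := by
    refine LinearMap.ext_on_range (v := fun m => u m) hspan fun m => ?_
    change f (g (u m)) = u m
    rw [hg]; exact hf m
  have hgf : g ∘ₗ f = LinearMap.id := by
    refine (TensorProduct.isBaseChange A M A').algHom_ext _ _ fun m => ?_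
    change g (f (1 ⊗ₜ m)) = 1 ⊗ₜ m
    rw [hf, hg]; rfl
  exact IsBaseChange.of_equiv (LinearEquiv.ofLinearMap f g hfg hgf) hf

theorem IsBaseChangeAlong.comp {θ' : A' →+* A''} {θ'' : A →+* A''} {u' : M' →ₛₗ[θ'] M''}
    {u'' : M →ₛₗ[θ''] M''} (h : IsBaseChangeAlong θ u) (h' : IsBaseChangeAlong θ' u')
    (hθ : ∀ a, θ'' a = θ' (θ a)) (hu : ∀ m, u'' m = u' (u m)) : IsBaseChangeAlong θ'' u'' := by
  obtain rfl : θ'' = θ'.comp θ := RingHom.ext hθ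
  refine .of_section ?_ fun P _ _ g => ?_
  · rw [eq_top_iff, ← h'.span_range, Submodule.span_le]
    rintro _ ⟨x, rfl⟩
    have hx : x ∈ Submodule.span A' (Set.range u) := h.span_range ▸ Submodule.mem_top
    induction hx using Submodule.span_induction with
    | mem _ hx => obtain ⟨m, rfl⟩ := hx; exact Submodule.subset_span ⟨m, hu m⟩
    | zero => simp
    | add x y _ _ hx hy => rw [map_add]; exact add_mem hx hy
    | smul a x _ hx => rw [map_smulₛₗ]; exact Submodule.smul_mem _ _ hx
  · let : Module A' P := Module.compHom P θ'
    obtain ⟨g₁, hg₁⟩ := h.exists_lift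
      ({ toFun := g, map_add' := map_add g, map_smul' := fun a m => map_smulₛₗ g a m } :
        M →ₛₗ[θ] P)
    obtain ⟨g₂, hg₂⟩ := h'.exists_lift
      ({ toFun := g₁, map_add' := map_add g₁, map_smul' := fun a m => map_smul g₁ a m } :
        M' →ₛₗ[θ'] P)
    refine ⟨g₂, fun m => ?_⟩
    rw [hu, hg₂]
    exact hg₁ m

/-- Cancellation: a lift built from the composite agrees with g because both are determined by their
values on the image of u. This is what makes the restriction maps of a pulled back sheaf
localizations again. -/
theorem IsBaseChangeAlong.of_comp {θ' : A' →+* A''} {θ'' : A →+* A''} {u' : M' →ₛₗ[θ'] M''}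
    {u'' : M →ₛₗ[θ''] M''} (h : IsBaseChangeAlong θ u) (h'' : IsBaseChangeAlong θ'' u'')
    (hθ : ∀ a, θ'' a = θ' (θ a)) (hu : ∀ m, u'' m = u' (u m)) : IsBaseChangeAlong θ' u' := by
  obtain rfl : θ'' = θ'.comp θ := RingHom.ext hθ
  refine .of_section ?_ fun P _ _ g => ?_
  · rw [eq_top_iff, ← h''.span_range]
    refine Submodule.span_mono ?_
    rintro _ ⟨x, rfl⟩
    exact ⟨u x, (hu x).symm⟩
  · obtain ⟨g₂, hg₂⟩ := h''.exists_lift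
      ({ toFun := fun m => g (u m)
         map_add' := fun x y => by simp
         map_smul' := fun a m => by rw [map_smulₛₗ, map_smulₛₗ]; rfl } : M →ₛₗ[θ'.comp θ] P)
    refine ⟨g₂, fun m => ?_⟩
    let : Module A' P := Module.compHom P θ'
    refine h.ext (g := ({ toFun := fun x => g₂ (u' x)
                          map_add' := fun x y => by simp
                          map_smul' := fun a m => by
                            rw [map_smulₛₗ, map_smul]; rfl } : M' →ₗ[A'] P))
      (g' := ({ toFun := g
                map_add' := map_add g
                map_smul' := fun a m => map_smulₛₗ g a m } : M' →ₗ[A'] P)) (fun x => ?_) m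
    change g₂ (u' (u x)) = g (u x)
    rw [← hu, hg₂]; rfl

theorem IsBaseChangeAlong.exists_equiv {N' : Type} [AddCommGroup N'] [Module A' N']
    {u₁ : M →ₛₗ[θ] N'} (h : IsBaseChangeAlong θ u) (h₁ : IsBaseChangeAlong θ u₁) :
    ∃ e : M' ≃ₗ[A'] N', ∀ m, e (u m) = u₁ m := by
  obtain ⟨f, hf⟩ := h.exists_lift u₁
  obtain ⟨g, hg⟩ := h₁.exists_lift u
  refine ⟨LinearEquiv.ofLinearMap f g ?_ ?_, hf⟩
  · exact LinearMap.ext fun x => h₁.ext (g := f ∘ₗ g) (g' := LinearMap.id)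
      (fun m => by simp [hg, hf]) x
  · exact LinearMap.ext fun x => h.ext (g := g ∘ₗ f) (g' := LinearMap.id)
      (fun m => by simp [hg, hf]) x

theorem IsBaseChangeAlong.equiv_comp {N' : Type} [AddCommGroup N'] [Module A' N']
    {u₁ : M →ₛₗ[θ] N'} (h : IsBaseChangeAlong θ u) (e : M' ≃ₗ[A'] N')
    (he : ∀ m, e (u m) = u₁ m) : IsBaseChangeAlong θ u₁ := by
  refine .of_section ?_ fun P _ _ g => ?_
  · have : Set.range u₁ = e '' Set.range u := by
      rw [← Set.range_comp]; exact congrArg Set.range (funext fun m => (he m).symm)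
    rw [this, ← LinearEquiv.coe_coe, Submodule.span_image, h.span_range, Submodule.map_top,
      LinearEquiv.range]
  · obtain ⟨g', hg'⟩ := h.exists_lift g
    exact ⟨g' ∘ₗ e.symm.toLinearMap, fun m => by simp [← he, hg']⟩

/-- Direct summands of free modules are compatible with base change. -/
theorem IsBaseChangeAlong.of_retract {ι : Type} [Fintype ι] [DecidableEq ι]
    {i : M → ι → A} {p : (ι → A) →ₗ[A] M} {i' : M' → ι → A'} {p' : (ι → A') →ₗ[A'] M'}
    (hpi : ∀ m, p (i m) = m) (hpi' : ∀ m, p' (i' m) = m) (hi'add : ∀ x y, i' (x + y) = i' x + i' y)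
    (hi'smul : ∀ (a : A') x, i' (a • x) = a • i' x)
    (hi : ∀ m b, i' (u m) b = θ (i m b)) (hp : ∀ x, p' (fun b => θ (x b)) = u (p x)) :
    IsBaseChangeAlong θ u := by
  have hsingle : ∀ b, p' (Pi.single b 1) = u (p (Pi.single b 1)) := fun b => by
    rw [← hp]
    congr 1
    ext c
    by_cases hc : c = b
    · subst hc; simp
    · simp [hc]
  have hdec : ∀ x : ι → A', p' x = ∑ b, x b • u (p (Pi.single b 1)) := fun x => by
    conv_lhs => rw [pi_eq_sum_univ x, map_sum]
    refine Finset.sum_congr rfl fun b _ => ?_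
    rw [map_smul, ← hsingle]
    congr 2
    ext c
    simp [Pi.single_apply, eq_comm]
  refine .of_section ?_ fun P _ _ g => ?_
  · rw [eq_top_iff]
    rintro x -
    rw [← hpi' x, hdec]
    exact sum_mem fun b _ => Submodule.smul_mem _ _ (Submodule.subset_span ⟨_, rfl⟩)
  -- The lift is forced: expand x by its coordinates i' x in the generators u (p e_b), and send
  -- these to g (p e_b).
  · refine ⟨{ toFun := fun x => ∑ b, i' x b • g (p (Pi.single b 1))
              map_add' := fun x y => by simp [hi'add, add_smul, Finset.sum_add_distrib]
              map_smul' := fun a x => by simp [hi'smul, Finset.smul_sum, mul_smul] },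
      fun m => ?_⟩
    change ∑ b, i' (u m) b • g (p (Pi.single b 1)) = g m
    conv_rhs => rw [← hpi m, pi_eq_sum_univ (i m), map_sum, map_sum]
    refine Finset.sum_congr rfl fun b _ => ?_
    rw [map_smul, map_smulₛₗ, hi]
    congr 3
    ext c
    simp [Pi.single_apply, eq_comm]

theorem IsBaseChangeAlong.pi (ι : Type) [Finite ι] (θ : A →+* A')
    (u : (ι → A) →ₛₗ[θ] (ι → A')) (hu : ∀ x b, u x b = θ (x b)) : IsBaseChangeAlong θ u := by
  classical
  cases nonempty_fintype ι
  exact .of_retract (i := id) (p := LinearMap.id) (i' := id) (p' := LinearMap.id)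
    (fun _ => rfl) (fun _ => rfl) (fun _ _ => rfl) (fun _ _ => rfl) (fun m b => hu m b)
    (fun x => funext fun b => (hu x b).symm)

theorem IsBaseChangeAlong.exists_of_surjective (h : IsBaseChangeAlong θ u)
    (hθ : Function.Surjective θ) : Function.Surjective u := by
  intro x
  have hx : x ∈ Submodule.span A' (Set.range u) := h.span_range ▸ Submodule.mem_top
  induction hx using Submodule.span_induction with
  | mem _ hx => exact hx
  | zero => exact ⟨0, map_zero u⟩
  | add x y _ _ hx hy =>
    obtain ⟨m, rfl⟩ := hx
    obtain ⟨n, rfl⟩ := hy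
    exact ⟨m + n, map_add u _ _⟩
  | smul a x _ hx =>
    obtain ⟨m, rfl⟩ := hx
    obtain ⟨b, rfl⟩ := hθ a
    exact ⟨b • m, map_smulₛₗ u _ _⟩

/-- Since θ is onto, M / (ker θ) M is a module over A', so the quotient map factors through u.
Applied to closed points, this identifies what vanishes in a fibre. -/
theorem IsBaseChangeAlong.mem_smul_of_eq_zero (h : IsBaseChangeAlong θ u)
    (hθ : Function.Surjective θ) {m : M} (hm : u m = 0) :
    m ∈ RingHom.ker θ • (⊤ : Submodule A M) := by
  set W : Submodule A M := RingHom.ker θ • (⊤ : Submodule A M)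
  let : SMul A' (M ⧸ W) := ⟨fun a x => (hθ a).choose • x⟩
  have key : ∀ (a : A) (x : M ⧸ W), θ a • x = a • x := fun a x => by
    change (hθ (θ a)).choose • x = a • x
    obtain ⟨x, rfl⟩ := W.mkQ_surjective x
    rw [← map_smul, ← map_smul, ← sub_eq_zero, ← map_sub, ← sub_smul, Submodule.mkQ_apply,
      Submodule.Quotient.mk_eq_zero]
    refine Submodule.smul_mem_smul ?_ Submodule.mem_top
    rw [RingHom.mem_ker, map_sub, (hθ (θ a)).choose_spec, sub_self]
  let : Module A' (M ⧸ W) := Function.Surjective.moduleLeft θ hθ key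
  obtain ⟨g, hg⟩ := h.exists_lift
    ({ toFun := W.mkQ, map_add' := map_add _, map_smul' := fun a m => by
        rw [map_smul, key] } : M →ₛₗ[θ] M ⧸ W)
  have := hg m
  rw [hm, map_zero] at this
  exact (Submodule.Quotient.mk_eq_zero W).mp this.symm

/-- `θ : A → A'` behaves like the localization of `A` at all elements that become invertible. -/
def IsUnitLocalization (θ : A →+* A') : Prop :=
  Function.Injective θ ∧ ∀ x : A', ∃ a b : A, IsUnit (θ a) ∧ θ b = θ a * x

/-- Here A' is the localization of A at the elements that θ makes invertible, and a localized module
is the same as a base change to the localized ring. The right hand side has the form of the axioms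
of `QCoh`, so restriction maps can be handled by universal properties. -/
theorem IsUnitLocalization.isBaseChangeAlong_iff (hθ : IsUnitLocalization θ) :
    IsBaseChangeAlong θ u ↔ (∀ x : M', ∃ a : A, IsUnit (θ a) ∧ ∃ m, u m = θ a • x) ∧
      ∀ m : M, u m = 0 → ∃ a : A, IsUnit (θ a) ∧ a • m = 0 := by
  let : Algebra A A' := θ.toAlgebra
  let : Module A M' := Module.compHom M' θ
  have : IsScalarTower A A' M' := ⟨fun a b m => mul_smul (θ a) b m⟩
  let S : Submonoid A := (IsUnit.submonoid A').comap θ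
  have : IsLocalization S A' :=
    { map_units := fun s => s.2
      surj := fun x => by
        obtain ⟨a, b, ha, hb⟩ := hθ.2 x
        exact ⟨(b, ⟨a, ha⟩), (mul_comm _ _).trans hb.symm⟩
      exists_of_eq := fun {a b} hab => ⟨1, by rw [hθ.1 hab]⟩ }
  refine (isLocalizedModule_iff_isBaseChange S A'
    ({ toFun := u, map_add' := map_add u, map_smul' := fun a m => map_smulₛₗ u a m } :
      M →ₗ[A] M')).symm.trans ⟨fun h => ⟨fun x => ?_, fun m hm => ?_⟩, fun h => ?_⟩
  · obtain ⟨⟨m, s⟩, hms⟩ := h.surj x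
    exact ⟨s.1, s.2, m, hms.symm⟩
  · obtain ⟨s, hs⟩ := h.exists_of_eq (x₁ := m) (x₂ := 0) (hm.trans (map_zero u).symm)
    exact ⟨s.1, s.2, by rw [smul_zero] at hs; exact hs⟩
  · refine ⟨fun s => ?_, fun x => ?_, fun {x y} hxy => ?_⟩
    · rw [Module.End.isUnit_iff]
      refine ⟨fun x y hxy => ?_, fun y => ?_⟩
      · exact s.2.smul_left_cancel.mp hxy
      · obtain ⟨c, hc⟩ := IsUnit.exists_right_inv (a := θ s.1) s.2
        exact ⟨c • y, by
          change θ s.1 • c • y = y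
          rw [smul_smul, hc, one_smul]⟩
    · obtain ⟨a, ha, m, hm⟩ := h.1 x
      exact ⟨(m, ⟨a, ha⟩), hm.symm⟩
    · obtain ⟨a, ha, hm⟩ := h.2 (x - y) (by
        rw [map_sub, sub_eq_zero]; exact hxy)
      exact ⟨⟨a, ha⟩, sub_eq_zero.mp ((smul_sub a x y).symm.trans hm)⟩

theorem IsBaseChangeAlong.projective (h : IsBaseChangeAlong θ u) [Module.Finite A M]
    [Module.Projective A M] {r : ℕ} (hr : ∀ p, Module.rankAtStalk (R := A) M p = r) :
    Module.Finite A' M' ∧ Module.Projective A' M' ∧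
      ∀ p, Module.rankAtStalk (R := A') M' p = r := by
  let : Algebra A A' := θ.toAlgebra
  let : Module A M' := Module.compHom M' θ
  have : IsScalarTower A A' M' := ⟨fun a b m => mul_smul (θ a) b m⟩
  exact ⟨Module.Finite.equiv (IsBaseChange.equiv h), .of_equiv (IsBaseChange.equiv h),
    fun p => (Module.rankAtStalk_isBaseChange h p).trans (hr _)⟩

end BaseChangeAlong

/-! ### Ranks of projective modules -/

section Rank

variable {A M : Type} [CommRing A] [AddCommGroup M] [Module A M]

/-- A surjection from a free module onto a projective module of the same rank is injective. -/
theorem injective_of_surjective_of_rankAtStalk [Module.Projective A M] {r : ℕ}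
    (hr : ∀ p, Module.rankAtStalk (R := A) M p = r) (f : (Fin r → A) →ₗ[A] M)
    (hf : Function.Surjective f) : Function.Injective f := by
  have : Module.Finite A M := .of_surjective f hf
  obtain ⟨g, hg⟩ := Module.projective_lifting_property f LinearMap.id hf
  have hfg : ∀ m, f (g m) = m := fun m => LinearMap.congr_fun hg m
  -- The splitting g identifies the free module with M × K. So K is projective, and comparison of
  -- ranks gives it rank zero; hence it vanishes.
  let K := LinearMap.ker f
  let pr : (Fin r → A) →ₗ[A] K := LinearMap.codRestrict K (LinearMap.id - g ∘ₗ f)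
    fun x => by simp [K, hfg]
  have hpr : ∀ x : K, pr x = x := fun x => Subtype.ext (by
    have := x.2
    simp only [K, LinearMap.mem_ker] at this
    simp [pr, this])
  have : Module.Finite A K := .of_surjective pr fun x => ⟨x, hpr x⟩
  have : Module.Projective A K := .of_split K.subtype pr (LinearMap.ext hpr)
  let e : (Fin r → A) ≃ₗ[A] M × K := LinearEquiv.ofLinearMap (f.prod pr)
    (g.coprod K.subtype) (by
      ext x
      · simp [hfg]
      · simp [pr, hfg]
      · simp
      · simp [hpr]) (by
      refine LinearMap.ext fun x => ?_
      simp [pr])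
  have hK : ∀ p, Module.rankAtStalk (R := A) K p = 0 := fun p => by
    have : Nontrivial A := p.nontrivial
    have h := congrFun (Module.rankAtStalk_eq_of_equiv e) p
    rw [Module.rankAtStalk_prod, Pi.add_apply, hr] at h
    simp at h
    exact h
  have := Module.rankAtStalk_eq_zero_iff_subsingleton.mp (funext hK)
  rw [← LinearMap.ker_eq_bot]
  exact (Submodule.subsingleton_iff_eq_bot).mp this

/-- Localization at p turns c into a unit, and f and g into mutually inverse maps up to that unit.
Thus the local rank is found from globally defined maps, without choosing local trivializations. -/
theorem rankAtStalk_eq_of_comp_eq_smul {r : ℕ} (p : PrimeSpectrum A) {c : A} (hc : c ∉ p.asIdeal)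
    (f : M →ₗ[A] (Fin r → A)) (g : (Fin r → A) →ₗ[A] M) (hfg : ∀ x, f (g x) = c • x)
    (hgf : ∀ x, g (f x) = c • x) : Module.rankAtStalk (R := A) M p = r := by
  let S := p.asIdeal.primeCompl
  let As := Localization.AtPrime p.asIdeal
  have : Nontrivial A := p.nontrivial
  have hr : Module.rankAtStalk (R := A) (Fin r → A) p = r := by simp
  rw [← hr]
  let F := LocalizedModule.map S f
  let G := LocalizedModule.map S g
  have hu : IsUnit (algebraMap A As c) := IsLocalization.map_units As (⟨c, hc⟩ : S)
  have key : ∀ (N : Type) [AddCommGroup N] [Module A N] (h : N →ₗ[A] N), (∀ x, h x = c • x) →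
      ∀ x, LocalizedModule.map S h x = algebraMap A As c • x := by
    intro N _ _ h hh x
    have : h = c • LinearMap.id := LinearMap.ext hh
    rw [this, map_smul]
    rw [LinearMap.smul_apply, LocalizedModule.map_id, algebraMap_smul]
    rfl
  have hGF : ∀ x, G (F x) = algebraMap A As c • x := fun x => by
    rw [← key M (g ∘ₗ f) hgf x]
    induction x using LocalizedModule.induction_on with
    | h m s => simp [F, G, LocalizedModule.map_mk]
  have hFG : ∀ x, F (G x) = algebraMap A As c • x := fun x => by
    rw [← key _ (f ∘ₗ g) hfg x]
    induction x using LocalizedModule.induction_on with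
    | h m s => simp [F, G, LocalizedModule.map_mk]
  have hbij : Function.Bijective F := by
    constructor
    · intro x y hxy
      have := congrArg G hxy
      rw [hGF, hGF] at this
      exact hu.smul_left_cancel.mp this
    · intro y
      obtain ⟨d, hd⟩ := hu.exists_right_inv
      exact ⟨G (d • y), by rw [hFG, smul_smul, hd, one_smul]⟩
  exact (LinearEquiv.ofBijective F hbij).finrank_eq

end Rank

/-! ### Jets, interpolation and the coordinate rings of the charts -/

section RingLemmas

variable (D : Divisor) (R : Type) [CommRing R] [Algebra ℂ R]

/-- The polynomial `∏ (z - P_i) ^ n_i`, a generator of the conductor. -/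
def fatPoly : R[X] := ∏ i, (X - C (algebraMap ℂ R (D.P i))) ^ D.n i

theorem monic_nodePoly : (nodePoly D R).Monic :=
  monic_prod_of_monic _ _ fun _ _ => monic_X_sub_C _

theorem monic_fatPoly : (fatPoly D R).Monic :=
  monic_prod_of_monic _ _ fun _ _ => (monic_X_sub_C _).pow _

theorem natDegree_nodePoly [Nontrivial R] : (nodePoly D R).natDegree = D.k + 1 := by
  rw [nodePoly, natDegree_prod_of_monic _ _ fun _ _ => monic_X_sub_C _]
  simp

theorem natDegree_fatPoly [Nontrivial R] : (fatPoly D R).natDegree = ∑ i, D.n i := by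
  rw [fatPoly, natDegree_prod_of_monic _ _ fun _ _ => (monic_X_sub_C _).pow _]
  refine Finset.sum_congr rfl fun i _ => ?_
  rw [(monic_X_sub_C _).natDegree_pow, natDegree_X_sub_C, mul_one]

variable {R}

theorem isCoprime_X_sub_C {i j : Fin (D.k + 1)} (hij : i ≠ j) :
    IsCoprime (X - C (algebraMap ℂ R (D.P i))) (X - C (algebraMap ℂ R (D.P j))) := by
  refine isCoprime_X_sub_C_of_isUnit_sub ?_
  rw [← map_sub]
  exact (IsUnit.mk0 _ (sub_ne_zero.mpr (D.P_injective.ne hij))).map _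

/-- Translation moves a to 0, where divisibility is read off the Taylor coefficients. The l-th
derivative is l! times the l-th Hasse derivative, and l! is a unit in a ℂ-algebra. -/
theorem X_sub_C_pow_dvd_iff (a : R) (n : ℕ) (f : R[X]) :
    (X - C a) ^ n ∣ f ↔ ∀ l < n, (derivative^[l] f).eval a = 0 := by
  have h1 : (X - C a) ^ n ∣ f ↔ X ^ n ∣ taylor a f := by
    rw [← map_dvd_iff (taylorEquiv a)]
    simp [taylorEquiv]
  rw [h1, X_pow_dvd_iff]
  refine forall₂_congr fun l _ => ?_
  rw [taylor_coeff]
  have h2 : (derivative^[l] f).eval a = algebraMap ℂ R (l.factorial : ℂ) * (hasseDeriv l f).eval a := by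
    have := congrArg (eval a) (congrFun (factorial_smul_hasseDeriv (R := R) l) f)
    rw [← this]
    simp [nsmul_eq_mul]
  rw [h2]
  have hu : IsUnit (algebraMap ℂ R (l.factorial : ℂ)) :=
    (IsUnit.mk0 _ (Nat.cast_ne_zero.mpr l.factorial_ne_zero)).map _
  exact (hu.mul_right_eq_zero).symm

theorem jet_eq_zero_iff (f : R[X]) :
    (∀ i l, l < D.n i → jet D R i l f = 0) ↔ fatPoly D R ∣ f := by
  constructor
  · intro h
    refine Finset.prod_dvd_of_coprime (fun i _ j _ hij => ?_) fun i _ => ?_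
    · exact (isCoprime_X_sub_C D hij).pow
    · exact (X_sub_C_pow_dvd_iff _ _ _).mpr fun l hl => h i l hl
  · intro h i
    exact (X_sub_C_pow_dvd_iff _ _ _).mp
      ((Finset.dvd_prod_of_mem (fun i => (X - C (algebraMap ℂ R (D.P i))) ^ D.n i)
        (Finset.mem_univ i)).trans h)

theorem jet_sub (i : Fin (D.k + 1)) (l : ℕ) (f g : R[X]) :
    jet D R i l (f - g) = jet D R i l f - jet D R i l g := by
  rw [eq_sub_iff_add_eq, ← jet_add, sub_add_cancel]

theorem jet_C (i : Fin (D.k + 1)) (l : ℕ) (c : R) :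
    jet D R i l (C c) = if l = 0 then c else 0 := by
  obtain _ | l := l
  · simp [jet]
  · simp [jet]

theorem jet_fatPoly_mul (i : Fin (D.k + 1)) (l : ℕ) (hl : l < D.n i) (f : R[X]) :
    jet D R i l (fatPoly D R * f) = 0 :=
  (jet_eq_zero_iff D _).mpr (dvd_mul_right _ _) i l hl

/-- Hermite interpolation. -/
theorem exists_jet_eq (c : Fin (D.k + 1) → ℕ → R) :
    ∃ f : R[X], ∀ i l, l < D.n i → jet D R i l f = c i l := by
  -- The Taylor polynomial at P_i with the required derivatives. The powers (z - P_i)^{n_i} are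
  -- pairwise coprime, so one f is congruent to all of these.
  let g : Fin (D.k + 1) → R[X] := fun i =>
    ∑ l ∈ Finset.range (D.n i), C (algebraMap ℂ R ((l.factorial : ℂ)⁻¹) * c i l) *
      (X - C (algebraMap ℂ R (D.P i))) ^ l
  obtain ⟨f, hf⟩ := Ideal.exists_forall_sub_mem_ideal
    (I := fun i => Ideal.span {(X - C (algebraMap ℂ R (D.P i))) ^ D.n i})
    (fun i j hij => (Ideal.isCoprime_span_singleton_iff _ _).mpr (isCoprime_X_sub_C D hij).pow) g
  refine ⟨f, fun i l hl => ?_⟩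
  have h1 := (X_sub_C_pow_dvd_iff _ _ _).mp (Ideal.mem_span_singleton.mp (hf i)) l hl
  have h2 : jet D R i l f = jet D R i l (g i) := by
    rw [← sub_eq_zero, ← jet_sub]; exact h1
  rw [h2]
  have h3 : ∀ m, jet D R i l (C (algebraMap ℂ R ((m.factorial : ℂ)⁻¹) * c i m) *
      (X - C (algebraMap ℂ R (D.P i))) ^ m) = if m = l then c i m else 0 := by
    intro m
    rw [jet, iterate_derivative_C_mul, eval_mul, eval_C, iterate_derivative_X_sub_pow]
    split_ifs with hm
    · subst hm
      simp only [Nat.descFactorial_self, tsub_self, pow_zero, nsmul_eq_mul, mul_one, eval_natCast]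
      rw [mul_right_comm, ← map_natCast (algebraMap ℂ R), ← map_mul,
        inv_mul_cancel₀ (Nat.cast_ne_zero.mpr m.factorial_ne_zero), map_one, one_mul]
    · rcases lt_or_gt_of_ne hm with h | h
      · simp [Nat.descFactorial_of_lt h]
      · simp [Nat.sub_ne_zero_of_lt h]
  have h4 : ∀ (s : Finset ℕ) (F : ℕ → R[X]),
      jet D R i l (∑ m ∈ s, F m) = ∑ m ∈ s, jet D R i l (F m) := fun s F => by
    simp [jet, iterate_derivative_sum, eval_finsetSum]
  rw [h4, Finset.sum_congr rfl fun m _ => h3 m]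
  simp [hl]

theorem C_add_mul_fatPoly_mem (c : R) (g : R[X]) : C c + fatPoly D R * g ∈ affRing D R := by
  refine ⟨fun i j => ?_, fun i l h1 hl => ?_⟩
  · rw [jet_add, jet_add, jet_fatPoly_mul _ _ _ (D.n_pos _), jet_fatPoly_mul _ _ _ (D.n_pos _),
      jet_C, jet_C]
  · rw [jet_add, jet_fatPoly_mul _ _ _ hl, jet_C, if_neg (by omega), zero_add]

theorem fatPoly_mul_mem (g : R[X]) : fatPoly D R * g ∈ affRing D R := by
  simpa using C_add_mul_fatPoly_mem D 0 g

/-- Subtracting the common value at the P_i leaves a polynomial whose jets along D vanish. All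
computations on the singular chart use this decomposition R + Q R[z]. -/
theorem mem_affRing_iff (f : R[X]) :
    f ∈ affRing D R ↔ ∃ g, f = C (jet D R 0 0 f) + fatPoly D R * g := by
  constructor
  · rintro ⟨h1, h2⟩
    obtain ⟨g, hg⟩ : fatPoly D R ∣ f - C (jet D R 0 0 f) := by
      refine (jet_eq_zero_iff D _).mp fun i l hl => ?_
      rw [jet_sub, jet_C]
      split_ifs with h
      · subst h; rw [h1 i 0, sub_self]
      · rw [h2 i l (by omega) hl, sub_zero]
    exact ⟨g, by rw [← hg]; ring⟩
  · rintro ⟨g, hg⟩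
    rw [hg]
    exact C_add_mul_fatPoly_mem D _ g

theorem isUnit_algebraMap_nodePoly :
    IsUnit (algebraMap R[X] (overlapRing D R) (nodePoly D R)) :=
  IsLocalization.Away.algebraMap_isUnit (nodePoly D R)

theorem algebraMap_overlapRing_injective :
    Function.Injective (algebraMap R[X] (overlapRing D R)) :=
  IsLocalization.injective (M := Submonoid.powers (nodePoly D R)) _
    (Submonoid.powers_le.mpr (mem_nonZeroDivisors_iff_right.mpr fun x hx =>
      (monic_nodePoly D R).mul_left_eq_zero_iff.mp hx))

variable (R) in
/-- The function `1 / q` on the overlap. -/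
def nodeInv : overlapRing D R := ↑(isUnit_algebraMap_nodePoly (R := R) D).unit⁻¹

theorem algebraMap_nodePoly_mul_nodeInv :
    algebraMap R[X] (overlapRing D R) (nodePoly D R) * nodeInv D R = 1 :=
  (isUnit_algebraMap_nodePoly D).mul_val_inv

theorem algebraMap_nodePoly_pow_mul_nodeInv_pow (n : ℕ) :
    algebraMap R[X] (overlapRing D R) (nodePoly D R) ^ n * nodeInv D R ^ n = 1 := by
  rw [← mul_pow, algebraMap_nodePoly_mul_nodeInv, one_pow]

theorem isUnit_nodeInv : IsUnit (nodeInv D R) := Units.isUnit _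

theorem exists_eq_nodeInv_pow_mul (x : overlapRing D R) :
    ∃ (n : ℕ) (f : R[X]), x = nodeInv D R ^ n * algebraMap R[X] (overlapRing D R) f := by
  obtain ⟨m, g, hg⟩ := IsLocalization.Away.surj (nodePoly D R) x
  refine ⟨m, g, ?_⟩
  rw [← hg]
  linear_combination -x * algebraMap_nodePoly_pow_mul_nodeInv_pow D m (R := R)

theorem mem_infRing_iff (x : overlapRing D R) :
    x ∈ infRing D R ↔ ∃ (n : ℕ) (f : R[X]), f.natDegree ≤ n * (D.k + 1) ∧
      x = nodeInv D R ^ n * algebraMap R[X] (overlapRing D R) f := by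
  constructor
  · rintro ⟨m, f, hf, hx⟩
    refine ⟨m, f, hf, ?_⟩
    rw [← hx, map_pow]
    linear_combination -x * algebraMap_nodePoly_pow_mul_nodeInv_pow D m (R := R)
  · rintro ⟨m, f, hf, rfl⟩
    refine ⟨m, f, hf, ?_⟩
    rw [map_pow]
    linear_combination (algebraMap R[X] (overlapRing D R) f) *
      algebraMap_nodePoly_pow_mul_nodeInv_pow D m (R := R)

theorem nodeInv_pow_mul_mem {n : ℕ} {f : R[X]} (h : f.natDegree ≤ n * (D.k + 1)) :
    nodeInv D R ^ n * algebraMap R[X] (overlapRing D R) f ∈ infRing D R :=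
  (mem_infRing_iff D _).mpr ⟨n, f, h, rfl⟩

theorem nodeInv_mem : nodeInv D R ∈ infRing D R := by
  simpa using nodeInv_pow_mul_mem D (R := R) (n := 1) (f := 1) (by simp)

theorem exists_nodeInv_pow_mul_mem {ι : Type} [Finite ι] (x : ι → overlapRing D R) :
    ∃ e, ∀ e' ≥ e, ∀ i, nodeInv D R ^ e' * x i ∈ infRing D R := by
  cases nonempty_fintype ι
  choose n f hf using fun i => exists_eq_nodeInv_pow_mul D (x i)
  refine ⟨∑ i, (f i).natDegree, fun e' he' i => ?_⟩
  rw [hf, ← mul_assoc, ← pow_add]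
  refine nodeInv_pow_mul_mem D ?_
  have : (f i).natDegree ≤ ∑ i, (f i).natDegree :=
    Finset.single_le_sum (f := fun i => (f i).natDegree) (fun _ _ => Nat.zero_le _)
      (Finset.mem_univ i)
  nlinarith [Nat.zero_le (n i * (D.k + 1)), Nat.zero_le (e' * D.k)]

theorem exists_nodePoly_pow_mul_eq {ι : Type} [Finite ι] (x : ι → overlapRing D R) :
    ∃ e, ∀ i, ∃ f : R[X], algebraMap R[X] (overlapRing D R) (nodePoly D R ^ e) * x i =
      algebraMap R[X] (overlapRing D R) f := by
  cases nonempty_fintype ι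
  choose n f hf using fun i => exists_eq_nodeInv_pow_mul D (x i)
  refine ⟨∑ i, n i, fun i => ⟨nodePoly D R ^ (∑ j, n j - n i) * f i, ?_⟩⟩
  have : n i ≤ ∑ i, n i :=
    Finset.single_le_sum (f := n) (fun _ _ => Nat.zero_le _) (Finset.mem_univ i)
  obtain ⟨m, hm⟩ := Nat.exists_eq_add_of_le this
  rw [hm, Nat.add_sub_cancel_left, hf, map_mul, map_pow, map_pow, pow_add]
  linear_combination (algebraMap R[X] (overlapRing D R) (nodePoly D R)) ^ m *
    algebraMap R[X] (overlapRing D R) (f i) *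
    algebraMap_nodePoly_pow_mul_nodeInv_pow D (n i) (R := R)

/-- A polynomial which is regular at infinity is constant. -/
theorem eq_C_of_algebraMap_mem {f : R[X]}
    (h : algebraMap R[X] (overlapRing D R) f ∈ infRing D R) : ∃ c, f = C c := by
  nontriviality R
  obtain ⟨m, g, hg, hf⟩ := h
  rw [← map_mul] at hf
  have := algebraMap_overlapRing_injective D hf
  refine ⟨f.coeff 0, eq_C_of_natDegree_eq_zero ?_⟩
  by_cases hf0 : f = 0
  · simp [hf0]
  -- The product q^m f has degree m (k + 1) + deg f because q is monic; regularity at infinity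
  -- allows at most m (k + 1).
  have h1 := ((monic_nodePoly D R).pow m).natDegree_mul' hf0
  rw [this, (monic_nodePoly D R).natDegree_pow, natDegree_nodePoly] at h1
  omega

theorem isUnitLocalization_affToOverlap : IsUnitLocalization (affToOverlap D R) := by
  refine ⟨fun a b h => Subtype.ext (algebraMap_overlapRing_injective D h), fun x => ?_⟩
  obtain ⟨a, f, ha, hf, h⟩ := exists_aff_mul D x
  obtain ⟨g, rfl⟩ := (jet_eq_zero_iff D f).mp hf
  exact ⟨a, ⟨_, fatPoly_mul_mem D g⟩, ha, h⟩

theorem isUnitLocalization_infToOverlap : IsUnitLocalization (infToOverlap D R) := by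
  refine ⟨fun a b h => Subtype.ext h, fun x => ?_⟩
  obtain ⟨b, hb, h⟩ := exists_inf_mul D (fun _ : Unit => x)
  exact ⟨b, ⟨_, h ()⟩, hb, rfl⟩

/-- Every function on the overlap is the sum of a function in the conductor, a function vanishing to
order `e` along the divisor of `1 / q`, and a function in a finitely generated module. -/
theorem exists_overlap_decomposition (e : ℕ) (x : overlapRing D R) :
    ∃ (g h₁ h₂ : R[X]) (b : infRing D R), h₁.natDegree < ∑ i, D.n i + 1 ∧
      h₂.natDegree < e * (D.k + 1) + 1 ∧
      x = algebraMap R[X] (overlapRing D R) (fatPoly D R * g) + nodeInv D R ^ e * b.1 +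
        algebraMap R[X] (overlapRing D R) h₁ +
        nodeInv D R ^ e * algebraMap R[X] (overlapRing D R) h₂ := by
  rcases subsingleton_or_nontrivial R with _ | _
  · have := Module.subsingleton R (overlapRing D R)
    exact ⟨0, 0, 0, 0, by simp, by simp, Subsingleton.elim _ _⟩
  obtain ⟨n, f, rfl⟩ := exists_eq_nodeInv_pow_mul D x
  have hq := monic_nodePoly D R
  have hdeg : ∀ (p : R[X]) {s : R[X]} (hs : s.Monic), (p %ₘ s).natDegree ≤ s.natDegree := fun p s hs =>
    natDegree_le_natDegree (degree_modByMonic_le _ hs)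
  have hqn : ∀ n, (nodePoly D R ^ n).natDegree = n * (D.k + 1) := fun n => by
    rw [hq.natDegree_pow, natDegree_nodePoly]
  -- Three successive divisions with remainder: by q^n, whose remainder over q^n is regular at
  -- infinity, then by q^e, then by Q. The factor q^e inserted here pays for the factor q^{-e} in
  -- front of b. For e = 0 the result is a polynomial plus a function regular at infinity, the
  -- vanishing of the first cohomology of the projective line.
  set f' := nodePoly D R ^ e * f
  set g := f' /ₘ nodePoly D R ^ n
  set g₁ := g /ₘ nodePoly D R ^ e
  refine ⟨g₁ /ₘ fatPoly D R, g₁ %ₘ fatPoly D R, g %ₘ nodePoly D R ^ e,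
    ⟨_, nodeInv_pow_mul_mem D (n := n) (f := f' %ₘ nodePoly D R ^ n)
      ((hdeg _ (hq.pow n)).trans (hqn n).le)⟩, ?_, ?_, ?_⟩
  · have := hdeg g₁ (monic_fatPoly D R)
    rw [natDegree_fatPoly] at this
    omega
  · have := hdeg g (hq.pow e)
    rw [hqn] at this
    omega
  · have e1 : f' = f' %ₘ nodePoly D R ^ n + nodePoly D R ^ n * g := (modByMonic_add_div _ _).symm
    have e2 : g = g %ₘ nodePoly D R ^ e + nodePoly D R ^ e * g₁ := (modByMonic_add_div _ _).symm
    have e3 : g₁ = g₁ %ₘ fatPoly D R + fatPoly D R * (g₁ /ₘ fatPoly D R) :=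
      (modByMonic_add_div _ _).symm
    have E0 : algebraMap R[X] (overlapRing D R) f' = algebraMap R[X] (overlapRing D R)
      (nodePoly D R) ^ e * algebraMap R[X] (overlapRing D R) f := by rw [map_mul, map_pow]
    have E1 := congrArg (algebraMap R[X] (overlapRing D R)) e1
    have E2 := congrArg (algebraMap R[X] (overlapRing D R)) e2
    have E3 := congrArg (algebraMap R[X] (overlapRing D R)) e3
    simp only [map_add, map_mul, map_pow] at E1 E2 E3
    rw [map_mul]
    dsimp only
    have u1 := algebraMap_nodePoly_pow_mul_nodeInv_pow D e (R := R)
    have u2 := algebraMap_nodePoly_pow_mul_nodeInv_pow D n (R := R)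
    generalize algebraMap R[X] (overlapRing D R) (nodePoly D R) ^ e = qe at *
    generalize algebraMap R[X] (overlapRing D R) (nodePoly D R) ^ n = qn at *
    generalize nodeInv D R ^ e = ve at *
    generalize nodeInv D R ^ n = vn at *
    generalize algebraMap R[X] (overlapRing D R) f' = F' at *
    generalize algebraMap R[X] (overlapRing D R) g = G at *
    generalize algebraMap R[X] (overlapRing D R) g₁ = G₁ at *
    linear_combination (-vn * algebraMap R[X] (overlapRing D R) f) * u1 - ve * vn * E0 +
      ve * vn * E1 + ve * E2 + E3 + G₁ * u1 + ve * G * u2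

end RingLemmas

/-! ### Functoriality of the coordinate rings -/

section BaseChangeRingLemmas

variable (D : Divisor) {R S T : Type} [CommRing R] [Algebra ℂ R] [CommRing S] [Algebra ℂ S]
  [CommRing T] [Algebra ℂ T] (φ : R →ₐ[ℂ] S) (ψ : S →ₐ[ℂ] T)

theorem fatPoly_map : (fatPoly D R).map φ.toRingHom = fatPoly D S := by
  simp [fatPoly, Polynomial.map_prod, Polynomial.map_pow]

theorem overlapMap_nodeInv : overlapMap D φ (nodeInv D R) = nodeInv D S := by
  have h1 := congrArg (overlapMap D φ) (algebraMap_nodePoly_mul_nodeInv D (R := R))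
  rw [map_mul, overlapMap_algebraMap, nodePoly_map, map_one] at h1
  have h2 := algebraMap_nodePoly_mul_nodeInv D (R := S)
  linear_combination nodeInv D S * h1 - overlapMap D φ (nodeInv D R) * h2

theorem affMap_comp (a : affRing D R) : affMap D (ψ.comp φ) a = affMap D ψ (affMap D φ a) :=
  Subtype.ext (Polynomial.map_map φ.toRingHom ψ.toRingHom a.1).symm

theorem overlapMap_comp (x : overlapRing D R) :
    overlapMap D (ψ.comp φ) x = overlapMap D ψ (overlapMap D φ x) := by
  obtain ⟨n, f, rfl⟩ := exists_eq_nodeInv_pow_mul D x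
  simp only [map_mul, map_pow, overlapMap_nodeInv, overlapMap_algebraMap]
  rw [Polynomial.map_map]
  rfl

theorem infMap_comp (a : infRing D R) : infMap D (ψ.comp φ) a = infMap D ψ (infMap D φ a) :=
  Subtype.ext (overlapMap_comp D φ ψ a.1)

theorem affMap_id (a : affRing D R) : affMap D (AlgHom.id ℂ R) a = a :=
  Subtype.ext (Polynomial.map_id)

theorem overlapMap_id (x : overlapRing D R) : overlapMap D (AlgHom.id ℂ R) x = x := by
  obtain ⟨n, f, rfl⟩ := exists_eq_nodeInv_pow_mul D x
  simp only [map_mul, map_pow, overlapMap_nodeInv, overlapMap_algebraMap]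
  exact congrArg _ (congrArg _ Polynomial.map_id)

theorem infMap_id (a : infRing D R) : infMap D (AlgHom.id ℂ R) a = a :=
  Subtype.ext (overlapMap_id D a.1)

theorem affToOverlap_affMap (a : affRing D R) :
    affToOverlap D S (affMap D φ a) = overlapMap D φ (affToOverlap D R a) :=
  (overlapMap_algebraMap D φ a.1).symm

theorem infToOverlap_infMap (a : infRing D R) :
    infToOverlap D S (infMap D φ a) = overlapMap D φ (infToOverlap D R a) := rfl

theorem affMap_algebraMap (c : R) :
    affMap D φ (algebraMap R _ c) = algebraMap S (affRing D S) (φ c) :=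
  Subtype.ext (Polynomial.map_C φ.toRingHom)

theorem overlapMap_algebraMap_base (c : R) :
    overlapMap D φ (algebraMap R _ c) = algebraMap S (overlapRing D S) (φ c) := by
  rw [IsScalarTower.algebraMap_apply R R[X] (overlapRing D R), overlapMap_algebraMap,
    IsScalarTower.algebraMap_apply S S[X] (overlapRing D S)]
  exact congrArg _ (Polynomial.map_C φ.toRingHom)

theorem infMap_algebraMap (c : R) :
    infMap D φ (algebraMap R _ c) = algebraMap S (infRing D S) (φ c) :=
  Subtype.ext (overlapMap_algebraMap_base D φ c)

theorem algHom_comp_ofId (φ : R →ₐ[ℂ] ℂ) : φ.comp (Algebra.ofId ℂ R) = AlgHom.id ℂ ℂ :=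
  Subsingleton.elim _ _

/-- The structure map of R is a section of φ, and a function with complex coefficients lifts along
it. -/
theorem affMap_surjective (φ : R →ₐ[ℂ] ℂ) : Function.Surjective (affMap D φ) := fun x =>
  ⟨affMap D (Algebra.ofId ℂ R) x, by rw [← affMap_comp, algHom_comp_ofId, affMap_id]⟩

theorem infMap_surjective (φ : R →ₐ[ℂ] ℂ) : Function.Surjective (infMap D φ) := fun x =>
  ⟨infMap D (Algebra.ofId ℂ R) x, by rw [← infMap_comp, algHom_comp_ofId, infMap_id]⟩

theorem overlapMap_surjective (φ : R →ₐ[ℂ] ℂ) : Function.Surjective (overlapMap D φ) := fun x =>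
  ⟨overlapMap D (Algebra.ofId ℂ R) x, by rw [← overlapMap_comp, algHom_comp_ofId, overlapMap_id]⟩

theorem exists_map_eq (φ : R →ₐ[ℂ] ℂ) (f : ℂ[X]) : ∃ g : R[X], g.map φ.toRingHom = f :=
  Polynomial.map_surjective φ.toRingHom (fun c => ⟨algebraMap ℂ R c, φ.commutes c⟩) f

variable {D} in
theorem coeff_mem_ker_of_overlapMap_eq_zero {n : ℕ} {f : R[X]}
    (h : overlapMap D φ (nodeInv D R ^ n * algebraMap R[X] (overlapRing D R) f) = 0) (i : ℕ) :
    f.coeff i ∈ RingHom.ker φ := by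
  rw [map_mul, map_pow, overlapMap_nodeInv, overlapMap_algebraMap,
    ((isUnit_nodeInv D).pow n).mul_right_eq_zero] at h
  have := algebraMap_overlapRing_injective D (h.trans (map_zero _).symm)
  rw [RingHom.mem_ker]
  have h2 := congrArg (fun p => p.coeff i) this
  simpa using h2

theorem ker_overlapMap_le :
    RingHom.ker (overlapMap D φ) ≤ (RingHom.ker φ).map (algebraMap R (overlapRing D R)) := by
  intro x hx
  obtain ⟨n, f, rfl⟩ := exists_eq_nodeInv_pow_mul D x
  refine Ideal.mul_mem_left _ _ ?_
  rw [f.as_sum_range_C_mul_X_pow, map_sum]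
  refine sum_mem fun i _ => ?_
  rw [map_mul]
  refine Ideal.mul_mem_right _ _ ?_
  change algebraMap R[X] _ (algebraMap R R[X] _) ∈ _
  rw [← IsScalarTower.algebraMap_apply]
  exact Ideal.mem_map_of_mem _ (coeff_mem_ker_of_overlapMap_eq_zero φ hx i)

/-- In c + Q g the polynomial Q stays monic under φ, so such a function dies only if c and all
coefficients of g do. Being generated by ker φ, the kernels on the charts fit Nakayama's lemma over
R. -/
theorem ker_affMap_le :
    RingHom.ker (affMap D φ) ≤ (RingHom.ker φ).map (algebraMap R (affRing D R)) := by
  rintro ⟨f, hf⟩ hx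
  obtain ⟨g, hg⟩ := (mem_affRing_iff D f).mp hf
  have hx : f.map φ.toRingHom = 0 := congrArg Subtype.val hx
  have h1 : φ (jet D R 0 0 f) = 0 := by
    rw [← jet_map, hx]
    simp [jet]
  have h2 : g.map φ.toRingHom = 0 := by
    rw [hg, Polynomial.map_add, Polynomial.map_mul, fatPoly_map, Polynomial.map_C] at hx
    have h1' : φ.toRingHom (jet D R 0 0 f) = 0 := h1
    rw [h1', map_zero, zero_add] at hx
    exact (monic_fatPoly D S).mul_right_eq_zero_iff.mp hx
  have h3 : ∀ i, g.coeff i ∈ RingHom.ker φ := fun i => by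
    have := congrArg (fun p => p.coeff i) h2
    rw [RingHom.mem_ker]
    simpa using this
  have : (⟨f, hf⟩ : affRing D R) = algebraMap R (affRing D R) (jet D R 0 0 f) +
      ∑ i : Fin (g.natDegree + 1), algebraMap R (affRing D R) (g.coeff i) *
        ⟨_, fatPoly_mul_mem D (X ^ i.1)⟩ := by
    refine Subtype.ext ?_
    change f = C (jet D R 0 0 f) + _
    rw [AddSubmonoidClass.coe_finsetSum]
    conv_lhs => rw [hg]
    congr 1
    conv_lhs => rw [g.as_sum_range_C_mul_X_pow, Finset.mul_sum, Finset.sum_range]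
    refine Finset.sum_congr rfl fun i _ => ?_
    change _ = C (g.coeff i) * _
    ring
  rw [this]
  exact add_mem (Ideal.mem_map_of_mem _ h1) (sum_mem fun i _ => Ideal.mul_mem_right _ _
    (Ideal.mem_map_of_mem _ (h3 i)))

end BaseChangeRingLemmas

/-! ### Existence of base changes -/

section ExtendScalars

variable {A A' A'' M M' M'' : Type} [CommRing A] [CommRing A'] [CommRing A'']
  [AddCommGroup M] [AddCommGroup M'] [AddCommGroup M'']
  [Module A M] [Module A' M'] [Module A'' M''] {θ : A →+* A'} {u : M →ₛₗ[θ] M'}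

theorem IsBaseChangeAlong.exists_semilinear_lift (h : IsBaseChangeAlong θ u) (τ : A' →+* A'')
    {θ'' : A →+* A''} (hθ : ∀ a, θ'' a = τ (θ a)) (g : M →ₛₗ[θ''] M'') :
    ∃ g' : M' →ₛₗ[τ] M'', ∀ m, g' (u m) = g m := by
  let : Module A' M'' := Module.compHom M'' τ
  obtain ⟨g', hg'⟩ := h.exists_lift
    ({ toFun := g
       map_add' := map_add g
       map_smul' := fun a m => by rw [map_smulₛₗ, hθ]; rfl } : M →ₛₗ[θ] M'')
  exact ⟨{ toFun := g', map_add' := map_add g', map_smul' := fun a m => map_smul g' a m }, hg'⟩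

variable (θ M) in
theorem exists_isBaseChangeAlong :
    ∃ (M' : Type) (_ : AddCommGroup M') (_ : Module A' M') (u : M →ₛₗ[θ] M'),
      IsBaseChangeAlong θ u := by
  let : Algebra A A' := θ.toAlgebra
  refine ⟨TensorProduct A A' M, inferInstance, inferInstance,
          { toFun := fun m => (1 ⊗ₜ[A] m : TensorProduct A A' M)
            map_add' := fun x y => TensorProduct.tmul_add _ _ _
            map_smul' := fun a m => ?_ }, .of_section ?_ fun P _ _ g => ?_⟩
  · change (1 ⊗ₜ[A] (a • m) : TensorProduct A A' M) = θ a • (1 ⊗ₜ[A] m : TensorProduct A A' M)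
    rw [TensorProduct.tmul_smul, ← algebraMap_smul A' a]; rfl
  · rw [eq_top_iff]
    rintro x -
    induction x using TensorProduct.induction_on with
    | zero => exact zero_mem _
    | tmul a m =>
      have : (a ⊗ₜ[A] m : TensorProduct A A' M) = a • (1 ⊗ₜ[A] m) := by
        rw [TensorProduct.smul_tmul', smul_eq_mul, mul_one]
      exact this ▸ Submodule.smul_mem _ _ (Submodule.subset_span ⟨m, rfl⟩)
    | add x y hx hy => exact add_mem hx hy
  · let : Module A P := Module.compHom P θ
    have : IsScalarTower A A' P := ⟨fun a b m => mul_smul (θ a) b m⟩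
    let g₀ : M →ₗ[A] P :=
      { toFun := g, map_add' := map_add g, map_smul' := fun a m => map_smulₛₗ g a m }
    exact ⟨(TensorProduct.isBaseChange A M A').lift g₀, fun m =>
      (TensorProduct.isBaseChange A M A').lift_eq g₀ m⟩

end ExtendScalars

/-! ### Pullback of sheaves along the base -/

section Pullbacks

variable {D : Divisor} {R S T : Type} [CommRing R] [Algebra ℂ R] [CommRing S] [Algebra ℂ S]
  [CommRing T] [Algebra ℂ T] {φ : R →ₐ[ℂ] S} {ψ : S →ₐ[ℂ] T}

theorem QCoh.isBaseChangeAlong_ρ (E : QCoh D R) : IsBaseChangeAlong (affToOverlap D R) E.ρ :=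
  (isUnitLocalization_affToOverlap D).isBaseChangeAlong_iff.mpr ⟨E.ρ_surj, E.ρ_inj⟩

theorem QCoh.isBaseChangeAlong_σ (E : QCoh D R) : IsBaseChangeAlong (infToOverlap D R) E.σ :=
  (isUnitLocalization_infToOverlap D).isBaseChangeAlong_iff.mpr ⟨E.σ_surj, E.σ_inj⟩

theorem QCoh.Iso.symm {E F : QCoh D R} (h : E.Iso F) : F.Iso E := by
  obtain ⟨u, v, w, h1, h2⟩ := h
  refine ⟨u.symm, v.symm, w.symm, fun m => ?_, fun m => ?_⟩
  · rw [LinearEquiv.eq_symm_apply, ← h1, LinearEquiv.apply_symm_apply]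
  · rw [LinearEquiv.eq_symm_apply, ← h2, LinearEquiv.apply_symm_apply]

theorem IsPullback.trans_iso {E : QCoh D R} {F G : QCoh D S} (h : IsPullback φ E F)
    (e : F.Iso G) : IsPullback φ E G := by
  obtain ⟨u, v, w, h1, h2, hu, hv, hw⟩ := h
  obtain ⟨u', v', w', h1', h2'⟩ := e
  refine ⟨u'.toLinearMap.comp u, v'.toLinearMap.comp v, w'.toLinearMap.comp w, fun m => ?_,
    fun m => ?_, hu.equiv_comp u' fun _ => rfl, hv.equiv_comp v' fun _ => rfl,
    hw.equiv_comp w' fun _ => rfl⟩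
  · exact (h1' _).trans (congrArg w' (h1 m))
  · exact (h2' _).trans (congrArg w' (h2 m))

theorem IsPullback.iso {E : QCoh D R} {F G : QCoh D S} (h : IsPullback φ E F)
    (h' : IsPullback φ E G) : F.Iso G := by
  obtain ⟨u, v, w, h1, h2, hu, hv, hw⟩ := h
  obtain ⟨u', v', w', h1', h2', hu', hv', hw'⟩ := h'
  obtain ⟨a, ha⟩ := hu.exists_equiv hu'
  obtain ⟨b, hb⟩ := hv.exists_equiv hv'
  obtain ⟨c, hc⟩ := hw.exists_equiv hw'
  refine ⟨a, b, c, hu.ext (g := G.ρ.comp a.toLinearMap) (g' := c.toLinearMap.comp F.ρ) ?_,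
    hv.ext (g := G.σ.comp b.toLinearMap) (g' := c.toLinearMap.comp F.σ) ?_⟩
  · intro m
    change G.ρ (a (u m)) = c (F.ρ (u m))
    rw [ha, h1', h1, hc]
  · intro m
    change G.σ (b (v m)) = c (F.σ (v m))
    rw [hb, h2', h2, hc]

theorem IsPullback.comp {E : QCoh D R} {F : QCoh D S} {G : QCoh D T} (h : IsPullback φ E F)
    (h' : IsPullback ψ F G) : IsPullback (ψ.comp φ) E G := by
  obtain ⟨u, v, w, h1, h2, hu, hv, hw⟩ := h
  obtain ⟨u', v', w', h1', h2', hu', hv', hw'⟩ := h'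
  have : RingHomCompTriple (affMap D φ) (affMap D ψ) (affMap D (ψ.comp φ)) :=
    ⟨RingHom.ext fun a => (affMap_comp D φ ψ a).symm⟩
  have : RingHomCompTriple (infMap D φ) (infMap D ψ) (infMap D (ψ.comp φ)) :=
    ⟨RingHom.ext fun a => (infMap_comp D φ ψ a).symm⟩
  have : RingHomCompTriple (overlapMap D φ) (overlapMap D ψ) (overlapMap D (ψ.comp φ)) :=
    ⟨RingHom.ext fun a => (overlapMap_comp D φ ψ a).symm⟩
  refine ⟨u'.comp u, v'.comp v, w'.comp w, fun m => ?_, fun m => ?_,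
    hu.comp hu' (affMap_comp D φ ψ) fun _ => rfl, hv.comp hv' (infMap_comp D φ ψ) fun _ => rfl,
    hw.comp hw' (overlapMap_comp D φ ψ) fun _ => rfl⟩
  · change G.ρ (u' (u m)) = w' (w (E.ρ m))
    rw [h1', h1]
  · change G.σ (v' (v m)) = w' (w (E.σ m))
    rw [h2', h2]

theorem IsPullback.isVectorBundle {E : QCoh D R} {F : QCoh D S} {r : ℕ} (h : IsPullback φ E F)
    (hE : E.IsVectorBundle r) : F.IsVectorBundle r := by
  obtain ⟨u, v, w, -, -, hu, hv, -⟩ := h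
  obtain ⟨⟨_, _, h1⟩, ⟨_, _, h2⟩⟩ := hE
  exact ⟨hu.projective h1, hv.projective h2⟩

/-- The pullback of a sheaf exists. -/
theorem exists_isPullback (φ : R →ₐ[ℂ] S) (E : QCoh D R) : ∃ F : QCoh D S, IsPullback φ E F := by
  obtain ⟨M', _, _, u, hu⟩ := exists_isBaseChangeAlong E.M (affMap D φ)
  obtain ⟨N', _, _, v, hv⟩ := exists_isBaseChangeAlong E.N (infMap D φ)
  obtain ⟨L', _, _, w, hw⟩ := exists_isBaseChangeAlong E.L (overlapMap D φ)
  have : RingHomCompTriple (affToOverlap D R) (overlapMap D φ)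
    ((overlapMap D φ).comp (affToOverlap D R)) := ⟨rfl⟩
  have : RingHomCompTriple (infToOverlap D R) (overlapMap D φ)
    ((overlapMap D φ).comp (infToOverlap D R)) := ⟨rfl⟩
  let g₁ : E.M →ₛₗ[(overlapMap D φ).comp (affToOverlap D R)] L' :=
    w.comp E.ρ
  let g₂ : E.N →ₛₗ[(overlapMap D φ).comp (infToOverlap D R)] L' :=
    w.comp E.σ
  have hg₁ : IsBaseChangeAlong _ g₁ :=
    E.isBaseChangeAlong_ρ.comp hw (fun _ => rfl) fun _ => rfl
  have hg₂ : IsBaseChangeAlong _ g₂ :=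
    E.isBaseChangeAlong_σ.comp hw (fun _ => rfl) fun _ => rfl
  have e₁ : ∀ a, ((overlapMap D φ).comp (affToOverlap D R)) a =
    affToOverlap D S (affMap D φ a) := fun a => (affToOverlap_affMap D φ a).symm
  have e₂ : ∀ a, ((overlapMap D φ).comp (infToOverlap D R)) a =
    infToOverlap D S (infMap D φ a) := fun a => (infToOverlap_infMap D φ a).symm
  obtain ⟨ρ, hρ⟩ := hu.exists_semilinear_lift (affToOverlap D S) e₁ g₁
  obtain ⟨σ, hσ⟩ := hv.exists_semilinear_lift (infToOverlap D S) e₂ g₂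
  -- The composite of ρ with w is a base change and factors through u. Cancelling u leaves a base
  -- change along the restriction of functions, which amounts to the two axioms for ρ.
  have hρ' := (isUnitLocalization_affToOverlap D).isBaseChangeAlong_iff.mp
    (hu.of_comp hg₁ e₁ fun m => (hρ m).symm)
  have hσ' := (isUnitLocalization_infToOverlap D).isBaseChangeAlong_iff.mp
    (hv.of_comp hg₂ e₂ fun m => (hσ m).symm)
  let : Module S M' := Module.compHom M' (algebraMap S (affRing D S))
  let : Module S N' := Module.compHom N' (algebraMap S (infRing D S))
  let : Module S L' := Module.compHom L' (algebraMap S (overlapRing D S))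
  have : IsScalarTower S (affRing D S) M' := .of_algebraMap_smul fun _ _ => rfl
  have : IsScalarTower S (infRing D S) N' := .of_algebraMap_smul fun _ _ => rfl
  have : IsScalarTower S (overlapRing D S) L' := .of_algebraMap_smul fun _ _ => rfl
  exact ⟨{ M := M', N := N', L := L', ρ := ρ, σ := σ, ρ_surj := hρ'.1, ρ_inj := hρ'.2,
           σ_surj := hσ'.1, σ_inj := hσ'.2 },
    u, v, w, hρ, hσ, hu, hv, hw⟩

end Pullbacks

/-! ### Frames of M_Λ and the vector bundle property -/

section Frames

variable {D : Divisor} {r : ℕ} {R : Type} [CommRing R]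

/-- The value at `P_i` of a matrix of sections of `M_Λ` which is the identity at `P_1`. -/
def Tuple.val (Λ : Tuple D r R) : Fin (D.k + 1) → GL (Fin r) R :=
  Fin.cons 1 fun i => (Λ.glue i)⁻¹

/-- The jets at the `P_i` of a matrix of sections of `M_Λ` which is the identity at `P_1`. -/
def Tuple.jetMat (Λ : Tuple D r R) (i : Fin (D.k + 1)) : ℕ → Matrix (Fin r) (Fin r) R
  | 0 => (Λ.val i).1
  | l + 1 => if h : l < D.n i - 1 then Λ.deriv i ⟨l, h⟩ * (Λ.val i).1 else 0

theorem Tuple.jetMat_zero_zero (Λ : Tuple D r R) : Λ.jetMat 0 0 = 1 := rfl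

theorem Tuple.jetMat_map {S : Type} [CommRing S] (φ : R →+* S) (Λ : Tuple D r R)
    (i : Fin (D.k + 1)) (l : ℕ) : (Λ.map φ).jetMat i l = (Λ.jetMat i l).map φ := by
  have hval : ((Λ.map φ).val i).1 = (Λ.val i).1.map φ := by
    obtain rfl | ⟨j, rfl⟩ := i.eq_zero_or_eq_succ
    · exact (Matrix.map_one φ (map_zero φ) (map_one φ)).symm
    · change ((Matrix.GeneralLinearGroup.map φ (Λ.glue j))⁻¹).1 = _
      rw [← map_inv]
      rfl
  obtain _ | l := l
  · exact hval
  · simp only [Tuple.jetMat, hval]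
    split_ifs with h
    · exact (Matrix.map_mul (f := φ)).symm
    · exact (Matrix.map_zero φ (map_zero φ)).symm

/-- Two tuples are conjugate iff their jets are. -/
theorem Tuple.eq_smul_iff (Λ Λ' : Tuple D r R) (g : GL (Fin r) R) :
    Λ = g • Λ' ↔ ∀ i l, l < D.n i → Λ.jetMat i l * g.1 = g.1 * Λ'.jetMat i l := by
  have hg : (g⁻¹).1 * g.1 = 1 := congrArg Units.val (inv_mul_cancel g)
  constructor
  · rintro rfl i l hl
    have hval : (g • Λ').val i = g * Λ'.val i * g⁻¹ := by
      obtain rfl | ⟨j, rfl⟩ := i.eq_zero_or_eq_succ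
      · change 1 = g * 1 * g⁻¹
        simp
      · change (g * Λ'.glue j * g⁻¹)⁻¹ = g * (Λ'.glue j)⁻¹ * g⁻¹
        group
    obtain _ | l := l
    · change ((g • Λ').val i).1 * g.1 = g.1 * (Λ'.val i).1
      rw [hval, Units.val_mul, Units.val_mul, mul_assoc, hg, mul_one]
    · simp only [Tuple.jetMat, hval]
      rw [dif_pos (by omega), dif_pos (by omega)]
      change g.1 * Λ'.deriv i _ * (g⁻¹).1 * _ * _ = _
      rw [Units.val_mul, Units.val_mul]
      have : g.1 * Λ'.deriv i ⟨l, by omega⟩ * (g⁻¹).1 * (g.1 * (Λ'.val i).1 * (g⁻¹).1) * g.1 =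
        g.1 * Λ'.deriv i ⟨l, by omega⟩ * ((g⁻¹).1 * g.1) * (Λ'.val i).1 * ((g⁻¹).1 * g.1) := by
        simp only [mul_assoc]
      rw [this, hg]
      simp only [mul_assoc, mul_one, one_mul]
  · intro h
    have hval : ∀ i, Λ.val i = g * Λ'.val i * g⁻¹ := fun i => by
      rw [eq_mul_inv_iff_mul_eq]
      exact Units.ext (h i 0 (D.n_pos i))
    refine Tuple.ext (funext fun i => ?_) (funext fun i => funext fun l => ?_)
    · have : (Λ.glue i)⁻¹ = g * (Λ'.glue i)⁻¹ * g⁻¹ := hval i.succ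
      rw [← inv_inv (Λ.glue i), this]
      change _ = g * Λ'.glue i * g⁻¹
      group
    · have h1 := h i (l + 1) (by have := l.2; omega)
      simp only [Tuple.jetMat] at h1
      rw [dif_pos l.2, dif_pos l.2] at h1
      change Λ.deriv i l = g.1 * Λ'.deriv i l * (g⁻¹).1
      have h2 : (Λ.val i).1 * g.1 = g.1 * (Λ'.val i).1 := h i 0 (D.n_pos i)
      change Λ.deriv i l * (Λ.val i).1 * g.1 = g.1 * (Λ'.deriv i l * (Λ'.val i).1) at h1
      rw [mul_assoc, h2] at h1
      have h3 : (Λ'.val i).1 * ((Λ'.val i)⁻¹).1 = 1 := congrArg Units.val (mul_inv_cancel _)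
      have h4 : g.1 * (g⁻¹).1 = 1 := congrArg Units.val (mul_inv_cancel _)
      have h5 := congrArg (· * ((Λ'.val i)⁻¹).1 * (g⁻¹).1) h1
      simp only [mul_assoc] at h5
      rw [← mul_assoc (Λ'.val i).1 ((Λ'.val i)⁻¹).1, h3, one_mul, h4, mul_one] at h5
      rw [h5, mul_assoc]

variable [Algebra ℂ R]

theorem jet_sum {ι : Type*} (s : Finset ι) (F : ι → R[X]) (i : Fin (D.k + 1)) (l : ℕ) :
    jet D R i l (∑ m ∈ s, F m) = ∑ m ∈ s, jet D R i l (F m) := by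
  simp [jet, iterate_derivative_sum, eval_finsetSum]

theorem jet_mul_C (i : Fin (D.k + 1)) (l : ℕ) (f : R[X]) (c : R) :
    jet D R i l (f * C c) = jet D R i l f * c := by
  rw [mul_comm, jet, iterate_derivative_C_mul, eval_mul, eval_C, mul_comm]
  rfl

theorem vjet_mulVec_C (i : Fin (D.k + 1)) (l : ℕ) (S : Matrix (Fin r) (Fin r) R[X])
    (c : Fin r → R) :
    vjet D i l (S.mulVec fun b => C (c b)) = (S.map (jet D R i l)).mulVec c := by
  ext a
  simp only [vjet, Matrix.mulVec, dotProduct, jet_sum, jet_mul_C, Matrix.map_apply]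

/-- The gluing equations are solved for s(P_i) in terms of s(P_1), which inverts the matrices Λ_i;
substitution into the equations for the derivatives puts all conditions into one shape. -/
theorem Tuple.mem_module_iff (Λ : Tuple D r R) (s : Fin r → R[X]) :
    s ∈ Λ.module ↔
      ∀ i l, l < D.n i → vjet D i l s = (Λ.jetMat i l).mulVec (vjet D 0 0 s) := by
  have h0 : ∀ (A : GL (Fin r) R) (x y : Fin r → R),
      x = A.1.mulVec y ↔ y = (A⁻¹).1.mulVec x := by
    intro A x y
    have h1 : A.1 * (A⁻¹).1 = 1 := congrArg Units.val (mul_inv_cancel _)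
    have h2 : (A⁻¹).1 * A.1 = 1 := congrArg Units.val (inv_mul_cancel _)
    constructor
    · rintro rfl
      rw [Matrix.mulVec_mulVec, h2, Matrix.one_mulVec]
    · rintro rfl
      rw [Matrix.mulVec_mulVec, h1, Matrix.one_mulVec]
  constructor
  · rintro ⟨h1, h2⟩
    have hval : ∀ i, vjet D i 0 s = (Λ.val i).1.mulVec (vjet D 0 0 s) := by
      intro i
      obtain rfl | ⟨j, rfl⟩ := i.eq_zero_or_eq_succ
      · exact (Matrix.one_mulVec _).symm
      · exact (h0 _ _ _).mp (h1 j)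
    intro i l hl
    obtain _ | l := l
    · exact hval i
    · simp only [Tuple.jetMat]
      rw [dif_pos (by omega), ← Matrix.mulVec_mulVec, ← hval]
      exact h2 i ⟨l, by omega⟩
  · intro h
    refine ⟨fun i => (h0 _ _ _).mpr (h i.succ 0 (D.n_pos _)), fun i l => ?_⟩
    rw [h i (l + 1) (by have := l.2; omega), h i 0 (D.n_pos i)]
    simp only [Tuple.jetMat]
    rw [dif_pos l.2, ← Matrix.mulVec_mulVec]

/-- A matrix `S` of sections of `M_Λ` which is the identity at `P_1`, together with a matrix `T`
which is inverse to it up to a factor congruent to one modulo the conductor. -/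
structure Tuple.Frame (Λ : Tuple D r R) where
  S : Matrix (Fin r) (Fin r) R[X]
  T : Matrix (Fin r) (Fin r) R[X]
  h : R[X]
  jet_S : ∀ i l, l < D.n i → S.map (jet D R i l) = Λ.jetMat i l
  S_mul_T : S * T = (1 - fatPoly D R * h) • (1 : Matrix (Fin r) (Fin r) R[X])
  T_mul_S : T * S = (1 - fatPoly D R * h) • (1 : Matrix (Fin r) (Fin r) R[X])

/-- Modulo z - P_i the polynomial f is its value there, a unit; so f is coprime to every factor of
Q. -/
theorem isCoprime_fatPoly {f : R[X]} (hf : ∀ i, IsUnit (jet D R i 0 f)) :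
    IsCoprime f (fatPoly D R) := by
  refine IsCoprime.prod_right fun i _ => IsCoprime.pow_right ?_
  have h1 : f = (X - C (algebraMap ℂ R (D.P i))) * (f /ₘ (X - C (algebraMap ℂ R (D.P i)))) +
      C (jet D R i 0 f) := by
    have := modByMonic_add_div f (X - C (algebraMap ℂ R (D.P i)))
    rw [modByMonic_X_sub_C_eq_C_eval] at this
    rw [jet, Function.iterate_zero, id]
    rw [add_comm]
    exact this.symm
  rw [h1, add_comm]
  refine IsCoprime.add_mul_left_left ?_ _
  exact (isCoprime_one_left).of_isCoprime_of_dvd_left (((hf i).map C).dvd)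

/-- A matrix with invertible values at the `P_i` is invertible up to a factor congruent to one
modulo the conductor. -/
theorem exists_mul_eq_smul_one (S : Matrix (Fin r) (Fin r) R[X])
    (hS : ∀ i, IsUnit (S.map (jet D R i 0)).det) :
    ∃ (T : Matrix (Fin r) (Fin r) R[X]) (h : R[X]),
      S * T = (1 - fatPoly D R * h) • (1 : Matrix (Fin r) (Fin r) R[X]) ∧
      T * S = (1 - fatPoly D R * h) • (1 : Matrix (Fin r) (Fin r) R[X]) := by
  -- The Bézout relation inverts det S modulo Q, so g times the adjugate inverts S modulo Q on both
  -- sides.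
  obtain ⟨g, h, hgh⟩ : IsCoprime S.det (fatPoly D R) := by
    refine isCoprime_fatPoly fun i => ?_
    have := hS i
    have e : S.map (jet D R i 0) = (evalRingHom (algebraMap ℂ R (D.P i))).mapMatrix S := rfl
    rw [e, ← RingHom.map_det] at this
    exact this
  have hf : g * S.det = 1 - fatPoly D R * h := by linear_combination hgh
  refine ⟨g • S.adjugate, h, ?_, ?_⟩
  · rw [Matrix.mul_smul, Matrix.mul_adjugate, smul_smul, hf]
  · rw [Matrix.smul_mul, Matrix.adjugate_mul, smul_smul, hf]

theorem Tuple.nonempty_frame (Λ : Tuple D r R) : Nonempty Λ.Frame := by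
  choose S hS using fun a b => exists_jet_eq D fun i l => Λ.jetMat i l a b
  have hS' : ∀ i l, l < D.n i → (Matrix.of S).map (jet D R i l) = Λ.jetMat i l := fun i l hl =>
    Matrix.ext fun a b => hS a b i l hl
  obtain ⟨T, h, h1, h2⟩ := exists_mul_eq_smul_one (D := D) (Matrix.of S) fun i => by
    rw [hS' i 0 (D.n_pos i)]
    exact (Matrix.isUnit_iff_isUnit_det _).mp (Λ.val i).isUnit
  exact ⟨⟨Matrix.of S, T, h, hS', h1, h2⟩⟩

theorem vjet_eq_zero_iff (s : Fin r → R[X]) :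
    (∀ i l, l < D.n i → vjet D i l s = 0) ↔ ∃ t : Fin r → R[X], s = fatPoly D R • t := by
  constructor
  · intro h
    choose t ht using fun a => (jet_eq_zero_iff D (s a)).mp fun i l hl => congrFun (h i l hl) a
    exact ⟨t, funext ht⟩
  · rintro ⟨t, rfl⟩ i l hl
    exact funext fun a => jet_fatPoly_mul D i l hl (t a)

theorem vjet_sub (i : Fin (D.k + 1)) (l : ℕ) (s t : Fin r → R[X]) :
    vjet D i l (s - t) = vjet D i l s - vjet D i l t :=
  funext fun _ => jet_sub D i l _ _

/-- The sections of `M_Λ` in terms of a matrix with the prescribed jets. -/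
theorem Tuple.mem_module_iff_exists (Λ : Tuple D r R) {S : Matrix (Fin r) (Fin r) R[X]}
    (hS : ∀ i l, l < D.n i → S.map (jet D R i l) = Λ.jetMat i l) (s : Fin r → R[X]) :
    s ∈ Λ.module ↔ ∃ (c : Fin r → R) (t : Fin r → R[X]),
      s = S.mulVec (fun b => C (c b)) + fatPoly D R • t := by
  constructor
  · intro hs
    rw [Λ.mem_module_iff] at hs
    obtain ⟨t, ht⟩ := (vjet_eq_zero_iff (D := D) (s - S.mulVec fun b => C (vjet D 0 0 s b))).mp
      fun i l hl => by rw [vjet_sub, hs i l hl, vjet_mulVec_C, hS i l hl, sub_self]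
    exact ⟨vjet D 0 0 s, t, by rw [← ht]; abel⟩
  · rintro ⟨c, t, rfl⟩
    have h : ∀ i l, l < D.n i → vjet D i l (S.mulVec (fun b => C (c b)) + fatPoly D R • t) =
        (Λ.jetMat i l).mulVec c := fun i l hl => by
      rw [vjet_add, vjet_mulVec_C, hS i l hl, (vjet_eq_zero_iff _).mpr ⟨t, rfl⟩ i l hl, add_zero]
    rw [Λ.mem_module_iff]
    intro i l hl
    rw [h i l hl, h 0 0 (D.n_pos 0), Λ.jetMat_zero_zero, Matrix.one_mulVec]

theorem Tuple.fatPoly_smul_mem (Λ : Tuple D r R) (t : Fin r → R[X]) :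
    fatPoly D R • t ∈ Λ.module := by
  obtain ⟨F⟩ := Λ.nonempty_frame
  refine (Λ.mem_module_iff_exists F.jet_S _).mpr ⟨0, t, ?_⟩
  have : (fun b : Fin r => C ((0 : Fin r → R) b)) = 0 := funext fun b => C_0
  rw [this, Matrix.mulVec_zero, zero_add]

namespace Tuple.Frame

variable {Λ : Tuple D r R} (F : Λ.Frame)


theorem S_mulVec_mem (x : Fin r → affRing D R) : F.S.mulVec (fun b => (x b).1) ∈ Λ.module := by
  choose g hg using fun b => (mem_affRing_iff D _).mp (x b).2
  refine (Λ.mem_module_iff_exists F.jet_S _).mpr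
    ⟨fun b => jet D R 0 0 (x b).1, F.S.mulVec g, ?_⟩
  rw [← Matrix.mulVec_smul, ← Matrix.mulVec_add]
  exact congrArg _ (funext hg)

/-- For a section S c + Q t the vector T s is congruent to the constant vector c modulo Q, since T S
is congruent to 1. -/
theorem T_mulVec_mem (s : Λ.module) (b : Fin r) : F.T.mulVec s.1 b ∈ affRing D R := by
  obtain ⟨c, t, h⟩ := (Λ.mem_module_iff_exists F.jet_S _).mp s.2
  rw [h, Matrix.mulVec_add, Matrix.mulVec_mulVec, F.T_mul_S, Matrix.mulVec_smul,
    Matrix.smul_mulVec, Matrix.one_mulVec]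
  have : ((1 - fatPoly D R * F.h) • (fun b => C (c b)) + fatPoly D R • F.T.mulVec t) b =
      C (c b) + fatPoly D R * (F.T.mulVec t b - F.h * C (c b)) := by
    simp only [Pi.add_apply, Pi.smul_apply, smul_eq_mul]
    ring
  rw [this]
  exact C_add_mul_fatPoly_mem D _ _

/-- Sections of the free module give sections of `M_Λ`. -/
def toSections : (Fin r → affRing D R) →ₗ[affRing D R] Λ.module where
  toFun x := ⟨_, F.S_mulVec_mem x⟩
  map_add' x y := Subtype.ext (Matrix.mulVec_add F.S (fun b => (x b).1) fun b => (y b).1)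
  map_smul' c x := Subtype.ext (Matrix.mulVec_smul F.S c.1 fun b => (x b).1)

/-- Coordinates of sections of `M_Λ`. -/
def coords : Λ.module →ₗ[affRing D R] (Fin r → affRing D R) where
  toFun s b := ⟨_, F.T_mulVec_mem s b⟩
  map_add' x y := funext fun b => Subtype.ext (congrFun (Matrix.mulVec_add F.T x.1 y.1) b)
  map_smul' c x := funext fun b => Subtype.ext (congrFun (Matrix.mulVec_smul F.T c.1 x.1) b)

/-- The function `∏ (z - P_i) ^ n_i * h`. -/
def cond : affRing D R := ⟨_, fatPoly_mul_mem D F.h⟩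

theorem toSections_coords (s : Λ.module) : F.toSections (F.coords s) = (1 - F.cond) • s := by
  refine Subtype.ext ?_
  change F.S.mulVec (F.T.mulVec s.1) = (1 - fatPoly D R * F.h) • s.1
  rw [Matrix.mulVec_mulVec, F.S_mul_T, Matrix.smul_mulVec, Matrix.one_mulVec]

theorem coords_toSections (x : Fin r → affRing D R) :
    F.coords (F.toSections x) = (1 - F.cond) • x := by
  refine funext fun b => Subtype.ext ?_
  change F.T.mulVec (F.S.mulVec fun b => (x b).1) b = (1 - fatPoly D R * F.h) * (x b).1
  rw [Matrix.mulVec_mulVec, F.T_mul_S, Matrix.smul_mulVec, Matrix.one_mulVec]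
  rfl

/-- Multiplication by an element of the conductor maps the free module into `M_Λ`. -/
def condToSections : (Fin r → affRing D R) →ₗ[affRing D R] Λ.module where
  toFun x := ⟨_, Λ.fatPoly_smul_mem (fun b => F.h * (x b).1)⟩
  map_add' x y := Subtype.ext (funext fun b => by
    change fatPoly D R * (F.h * ((x b).1 + (y b).1)) =
      fatPoly D R * (F.h * (x b).1) + fatPoly D R * (F.h * (y b).1)
    ring)
  map_smul' c x := Subtype.ext (funext fun b => by
    change fatPoly D R * (F.h * (c.1 * (x b).1)) = c.1 * (fatPoly D R * (F.h * (x b).1))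
    ring)

/-- Multiplication by an element of the conductor maps `M_Λ` into the free module. -/
def condCoords : Λ.module →ₗ[affRing D R] (Fin r → affRing D R) where
  toFun s b := ⟨_, fatPoly_mul_mem D (F.h * s.1 b)⟩
  map_add' x y := funext fun b => Subtype.ext (by
    change fatPoly D R * (F.h * (x.1 b + y.1 b)) =
      fatPoly D R * (F.h * x.1 b) + fatPoly D R * (F.h * y.1 b)
    ring)
  map_smul' c x := funext fun b => Subtype.ext (by
    change fatPoly D R * (F.h * (c.1 * x.1 b)) = c.1 * (fatPoly D R * (F.h * x.1 b))
    ring)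

theorem condToSections_condCoords (s : Λ.module) :
    F.condToSections (F.condCoords s) = (F.cond * F.cond) • s := by
  refine Subtype.ext (funext fun b => ?_)
  change fatPoly D R * (F.h * (fatPoly D R * (F.h * s.1 b))) =
    (fatPoly D R * F.h * (fatPoly D R * F.h)) * s.1 b
  ring

theorem condCoords_condToSections (x : Fin r → affRing D R) :
    F.condCoords (F.condToSections x) = (F.cond * F.cond) • x := by
  refine funext fun b => Subtype.ext ?_
  change fatPoly D R * (F.h * (fatPoly D R * (F.h * (x b).1))) =
    (fatPoly D R * F.h * (fatPoly D R * F.h)) * (x b).1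
  ring

/-- A surjection from a free module onto `M_Λ`. -/
def proj : (Fin r ⊕ Fin r → affRing D R) →ₗ[affRing D R] Λ.module :=
  F.toSections ∘ₗ LinearMap.funLeft _ _ Sum.inl + F.condToSections ∘ₗ LinearMap.funLeft _ _ Sum.inr

/-- A section of `Tuple.Frame.proj`. -/
def incl : Λ.module →ₗ[affRing D R] (Fin r ⊕ Fin r → affRing D R) where
  toFun s := Sum.elim ((1 + F.cond) • F.coords s) (F.condCoords s)
  map_add' x y := by
    ext (b | b) : 1
    · simp
    · simp
  map_smul' c x := by
    ext (b | b) : 1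
    · simp [mul_left_comm]
    · simp

theorem proj_incl (s : Λ.module) : F.proj (F.incl s) = s := by
  change F.toSections ((1 + F.cond) • F.coords s) + F.condToSections (F.condCoords s) = s
  rw [map_smul, toSections_coords, condToSections_condCoords, smul_smul, ← add_smul]
  -- The partition of unity that dictates the factor 1 + `cond` in `incl`: the frame costs 1 -
  -- `cond`, the conductor maps cost the square of `cond`.
  have : (1 + F.cond) * (1 - F.cond) + F.cond * F.cond = 1 := by ring
  rw [this, one_smul]

end Tuple.Frame

/-- No prime of the affine chart contains both `cond` and 1 - `cond`. Off the zeros of the second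
function S and T trivialize M_Λ; off the zeros of the first, multiplication by elements of the
conductor does. -/
theorem Tuple.bundle_isVectorBundle (Λ : Tuple D r R) : Λ.bundle.IsVectorBundle r := by
  obtain ⟨F⟩ := Λ.nonempty_frame
  refine ⟨⟨?_, ?_, fun p => ?_⟩, ⟨?_, ?_, fun p => ?_⟩⟩
  · exact Module.Finite.of_surjective (M := Fin r ⊕ Fin r → affRing D R) F.proj
      fun s => ⟨_, F.proj_incl s⟩
  · exact Module.Projective.of_split F.incl F.proj (LinearMap.ext F.proj_incl)
  · by_cases hc : F.cond ∈ p.asIdeal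
    · refine rankAtStalk_eq_of_comp_eq_smul (M := Λ.module) p (c := 1 - F.cond) (fun h => ?_)
        F.coords F.toSections F.coords_toSections F.toSections_coords
      exact (Ideal.ne_top_iff_one _).mp p.2.ne_top (by simpa using add_mem h hc)
    · exact rankAtStalk_eq_of_comp_eq_smul (M := Λ.module) p (c := F.cond * F.cond)
        (fun h => hc ((p.2.mem_or_mem h).elim id id))
        F.condCoords F.condToSections F.condCoords_condToSections F.condToSections_condCoords
  · exact inferInstanceAs (Module.Finite (infRing D R) (Fin r → infRing D R))
  · exact inferInstanceAs (Module.Projective (infRing D R) (Fin r → infRing D R))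
  · have : Nontrivial (infRing D R) := p.nontrivial
    change Module.rankAtStalk (R := infRing D R) (Fin r → infRing D R) p = r
    simp

/-! ### Base change of M_Λ -/

section

variable {S : Type} [CommRing S] [Algebra ℂ S] (φ : R →ₐ[ℂ] S)

/-- Apply a ring homomorphism to a frame. -/
def Tuple.Frame.map {Λ : Tuple D r R} (F : Λ.Frame) : (Λ.map φ.toRingHom).Frame where
  S := F.S.map (mapRingHom φ.toRingHom)
  T := F.T.map (mapRingHom φ.toRingHom)
  h := F.h.map φ.toRingHom
  jet_S i l hl := by
    rw [Tuple.jetMat_map, ← F.jet_S i l hl]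
    exact Matrix.ext fun a b => jet_map D φ i l _
  S_mul_T := by
    rw [← Matrix.map_mul, F.S_mul_T]
    ext a b : 1
    simp [Matrix.one_apply, fatPoly_map, ← fatPoly_map D φ, apply_ite (Polynomial.map _)]
  T_mul_S := by
    rw [← Matrix.map_mul, F.T_mul_S]
    ext a b : 1
    simp [Matrix.one_apply, fatPoly_map, ← fatPoly_map D φ, apply_ite (Polynomial.map _)]

theorem Tuple.map_mem_module (Λ : Tuple D r R) {s : Fin r → R[X]} (hs : s ∈ Λ.module) :
    (fun b => (s b).map φ.toRingHom) ∈ (Λ.map φ.toRingHom).module := by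
  rw [Tuple.mem_module_iff] at hs ⊢
  have h : ∀ i l, vjet D i l (fun b => (s b).map φ.toRingHom) = φ ∘ vjet D i l s := fun i l =>
    funext fun b => jet_map D φ i l (s b)
  intro i l hl
  rw [h, h, hs i l hl, Tuple.jetMat_map]
  exact funext fun a => RingHom.map_mulVec φ.toRingHom _ _ a

/-- The map `M_Λ → M_{φ(Λ)}` given by applying `φ` to all coefficients. -/
def Tuple.mapSections (Λ : Tuple D r R) :
    Λ.bundle.M →ₛₗ[affMap D φ] (Λ.map φ.toRingHom).bundle.M where
  toFun := fun s => ⟨_, Λ.map_mem_module φ s.2⟩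
  map_add' := fun s t => Subtype.ext (funext fun b => Polynomial.map_add _)
  map_smul' := fun c s => Subtype.ext (funext fun b => Polynomial.map_mul _) 

/-- The maps that exhibit M_Λ as a direct summand of a free module have matrices built from a frame,
and applying φ to the frame gives those of the image tuple. So `of_retract` applies to an arbitrary
φ, with no flatness. -/
theorem Tuple.isBaseChangeAlong_mapSections (Λ : Tuple D r R) :
    IsBaseChangeAlong (affMap D φ) (Λ.mapSections φ) := by
  obtain ⟨F⟩ := Λ.nonempty_frame
  have h1 : ∀ (s : Λ.module) b, (F.map φ).incl (Λ.mapSections φ s) b = affMap D φ (F.incl s b) := by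
    intro s b
    refine Subtype.ext ?_
    obtain b | b := b
    · change (1 + fatPoly D S * F.h.map φ.toRingHom) *
        (F.T.map (mapRingHom φ.toRingHom)).mulVec (fun b => (s.1 b).map φ.toRingHom) b =
        ((1 + fatPoly D R * F.h) * F.T.mulVec s.1 b).map φ.toRingHom
      rw [Polynomial.map_mul, Polynomial.map_add, Polynomial.map_mul, fatPoly_map,
        Polynomial.map_one]
      congr 1
      exact (RingHom.map_mulVec (mapRingHom φ.toRingHom) _ _ b).symm
    · change fatPoly D S * (F.h.map φ.toRingHom * (s.1 b).map φ.toRingHom) =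
        (fatPoly D R * (F.h * s.1 b)).map φ.toRingHom
      rw [Polynomial.map_mul, Polynomial.map_mul, fatPoly_map]
  have h2 : ∀ x, (F.map φ).proj (fun b => affMap D φ (x b)) = Λ.mapSections φ (F.proj x) := by
    intro x
    refine Subtype.ext (funext fun b => ?_)
    change (F.S.map (mapRingHom φ.toRingHom)).mulVec
      (fun b => ((x (.inl b)).1).map φ.toRingHom) b +
      fatPoly D S * (F.h.map φ.toRingHom * ((x (.inr b)).1).map φ.toRingHom) =
      (F.S.mulVec (fun b => (x (.inl b)).1) b + fatPoly D R * (F.h * (x (.inr b)).1)).map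
        φ.toRingHom
    rw [Polynomial.map_add, Polynomial.map_mul, Polynomial.map_mul, fatPoly_map]
    congr 1
    exact (RingHom.map_mulVec (mapRingHom φ.toRingHom) _ _ b).symm
  let p : (Fin r ⊕ Fin r → affRing D R) →ₗ[affRing D R] Λ.bundle.M := F.proj
  let p' : (Fin r ⊕ Fin r → affRing D S) →ₗ[affRing D S] (Λ.map φ.toRingHom).bundle.M :=
    (F.map φ).proj
  let i : Λ.bundle.M →ₗ[affRing D R] (Fin r ⊕ Fin r → affRing D R) := F.incl
  let i' : (Λ.map φ.toRingHom).bundle.M →ₗ[affRing D S] (Fin r ⊕ Fin r → affRing D S) :=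
    (F.map φ).incl
  exact IsBaseChangeAlong.of_retract (i := i) (p := p) (i' := i') (p' := p')
    F.proj_incl (F.map φ).proj_incl (map_add i') (map_smul i') h1 h2

/-- The formation of `M_Λ` commutes with base change. -/
theorem Tuple.isPullback_bundle (Λ : Tuple D r R) :
    IsPullback φ Λ.bundle (Λ.map φ.toRingHom).bundle := by
  let v : Λ.bundle.N →ₛₗ[infMap D φ] (Λ.map φ.toRingHom).bundle.N :=
    { toFun := fun x b => infMap D φ (x b)
      map_add' := fun s t => funext fun b => map_add _ _ _
      map_smul' := fun c s => funext fun b => map_mul _ _ _ }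
  let w : Λ.bundle.L →ₛₗ[overlapMap D φ] (Λ.map φ.toRingHom).bundle.L :=
    { toFun := fun x b => overlapMap D φ (x b)
      map_add' := fun s t => funext fun b => map_add _ _ _
      map_smul' := fun c s => funext fun b => map_mul _ _ _ }
  have hv : IsBaseChangeAlong (infMap D φ) v := .pi (Fin r) _ _ fun _ _ => rfl
  have hw : IsBaseChangeAlong (overlapMap D φ) w := .pi (Fin r) _ _ fun _ _ => rfl
  exact ⟨Λ.mapSections φ, v, w, fun m => funext fun b => (overlapMap_algebraMap D φ (m.1 b)).symm,
    fun m => rfl, Λ.isBaseChangeAlong_mapSections φ, hv, hw⟩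

end

end Frames

/-! ### Isomorphism of bundles and conjugacy of tuples -/

section Conjugation

variable {D : Divisor} {r : ℕ} {R : Type} [CommRing R] [Algebra ℂ R]

/-- The relation s = S (T s) + Q (h s) suffices: columns of S and multiples of Q are sections of
M_Λ. It says that on the projective line M_Λ generates the trivial bundle. -/
theorem Tuple.span_module (Λ : Tuple D r R) (s : Fin r → R[X]) :
    s ∈ Submodule.span R[X] (Λ.module : Set (Fin r → R[X])) := by
  obtain ⟨F⟩ := Λ.nonempty_frame
  have h1 : s = F.S.mulVec (F.T.mulVec s) + fatPoly D R • F.h • s := by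
    rw [Matrix.mulVec_mulVec, F.S_mul_T, Matrix.smul_mulVec, Matrix.one_mulVec, sub_smul,
      one_smul, mul_smul]
    abel
  rw [h1]
  refine add_mem ?_ (Submodule.subset_span (Λ.fatPoly_smul_mem _))
  have h2 : ∀ x : Fin r → R[X], F.S.mulVec x = ∑ b, x b • F.S.mulVec (Pi.single b 1) := by
    intro x
    conv_lhs => rw [pi_eq_sum_univ x, Matrix.mulVec_sum]
    refine Finset.sum_congr rfl fun b _ => ?_
    rw [Matrix.mulVec_smul]
    congr 2
    ext c
    simp [Pi.single_apply, eq_comm]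
  rw [h2]
  refine sum_mem fun b _ => Submodule.smul_mem _ _ (Submodule.subset_span ?_)
  have h3 : (Pi.single b 1 : Fin r → R[X]) =
      fun c => ((Pi.single b 1 : Fin r → affRing D R) c).1 := by
    ext c : 1
    by_cases hc : c = b
    · subst hc; simp
    · simp [hc]
  rw [h3]
  exact F.S_mulVec_mem _

variable (R) in
theorem algebraMap_overlapRing_base_injective (D : Divisor) :
    Function.Injective (algebraMap R (overlapRing D R)) := by
  rw [IsScalarTower.algebraMap_eq R R[X] (overlapRing D R)]
  exact (algebraMap_overlapRing_injective D).comp C_injective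

theorem Tuple.vjet_mulVec_base (g : Matrix (Fin r) (Fin r) R) (s : Fin r → R[X])
    (i : Fin (D.k + 1)) (l : ℕ) :
    vjet D i l ((g.map C).mulVec s) = g.mulVec (vjet D i l s) := by
  ext a
  simp only [vjet, Matrix.mulVec, dotProduct, jet_sum, Matrix.map_apply]
  refine Finset.sum_congr rfl fun b _ => ?_
  rw [mul_comm, jet_mul_C, mul_comm]

theorem Tuple.mulVec_mem_of_eq_smul {Λ Λ' : Tuple D r R} {g : GL (Fin r) R} (h : Λ = g • Λ')
    {s : Fin r → R[X]} (hs : s ∈ Λ'.module) : (g.1.map C).mulVec s ∈ Λ.module := by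
  rw [Tuple.mem_module_iff] at hs ⊢
  rw [Tuple.eq_smul_iff] at h
  intro i l hl
  rw [vjet_mulVec_base, vjet_mulVec_base, hs i l hl, Matrix.mulVec_mulVec, Matrix.mulVec_mulVec,
    h i l hl]

theorem Tuple.iso_of_eq_smul {Λ Λ' : Tuple D r R} {g : GL (Fin r) R} (h : Λ = g • Λ') :
    Λ'.bundle.Iso Λ.bundle := by
  have h' : Λ' = g⁻¹ • Λ := by rw [h, inv_smul_smul]
  have key : ∀ (B : Type) [CommRing B] (θ : R →+* B),
      ∃ e : (Fin r → B) ≃ₗ[B] (Fin r → B), ∀ x, e x = (g.1.map θ).mulVec x := by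
    intro B _ θ
    refine ⟨Matrix.toLin'OfInv (M := (g⁻¹).1.map θ) (M' := g.1.map θ) ?_ ?_, fun x => rfl⟩
    · rw [← Matrix.map_mul, ← Units.val_mul, inv_mul_cancel]
      exact Matrix.map_one θ (map_zero θ) (map_one θ)
    · rw [← Matrix.map_mul, ← Units.val_mul, mul_inv_cancel]
      exact Matrix.map_one θ (map_zero θ) (map_one θ)
  obtain ⟨v, hv⟩ := key (infRing D R) (algebraMap R _)
  obtain ⟨w, hw⟩ := key (overlapRing D R) (algebraMap R _)
  have hinv : ∀ (g g' : GL (Fin r) R) (hg : g * g' = 1) (s : Fin r → R[X]),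
      (g.1.map C).mulVec ((g'.1.map C).mulVec s) = s := by
    intro g g' hg s
    rw [Matrix.mulVec_mulVec, ← Matrix.map_mul, ← Units.val_mul, hg]
    erw [Matrix.map_one (C : R →+* R[X]) (map_zero C) (map_one C)]
    rw [Matrix.one_mulVec]
  let f : Λ'.module →ₗ[affRing D R] Λ.module :=
    { toFun := fun s => ⟨_, Tuple.mulVec_mem_of_eq_smul h s.2⟩
      map_add' := fun s t => Subtype.ext (Matrix.mulVec_add _ s.1 t.1)
      map_smul' := fun c s => Subtype.ext (Matrix.mulVec_smul _ c.1 s.1) }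
  let f' : Λ.module →ₗ[affRing D R] Λ'.module :=
    { toFun := fun s => ⟨_, Tuple.mulVec_mem_of_eq_smul h' s.2⟩
      map_add' := fun s t => Subtype.ext (Matrix.mulVec_add _ s.1 t.1)
      map_smul' := fun c s => Subtype.ext (Matrix.mulVec_smul _ c.1 s.1) }
  let u : Λ'.module ≃ₗ[affRing D R] Λ.module := LinearEquiv.ofLinearMap f f'
    (LinearMap.ext fun s => Subtype.ext (hinv g g⁻¹ (mul_inv_cancel g) s.1))
    (LinearMap.ext fun s => Subtype.ext (hinv g⁻¹ g (inv_mul_cancel g) s.1))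
  refine ⟨u, v, w, fun m => ?_, fun m => ?_⟩
  · refine Eq.trans ?_ (hw _).symm
    refine funext fun a => ?_
    change algebraMap R[X] (overlapRing D R) ((g.1.map C).mulVec m.1 a) = _
    rw [RingHom.map_mulVec, Matrix.map_map, IsScalarTower.algebraMap_eq R R[X] (overlapRing D R)]
    rfl
  · refine Eq.trans ?_ (hw _).symm
    refine Eq.trans (congrArg _ (hv m)) ?_
    refine funext fun a => ?_
    exact RingHom.map_mulVec (infToOverlap D R) (g.1.map (algebraMap R (infRing D R))) m a

/-- An isomorphism between two sheaves `M_Λ` is given on the overlap by a constant matrix. -/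
theorem Tuple.exists_constant_matrix {Λ Λ' : Tuple D r R}
    {u : Λ.bundle.M → Λ'.bundle.M} {v : Λ.bundle.N → Λ'.bundle.N}
    {w : Λ.bundle.L →ₗ[overlapRing D R] Λ'.bundle.L}
    (hu : ∀ m, Λ'.bundle.ρ (u m) = w (Λ.bundle.ρ m))
    (hv : ∀ m, Λ'.bundle.σ (v m) = w (Λ.bundle.σ m)) :
    ∃ G : Matrix (Fin r) (Fin r) R, ∀ x : Fin r → overlapRing D R,
      w x = (G.map (algebraMap R (overlapRing D R))).mulVec x := by
  let w' : (Fin r → overlapRing D R) →ₗ[overlapRing D R] (Fin r → overlapRing D R) := w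
  -- Since M_Λ generates R[z]^r, the map w preserves polynomial vectors. It also sends basis vectors
  -- to vectors regular at infinity, so its matrix entries are both, hence constant.
  have hpoly : ∀ s : Fin r → R[X], ∃ t : Fin r → R[X],
      w' (fun a => algebraMap R[X] (overlapRing D R) (s a)) =
        fun a => algebraMap R[X] (overlapRing D R) (t a) := by
    intro s
    have hs := Λ.span_module s
    induction hs using Submodule.span_induction with
    | mem s hs => exact ⟨(u ⟨s, hs⟩).1, (hu ⟨s, hs⟩).symm⟩
    | zero =>
      refine ⟨0, ?_⟩
      have : (fun a : Fin r => algebraMap R[X] (overlapRing D R) ((0 : Fin r → R[X]) a)) = 0 :=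
        funext fun a => map_zero _
      rw [this, map_zero]
    | add s t _ _ hs ht =>
      obtain ⟨s', hs⟩ := hs
      obtain ⟨t', ht⟩ := ht
      refine ⟨s' + t', ?_⟩
      have : ∀ s t : Fin r → R[X], (fun a => algebraMap R[X] (overlapRing D R) ((s + t) a)) =
          (fun a => algebraMap R[X] (overlapRing D R) (s a)) +
            fun a => algebraMap R[X] (overlapRing D R) (t a) :=
        fun s t => funext fun a => map_add _ _ _
      rw [this, map_add, hs, ht, this]
    | smul c s _ hs =>
      obtain ⟨s', hs⟩ := hs
      refine ⟨c • s', ?_⟩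
      have : ∀ s : Fin r → R[X], (fun a => algebraMap R[X] (overlapRing D R) ((c • s) a)) =
          algebraMap R[X] (overlapRing D R) c •
            fun a => algebraMap R[X] (overlapRing D R) (s a) :=
        fun s => funext fun a => map_mul _ _ _
      rw [this, map_smul, hs, this]
  have hconst : ∀ a b, ∃ c : R, w' (Pi.single b 1) a = algebraMap R (overlapRing D R) c := by
    intro a b
    obtain ⟨t, ht⟩ := hpoly (Pi.single b 1)
    have e1 : (fun a => algebraMap R[X] (overlapRing D R) ((Pi.single b 1 : Fin r → R[X]) a)) =
        Pi.single b 1 := by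
      ext c
      by_cases hc : c = b
      · subst hc; simp
      · simp [hc]
    have e2 : Λ.bundle.σ (Pi.single b 1 : Fin r → infRing D R) =
        (Pi.single b 1 : Fin r → overlapRing D R) := by
      refine funext fun c => ?_
      change infToOverlap D R ((Pi.single b 1 : Fin r → infRing D R) c) = _
      by_cases hc : c = b
      · subst hc; simp
      · simp [hc]
    rw [e1] at ht
    have h1 := hv (Pi.single b 1 : Fin r → infRing D R)
    rw [e2] at h1
    have h2 : w' (Pi.single b 1) a ∈ infRing D R := by
      have : w' (Pi.single b 1) = _ := h1.symm
      rw [this]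
      exact (v (Pi.single b 1 : Fin r → infRing D R) a).2
    rw [ht] at h2 ⊢
    obtain ⟨c, hc⟩ := eq_C_of_algebraMap_mem D h2
    exact ⟨c, by simp only [hc, IsScalarTower.algebraMap_apply R R[X] (overlapRing D R)]; rfl⟩
  choose G hG using hconst
  refine ⟨Matrix.of G, fun x => ?_⟩
  have : w' = Matrix.toLin' ((Matrix.of G).map (algebraMap R (overlapRing D R))) := by
    refine LinearMap.pi_ext' fun b => LinearMap.ext_ring ?_
    ext a
    simp [hG]
  exact LinearMap.congr_fun this x

theorem Tuple.iso_iff (Λ Λ' : Tuple D r R) :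
    Λ.bundle.Iso Λ'.bundle ↔ ∃ g : GL (Fin r) R, Λ = g • Λ' := by
  constructor
  · rintro ⟨u, v, w, hu, hv⟩
    obtain ⟨G, hG⟩ := Tuple.exists_constant_matrix (w := w.toLinearMap) hu hv
    obtain ⟨G', hG'⟩ := Tuple.exists_constant_matrix (Λ := Λ') (Λ' := Λ) (u := u.symm)
      (v := v.symm) (w := w.symm.toLinearMap)
      (fun m => by
        have := hu (u.symm m)
        rw [LinearEquiv.apply_symm_apply] at this
        rw [this]
        exact (w.symm_apply_apply _).symm)
      (fun m => by
        have := hv (v.symm m)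
        rw [LinearEquiv.apply_symm_apply] at this
        rw [this]
        exact (w.symm_apply_apply _).symm)
    have hmat : ∀ A B : Matrix (Fin r) (Fin r) R,
        (∀ x, (A.map (algebraMap R (overlapRing D R))).mulVec
          ((B.map (algebraMap R (overlapRing D R))).mulVec x) = x) → A * B = 1 := by
      intro A B h
      have h1 : (A * B).map (algebraMap R (overlapRing D R)) =
          (1 : Matrix (Fin r) (Fin r) R).map (algebraMap R (overlapRing D R)) := by
        rw [Matrix.map_mul, Matrix.map_one _ (map_zero _) (map_one _)]
        refine Matrix.ext_of_mulVec_single fun b => ?_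
        rw [← Matrix.mulVec_mulVec, h, Matrix.one_mulVec]
      exact Matrix.map_injective (algebraMap_overlapRing_base_injective R D) h1
    let g : GL (Fin r) R := ⟨G, G',
      hmat _ _ fun x =>
        (congrArg _ (hG' x).symm).trans ((hG _).symm.trans (w.apply_symm_apply x)),
      hmat _ _ fun x =>
        (congrArg _ (hG x).symm).trans ((hG' _).symm.trans (w.symm_apply_apply x))⟩
    have hmem : ∀ s ∈ Λ.module, (G.map C).mulVec s ∈ Λ'.module := by
      intro s hs
      have h1 : (u ⟨s, hs⟩).1 = (G.map C).mulVec s := by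
        have h2 := (hu ⟨s, hs⟩).trans (hG _)
        ext1 a
        refine algebraMap_overlapRing_injective D ?_
        refine (congrFun h2 a).trans ?_
        rw [RingHom.map_mulVec, Matrix.map_map,
          IsScalarTower.algebraMap_eq R R[X] (overlapRing D R)]
        rfl
      rw [← h1]
      exact (u ⟨s, hs⟩).2
    refine ⟨g⁻¹, ?_⟩
    rw [eq_inv_smul_iff, eq_comm, Tuple.eq_smul_iff]
    intro i l hl
    obtain ⟨F⟩ := Λ.nonempty_frame
    -- The test section is the b-th column of S. Its value at P_1 is a basis vector, so the jets of
    -- its image compare the b-th columns.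
    refine Matrix.ext_of_mulVec_single fun b => ?_
    have h1 : F.S.mulVec (fun c => C ((Pi.single b 1 : Fin r → R) c)) ∈ Λ.module :=
      (Λ.mem_module_iff_exists F.jet_S _).mpr ⟨_, 0, by rw [smul_zero, add_zero]⟩
    have h2 := (Λ'.mem_module_iff _).mp (hmem _ h1) i l hl
    rw [vjet_mulVec_base, vjet_mulVec_base, vjet_mulVec_C, vjet_mulVec_C, F.jet_S i l hl,
      F.jet_S 0 0 (D.n_pos 0), Λ.jetMat_zero_zero, Matrix.one_mulVec] at h2
    rw [← Matrix.mulVec_mulVec, ← Matrix.mulVec_mulVec]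
    exact h2.symm
  · rintro ⟨g, hg⟩
    exact (Tuple.iso_of_eq_smul hg).symm

end Conjugation

/-! ### Finiteness of the first cohomology -/

section FiniteCohomology

variable {D : Divisor} {R : Type} [CommRing R] [Algebra ℂ R]

theorem QCoh.cech_apply (E : QCoh D R) (x : E.M × E.N) : E.cech x = E.ρ x.1 - E.σ x.2 := rfl

theorem QCoh.ρ_mem_range_cech (E : QCoh D R) (m : E.M) : E.ρ m ∈ LinearMap.range E.cech :=
  ⟨(m, 0), by rw [cech_apply, map_zero, sub_zero]⟩

theorem QCoh.σ_mem_range_cech (E : QCoh D R) (n : E.N) : E.σ n ∈ LinearMap.range E.cech :=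
  ⟨(0, -n), by rw [cech_apply, map_zero, map_neg, zero_sub, neg_neg]⟩

theorem IsBaseChangeAlong.span_image {A A' M M' : Type} [CommRing A] [CommRing A']
    [AddCommGroup M] [AddCommGroup M'] [Module A M] [Module A' M'] {θ : A →+* A'}
    {u : M →ₛₗ[θ] M'} (h : IsBaseChangeAlong θ u) {s : Set M} (hs : Submodule.span A s = ⊤) :
    Submodule.span A' (u '' s) = ⊤ := by
  rw [eq_top_iff, ← h.span_range, Submodule.span_le]
  rintro _ ⟨m, rfl⟩
  have hm : m ∈ Submodule.span A s := hs ▸ Submodule.mem_top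
  induction hm using Submodule.span_induction with
  | mem x hx => exact Submodule.subset_span ⟨x, hx, rfl⟩
  | zero => rw [map_zero]; exact zero_mem _
  | add x y _ _ hx hy => rw [map_add]; exact add_mem hx hy
  | smul a x _ hx => rw [map_smulₛₗ]; exact Submodule.smul_mem _ _ hx

/-- Multiplication by a power of `1 / q` moves sections on the overlap into the sections on the
chart at infinity. -/
theorem QCoh.exists_nodeInv_pow_smul_mem (E : QCoh D R) {ι : Type} [Finite ι] (y : ι → E.L) :
    ∃ e, ∀ i (b : infRing D R), ∃ n, E.σ n = (nodeInv D R ^ e * b.1) • y i := by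
  choose b hb n hn using fun i => E.σ_surj (y i)
  choose c hc using fun i => (hb i).exists_right_inv
  obtain ⟨e, he⟩ := exists_nodeInv_pow_mul_mem D c
  refine ⟨e, fun i b' => ⟨(b' * ⟨_, he e le_rfl i⟩) • n i, ?_⟩⟩
  rw [map_smulₛₗ, hn, smul_smul]
  congr 1
  change b'.1 * (nodeInv D R ^ e * c i) * infToOverlap D R (b i) = _
  linear_combination b'.1 * nodeInv D R ^ e * hc i

theorem algebraMap_smul_mem_span {L : Type} [AddCommGroup L] [Module R L]
    [Module (overlapRing D R) L] [IsScalarTower R (overlapRing D R) L] {N : ℕ} {f : R[X]}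
    (hf : f.natDegree < N) (x : overlapRing D R) (y : L) (W : Submodule R L)
    (hW : ∀ i < N, (x * algebraMap R[X] (overlapRing D R) (X ^ i)) • y ∈ W) :
    (x * algebraMap R[X] (overlapRing D R) f) • y ∈ W := by
  rw [f.as_sum_range' N hf, map_sum, Finset.mul_sum, Finset.sum_smul]
  refine sum_mem fun i hi => ?_
  have h1 : algebraMap R[X] (overlapRing D R) (monomial i (f.coeff i)) =
      algebraMap R (overlapRing D R) (f.coeff i) * algebraMap R[X] (overlapRing D R) (X ^ i) := by
    rw [← C_mul_X_pow_eq_monomial, map_mul, IsScalarTower.algebraMap_apply R R[X] (overlapRing D R)]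
    rfl
  rw [h1, mul_left_comm, mul_smul, algebraMap_smul]
  exact W.smul_mem _ (hW i (Finset.mem_range.mp hi))

/-- The first cohomology of a coherent sheaf is finitely generated. -/
theorem QCoh.exists_fg_sup_range_cech (E : QCoh D R) [Module.Finite (affRing D R) E.M] :
    ∃ U : Submodule R E.L, U.FG ∧ LinearMap.range E.cech ⊔ U = ⊤ := by
  obtain ⟨N, m, hm⟩ := Module.Finite.exists_fin (R := affRing D R) (M := E.M)
  obtain ⟨e, he⟩ := E.exists_nodeInv_pow_smul_mem fun i => E.ρ (m i)
  set K := ∑ i, D.n i + 1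
  set K' := e * (D.k + 1) + 1
  -- In the decomposition of a coefficient, the multiple of Q comes from the affine chart and the
  -- multiple of q^{-e} b from the chart at infinity. The two remainders have bounded degree, so
  -- these monomial multiples of the generators span the rest.
  let f : (Fin N × Fin K) ⊕ (Fin N × Fin K') → E.L := Sum.elim
    (fun p => algebraMap R[X] (overlapRing D R) (X ^ p.2.1) • E.ρ (m p.1))
    (fun p => (nodeInv D R ^ e * algebraMap R[X] (overlapRing D R) (X ^ p.2.1)) • E.ρ (m p.1))
  refine ⟨Submodule.span R (Set.range f), Submodule.fg_span (Set.finite_range f), ?_⟩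
  set W := LinearMap.range E.cech ⊔ Submodule.span R (Set.range f)
  have hW1 : LinearMap.range E.cech ≤ W := le_sup_left
  have hW2 : ∀ p, f p ∈ W := fun p => (le_sup_right : _ ≤ W) (Submodule.subset_span ⟨p, rfl⟩)
  have key : ∀ (x : overlapRing D R) i, x • E.ρ (m i) ∈ W := by
    intro x i
    obtain ⟨g, h₁, h₂, b, hh₁, hh₂, rfl⟩ := exists_overlap_decomposition D e x
    rw [add_smul, add_smul, add_smul]
    refine add_mem (add_mem (add_mem ?_ ?_) ?_) ?_
    · have : algebraMap R[X] (overlapRing D R) (fatPoly D R * g) • E.ρ (m i) =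
          E.ρ ((⟨_, fatPoly_mul_mem D g⟩ : affRing D R) • m i) := by
        rw [map_smulₛₗ]; rfl
      rw [this]
      exact hW1 (E.ρ_mem_range_cech _)
    · obtain ⟨n, hn⟩ := he i b
      rw [← hn]
      exact hW1 (E.σ_mem_range_cech _)
    · have := algebraMap_smul_mem_span (D := D) hh₁ 1 (E.ρ (m i)) W fun j hj => by
        rw [one_mul]; exact hW2 (.inl (i, ⟨j, hj⟩))
      rwa [one_mul] at this
    · exact algebraMap_smul_mem_span (D := D) hh₂ _ (E.ρ (m i)) W fun j hj =>
        hW2 (.inr (i, ⟨j, hj⟩))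
  rw [eq_top_iff]
  rintro y -
  have hy : y ∈ Submodule.span (overlapRing D R) (E.ρ '' Set.range m) := by
    rw [E.isBaseChangeAlong_ρ.span_image hm]; trivial
  rw [← Set.range_comp] at hy
  obtain ⟨c, rfl⟩ := (Submodule.mem_span_range_iff_exists_fun _).mp hy
  exact sum_mem fun i _ => key _ i

theorem QCoh.finite_quotient_range_cech (E : QCoh D R) [Module.Finite (affRing D R) E.M] :
    Module.Finite R (E.L ⧸ LinearMap.range E.cech) := by
  obtain ⟨U, hU, h⟩ := E.exists_fg_sup_range_cech
  have : U.map (LinearMap.range E.cech).mkQ = ⊤ := by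
    rw [eq_top_iff, ← Submodule.range_mkQ (LinearMap.range E.cech), LinearMap.range_eq_map (Submodule.mkQ _),
      ← h,
      Submodule.map_sup]
    simp
  exact ⟨this ▸ hU.map _⟩

end FiniteCohomology

/-! ### Dimension counts -/

section LinearAlgebra

variable {K L : Type} [Field K] [AddCommGroup L] [Module K L] {M P N : Submodule K L}

/-- Dimension count for the Čech complex of `M, N ⊆ L` and a larger submodule `P ⊇ M`. -/
theorem finrank_map_mkQ_add_le (hMP : M ≤ P) [Module.Finite K (L ⧸ (M ⊔ N))]
    [Module.Finite K (P ⊓ N : Submodule K L)] :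
    Module.Finite K (P.map M.mkQ) ∧
      Module.finrank K (P.map M.mkQ) + Module.finrank K (M ⊓ N : Submodule K L) ≤
        Module.finrank K (L ⧸ (M ⊔ N)) + Module.finrank K (P ⊓ N : Submodule K L) ∧
      (P ⊔ N = ⊤ → Module.finrank K (P.map M.mkQ) + Module.finrank K (M ⊓ N : Submodule K L) =
        Module.finrank K (L ⧸ (M ⊔ N)) + Module.finrank K (P ⊓ N : Submodule K L)) := by
  -- These are two maps of the exact sequence from M ∩ N through P ∩ N and P / M to L / (M + N). The
  -- last map f is onto when P + N is everything, which turns the estimate into an equality.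
  let g : (P ⊓ N : Submodule K L) →ₗ[K] P.map M.mkQ :=
    (M.mkQ ∘ₗ (P ⊓ N).subtype).codRestrict _ fun x => ⟨x.1, x.2.1, rfl⟩
  let f : P.map M.mkQ →ₗ[K] L ⧸ (M ⊔ N) :=
    (Submodule.factor (le_sup_left : M ≤ M ⊔ N)) ∘ₗ (P.map M.mkQ).subtype
  have hgf : LinearMap.ker f = LinearMap.range g := by
    ext ⟨_, x, hx, rfl⟩
    rw [LinearMap.mem_ker, LinearMap.mem_range]
    have h1 : f ⟨M.mkQ x, x, hx, rfl⟩ = (M ⊔ N).mkQ x := rfl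
    rw [h1, Submodule.mkQ_apply, Submodule.Quotient.mk_eq_zero, Submodule.mem_sup]
    constructor
    · rintro ⟨m, hm, n, hn, rfl⟩
      refine ⟨⟨n, ?_, hn⟩, Subtype.ext ?_⟩
      · have := P.sub_mem hx (hMP hm)
        rwa [add_sub_cancel_left] at this
      · change M.mkQ n = M.mkQ (m + n)
        rw [map_add, (Submodule.Quotient.mk_eq_zero M).mpr hm |> fun h : M.mkQ m = 0 => h, zero_add]
    · rintro ⟨n, hn⟩
      have h2 : M.mkQ n.1 = M.mkQ x := congrArg Subtype.val hn
      rw [← sub_eq_zero, ← map_sub, Submodule.mkQ_apply, Submodule.Quotient.mk_eq_zero] at h2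
      exact ⟨x - n.1, by rw [← neg_sub]; exact M.neg_mem h2, n.1, n.2.2, sub_add_cancel _ _⟩
  have hfin : Module.Finite K (P.map M.mkQ) := by
    have h1 : Module.Finite K (LinearMap.ker f) := by rw [hgf]; infer_instance
    have h2 : Module.Finite K ((P.map M.mkQ) ⧸ LinearMap.ker f) :=
      Module.Finite.equiv f.quotKerEquivRange.symm
    exact Module.Finite.of_submodule_quotient (LinearMap.ker f)
  let k : (M ⊓ N : Submodule K L) ≃ₗ[K] LinearMap.ker g :=
    { toFun := fun x => ⟨⟨x.1, hMP x.2.1, x.2.2⟩, Subtype.ext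
        ((Submodule.Quotient.mk_eq_zero M).mpr x.2.1)⟩
      map_add' := fun x y => rfl
      map_smul' := fun c x => rfl
      invFun := fun x => ⟨x.1.1, (Submodule.Quotient.mk_eq_zero M).mp
        (congrArg Subtype.val x.2 : M.mkQ x.1.1 = 0), x.1.2.2⟩
      left_inv := fun x => rfl
      right_inv := fun x => rfl }
  have e1 := f.finrank_range_add_finrank_ker
  have e2 := g.finrank_range_add_finrank_ker
  rw [hgf] at e1
  rw [← k.finrank_eq] at e2
  have e3 := Submodule.finrank_le (LinearMap.range f)
  refine ⟨hfin, by omega, fun h => ?_⟩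
  have hf : LinearMap.range f = ⊤ := by
    rw [eq_top_iff]
    rintro x -
    obtain ⟨x, rfl⟩ := (M ⊔ N).mkQ_surjective x
    obtain ⟨p, hp, n, hn, rfl⟩ := Submodule.mem_sup.mp (h ▸ Submodule.mem_top : x ∈ P ⊔ N)
    refine ⟨⟨M.mkQ p, p, hp, rfl⟩, ?_⟩
    change (M ⊔ N).mkQ p = _
    rw [map_add, (Submodule.Quotient.mk_eq_zero (M ⊔ N)).mpr ((le_sup_right : N ≤ M ⊔ N) hn) |>
      fun h : (M ⊔ N).mkQ n = 0 => h, add_zero]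
  rw [hf, finrank_top] at e1
  omega

/-- Constant vectors that are independent over `K` are independent over `K[X]`. -/
theorem linearIndependent_C_comp {ι : Type} {r : ℕ} {c : ι → Fin r → K}
    (hc : LinearIndependent K c) : LinearIndependent K[X] fun i a => C (c i a) := by
  rw [linearIndependent_iff'] at hc ⊢
  intro s p hp i hi
  ext n
  refine hc s (fun i => (p i).coeff n) (funext fun a => ?_) i hi
  have h1 := congrArg (fun f : K[X] => f.coeff n) (congrFun hp a)
  simpa [finsetSum_coeff] using h1

end LinearAlgebra

/-! ### Euler characteristics by comparison with a larger sheaf -/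

section EulerCharacteristic

variable {D : Divisor} {R : Type} [CommRing R] [Algebra ℂ R]

/-- The restriction from the affine part as an `R`-linear map. -/
def QCoh.ρlin (E : QCoh D R) : E.M →ₗ[R] E.L := E.cech ∘ₗ LinearMap.inl R E.M E.N

/-- The restriction from the chart at infinity as an `R`-linear map. -/
def QCoh.σlin (E : QCoh D R) : E.N →ₗ[R] E.L := -(E.cech ∘ₗ LinearMap.inr R E.M E.N)

theorem QCoh.ρlin_apply (E : QCoh D R) (m : E.M) : E.ρlin m = E.ρ m := by
  simp [ρlin, cech_apply]

theorem QCoh.σlin_apply (E : QCoh D R) (n : E.N) : E.σlin n = E.σ n := by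
  simp [σlin, cech_apply]

theorem QCoh.range_cech (E : QCoh D R) :
    LinearMap.range E.cech = LinearMap.range E.ρlin ⊔ LinearMap.range E.σlin := by
  apply le_antisymm
  · rintro _ ⟨x, rfl⟩
    rw [cech_apply, ← ρlin_apply, ← σlin_apply]
    exact sub_mem (Submodule.mem_sup_left ⟨_, rfl⟩) (Submodule.mem_sup_right ⟨_, rfl⟩)
  · refine sup_le ?_ ?_
    · rintro _ ⟨x, rfl⟩
      rw [ρlin_apply]
      exact E.ρ_mem_range_cech x
    · rintro _ ⟨x, rfl⟩
      rw [σlin_apply]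
      exact E.σ_mem_range_cech x

theorem QCoh.finrank_ker_cech (E : QCoh D ℂ) (hρ : Function.Injective E.ρ)
    (hσ : Function.Injective E.σ) : Module.finrank ℂ (LinearMap.ker E.cech) =
      Module.finrank ℂ (LinearMap.range E.ρlin ⊓ LinearMap.range E.σlin : Submodule ℂ E.L) := by
  have hmem : ∀ x : LinearMap.ker E.cech,
      (E.ρlin ∘ₗ LinearMap.fst ℂ E.M E.N ∘ₗ (LinearMap.ker E.cech).subtype) x ∈
        (LinearMap.range E.ρlin ⊓ LinearMap.range E.σlin : Submodule ℂ E.L) := fun x => by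
    refine ⟨⟨_, rfl⟩, x.1.2, ?_⟩
    have := x.2
    rw [LinearMap.mem_ker, cech_apply, sub_eq_zero] at this
    rw [σlin_apply, ← this]
    exact (ρlin_apply _ _).symm
  refine LinearEquiv.finrank_eq (LinearEquiv.ofBijective
    (LinearMap.codRestrict _ _ hmem) ⟨?_, ?_⟩)
  · intro x y hxy
    have h1 : E.ρlin x.1.1 = E.ρlin y.1.1 := congrArg Subtype.val hxy
    rw [ρlin_apply, ρlin_apply] at h1
    have hx := x.2
    have hy := y.2
    rw [LinearMap.mem_ker, cech_apply, sub_eq_zero] at hx hy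
    exact Subtype.ext (Prod.ext (hρ h1) (hσ (hx.symm.trans (h1.trans hy))))
  · rintro ⟨l, ⟨m, hm⟩, n, hn⟩
    refine ⟨⟨(m, n), ?_⟩, Subtype.ext hm⟩
    rw [LinearMap.mem_ker, cech_apply, sub_eq_zero, ← ρlin_apply, ← σlin_apply, hm, hn]

/-- Comparison of the Euler characteristic with that of a larger sheaf. -/
theorem QCoh.eulerChar_bound (E : QCoh D ℂ) [Module.Finite (affRing D ℂ) E.M]
    (hρ : Function.Injective E.ρ) (hσ : Function.Injective E.σ) (P : Submodule ℂ E.L)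
    (hP : LinearMap.range E.ρlin ≤ P)
    [Module.Finite ℂ (P ⊓ LinearMap.range E.σlin : Submodule ℂ E.L)] :
    Module.Finite ℂ (P.map (LinearMap.range E.ρlin).mkQ) ∧
      E.eulerChar + Module.finrank ℂ (P.map (LinearMap.range E.ρlin).mkQ) ≤
        Module.finrank ℂ (P ⊓ LinearMap.range E.σlin : Submodule ℂ E.L) ∧
      (P ⊔ LinearMap.range E.σlin = ⊤ →
        E.eulerChar + Module.finrank ℂ (P.map (LinearMap.range E.ρlin).mkQ) =
          Module.finrank ℂ (P ⊓ LinearMap.range E.σlin : Submodule ℂ E.L)) := by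
  have : Module.Finite ℂ (E.L ⧸ (LinearMap.range E.ρlin ⊔ LinearMap.range E.σlin)) := by
    rw [← E.range_cech]
    exact E.finite_quotient_range_cech
  obtain ⟨h1, h2, h3⟩ := finrank_map_mkQ_add_le (N := LinearMap.range E.σlin) hP
  unfold eulerChar
  rw [E.finrank_ker_cech hρ hσ, E.range_cech]
  exact ⟨h1, by omega, fun h => by have := h3 h; omega⟩

theorem QCoh.Iso.eulerChar_eq {E F : QCoh D ℂ} (h : E.Iso F) : E.eulerChar = F.eulerChar := by
  obtain ⟨u, v, w, h1, h2⟩ := h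
  let u' := u.restrictScalars ℂ
  let v' := v.restrictScalars ℂ
  let w' := w.restrictScalars ℂ
  have h : F.cech ∘ₗ (u'.prodCongr v').toLinearMap = w'.toLinearMap ∘ₗ E.cech := by
    refine LinearMap.ext fun x => ?_
    change F.ρ (u x.1) - F.σ (v x.2) = w (E.ρ x.1 - E.σ x.2)
    rw [h1, h2, map_sub]
  have hk : (LinearMap.ker E.cech).map (u'.prodCongr v').toLinearMap = LinearMap.ker F.cech := by
    ext x
    have h' : ∀ y, F.cech (u'.prodCongr v' y) = w' (E.cech y) := LinearMap.congr_fun h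
    constructor
    · rintro ⟨y, hy, rfl⟩
      rw [LinearMap.mem_ker]
      refine (h' y).trans ?_
      rw [LinearMap.mem_ker.mp hy, map_zero]
    · intro hx
      refine ⟨(u'.prodCongr v').symm x, ?_, LinearEquiv.apply_symm_apply _ _⟩
      rw [SetLike.mem_coe, LinearMap.mem_ker]
      refine w'.injective ?_
      rw [← h', LinearEquiv.apply_symm_apply, map_zero]
      exact hx
  have hr : (LinearMap.range E.cech).map w'.toLinearMap = LinearMap.range F.cech := by
    rw [← LinearMap.range_comp, ← h, LinearMap.range_comp, LinearEquiv.range, Submodule.map_top]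
  unfold eulerChar
  rw [((u'.prodCongr v').submoduleMap (LinearMap.ker E.cech)).finrank_eq,
    (Submodule.Quotient.equiv _ _ w' rfl).finrank_eq]
  erw [hk, hr]

end EulerCharacteristic

/-! ### The degree of M_Λ -/

section Degree

theorem IsBaseChangeAlong.finrank_eq {A A' M M' : Type} [CommRing A] [CommRing A']
    [NoZeroDivisors A'] [AddCommGroup M] [AddCommGroup M'] [Module A M] [Module A' M']
    {θ : A →+* A'} {u : M →ₛₗ[θ] M'} (h : IsBaseChangeAlong θ u) (hθ : Function.Injective θ) :
    Module.finrank A' M' = Module.finrank A M := by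
  let : Algebra A A' := θ.toAlgebra
  let : Module A M' := Module.compHom M' θ
  have : IsScalarTower A A' M' := ⟨fun a b m => mul_smul (θ a) b m⟩
  have : FaithfulSMul A A' := (faithfulSMul_iff_algebraMap_injective A A').mpr hθ
  exact IsBaseChange.finrank_eq h

instance (D : Divisor) : IsDomain (overlapRing D ℂ) :=
  IsLocalization.isDomain_of_le_nonZeroDivisors (M := Submonoid.powers (nodePoly D ℂ)) _
    (Submonoid.powers_le.mpr (mem_nonZeroDivisors_of_ne_zero (monic_nodePoly D ℂ).ne_zero))

variable {D : Divisor} {R : Type} [CommRing R] [Algebra ℂ R] {r : ℕ}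

variable (D R) in
theorem isUnitLocalization_algebraMap :
    IsUnitLocalization (algebraMap R[X] (overlapRing D R)) := by
  refine ⟨algebraMap_overlapRing_injective D, fun x => ?_⟩
  obtain ⟨n, h⟩ := exists_nodePoly_pow_mul_eq D fun _ : Unit => x
  obtain ⟨f, hf⟩ := h ()
  refine ⟨nodePoly D R ^ n, f, ?_, hf.symm⟩
  rw [map_pow]
  exact (isUnit_algebraMap_nodePoly D).pow n

variable (D R r) in
/-- Vectors of polynomials as vectors of functions on the overlap. -/
def polyVec : (Fin r → R[X]) →ₗ[R[X]] (Fin r → overlapRing D R) :=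
  (Algebra.linearMap R[X] (overlapRing D R)).compLeft (Fin r)

theorem polyVec_apply (s : Fin r → R[X]) (a : Fin r) :
    polyVec D R r s a = algebraMap R[X] (overlapRing D R) (s a) := rfl

theorem polyVec_injective : Function.Injective (polyVec D R r) := fun _ _ h =>
  funext fun a => algebraMap_overlapRing_injective D (congrFun h a)

theorem Tuple.ρ_injective (Λ : Tuple D r R) : Function.Injective Λ.bundle.ρ := fun _ _ h =>
  Subtype.ext (polyVec_injective h)

theorem Tuple.σ_injective (Λ : Tuple D r R) : Function.Injective Λ.bundle.σ := fun _ _ h =>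
  funext fun a => Subtype.ext (congrFun h a)

/-- Vectors of polynomials that are regular at infinity are constant. -/
theorem exists_eq_C_of_polyVec_eq {s : Fin r → R[X]} {n : Fin r → infRing D R}
    (h : (fun a => infToOverlap D R (n a)) = polyVec D R r s) :
    ∃ c : Fin r → R, s = fun a => C (c a) := by
  have : ∀ a, ∃ c, s a = C c := fun a => eq_C_of_algebraMap_mem D (by
    rw [← polyVec_apply, ← h]; exact (n a).2)
  choose c hc using this
  exact ⟨c, funext hc⟩

theorem C_mem_infRing (c : R) : algebraMap R[X] (overlapRing D R) (C c) ∈ infRing D R := by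
  simpa using nodeInv_pow_mul_mem D (R := R) (n := 0) (f := C c) (by simp)

/-- The deviation of a vector of polynomials from the conditions defining `M_Λ`. -/
def Tuple.defect (Λ : Tuple D r ℂ) : (Fin r → ℂ[X]) →ₗ[ℂ]
    ({x : Σ i, Fin (D.n i) | x ≠ ⟨0, 0, D.n_pos 0⟩} → Fin r → ℂ) where
  toFun s x := vjet D x.1.1 x.1.2 s - (Λ.jetMat x.1.1 x.1.2).mulVec (vjet D 0 0 s)
  map_add' s t := by
    ext x : 1
    simp only [vjet_add, Matrix.mulVec_add, Pi.add_apply]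
    abel
  map_smul' c s := by
    have h : ∀ i l, vjet D i l (c • s) = c • vjet D i l s := fun i l => funext fun a => by
      change jet D ℂ i l (c • s a) = c * jet D ℂ i l (s a)
      rw [smul_eq_C_mul, mul_comm, jet_mul_C, mul_comm]
    ext x : 1
    simp only [h, Matrix.mulVec_smul, Pi.smul_apply, RingHom.id_apply, smul_sub]

theorem Tuple.mem_ker_defect (Λ : Tuple D r ℂ) (s : Fin r → ℂ[X]) :
    s ∈ LinearMap.ker Λ.defect ↔ s ∈ Λ.module := by
  rw [LinearMap.mem_ker, Tuple.mem_module_iff]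
  constructor
  · intro h i l hl
    by_cases hx : (⟨i, l, hl⟩ : Σ i, Fin (D.n i)) = ⟨0, 0, D.n_pos 0⟩
    · obtain rfl : i = 0 := congrArg Sigma.fst hx
      obtain rfl : l = 0 := by simpa using hx
      rw [Λ.jetMat_zero_zero, Matrix.one_mulVec]
    · exact sub_eq_zero.mp (congrFun h ⟨_, hx⟩)
  · intro h
    exact funext fun x => sub_eq_zero.mpr (h x.1.1 x.1.2 x.1.2.2)

/-- Interpolate with value 0 at P_1, so that the correction by `jetMat` disappears. The index of the
value at P_1 is omitted because its defect is identically zero; this leaves r (∑ n_i - 1)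
independent conditions. -/
theorem Tuple.defect_surjective (Λ : Tuple D r ℂ) : Function.Surjective Λ.defect := by
  classical
  intro y
  choose s hs using fun a : Fin r => exists_jet_eq D (R := ℂ) fun i l =>
    if h : ∃ hl : l < D.n i, (⟨i, l, hl⟩ : Σ i, Fin (D.n i)) ≠ ⟨0, 0, D.n_pos 0⟩ then
      y ⟨⟨i, l, h.1⟩, h.2⟩ a else 0
  have h0 : vjet D 0 0 s = 0 := funext fun a => by
    rw [vjet, hs a 0 0 (D.n_pos 0), dif_neg (by rintro ⟨_, h⟩; exact h rfl)]
    rfl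
  refine ⟨s, funext fun x => ?_⟩
  change vjet D x.1.1 x.1.2 s - _ = _
  rw [h0, Matrix.mulVec_zero, sub_zero]
  refine funext fun a => ?_
  rw [vjet, hs a _ _ x.1.2.2, dif_pos ⟨x.1.2.2, x.2⟩]

/-- Comparison with the trivial bundle on the projective line: its global sections are the
constants, of dimension r, its first cohomology vanishes, and M_Λ has codimension r (∑ n_i - 1) in
it. -/
theorem Tuple.eulerChar_bundle (Λ : Tuple D r ℂ) :
    Λ.bundle.eulerChar = r * (2 - ((∑ i, D.n i : ℕ) : ℤ)) := by
  have := Λ.bundle_isVectorBundle.1.1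
  let ι : (Fin r → ℂ[X]) →ₗ[ℂ] Λ.bundle.L := (polyVec D ℂ r).restrictScalars ℂ
  have hρ : ∀ m : Λ.module, Λ.bundle.ρ m = ι m.1 := fun m => rfl
  let k : (Fin r → ℂ) →ₗ[ℂ] Λ.bundle.L := ι ∘ₗ
    { toFun := fun c a => C (c a)
      map_add' := fun c d => funext fun a => C_add
      map_smul' := fun c d => funext fun a => by simp [smul_eq_C_mul] }
  have hk : Function.Injective k := fun c d h => funext fun a =>
    C_injective (congrFun (polyVec_injective h) a)
  have hrk : LinearMap.range k = LinearMap.range ι ⊓ LinearMap.range Λ.bundle.σlin := by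
    apply le_antisymm
    · rintro _ ⟨c, rfl⟩
      exact ⟨⟨_, rfl⟩, (fun a => ⟨_, C_mem_infRing (c a)⟩ : Fin r → infRing D ℂ),
        (Λ.bundle.σlin_apply _).trans rfl⟩
    · rintro _ ⟨⟨s, rfl⟩, n, hn'⟩
      have hn := (Λ.bundle.σlin_apply n).symm.trans hn'
      obtain ⟨c, rfl⟩ := exists_eq_C_of_polyVec_eq (D := D) (n := n) hn
      exact ⟨c, rfl⟩
  have hle : LinearMap.range Λ.bundle.ρlin ≤ LinearMap.range ι := by
    rintro _ ⟨m, rfl⟩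
    exact ⟨m.1, (Λ.bundle.ρlin_apply m).symm⟩
  -- The overlap decomposition with e = 0 splits every function into a polynomial and a function
  -- regular at infinity.
  have htop : LinearMap.range ι ⊔ LinearMap.range Λ.bundle.σlin = ⊤ := by
    rw [eq_top_iff]
    intro x _
    choose g h₁ h₂ b _ _ h using fun a => exists_overlap_decomposition D 0
      ((x : Fin r → overlapRing D ℂ) a)
    refine Submodule.mem_sup.mpr ⟨ι (fun a => fatPoly D ℂ * g a + h₁ a + h₂ a), ⟨_, rfl⟩,
      Λ.bundle.σlin b, ⟨b, rfl⟩, ?_⟩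
    refine (congrArg (ι _ + ·) (Λ.bundle.σlin_apply b)).trans ?_
    refine funext fun a => ?_
    refine Eq.trans ?_ (h a).symm
    change algebraMap ℂ[X] (overlapRing D ℂ) (fatPoly D ℂ * g a + h₁ a + h₂ a) + (b a).1 = _
    rw [map_add, map_add, pow_zero, one_mul, one_mul]
    ring
  have hfin : Module.Finite ℂ
      (LinearMap.range ι ⊓ LinearMap.range Λ.bundle.σlin : Submodule ℂ Λ.bundle.L) := by
    rw [← hrk]
    infer_instance
  have h1 := (Λ.bundle.eulerChar_bound Λ.ρ_injective Λ.σ_injective _ hle).2.2 htop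
  have h2 : Module.finrank ℂ
      (LinearMap.range ι ⊓ LinearMap.range Λ.bundle.σlin : Submodule ℂ Λ.bundle.L) = r := by
    rw [← hrk, LinearMap.finrank_range_of_inj hk, Module.finrank_fin_fun]
  have h3 : Module.finrank ℂ ((LinearMap.range ι).map (LinearMap.range Λ.bundle.ρlin).mkQ) =
      (∑ i, D.n i - 1) * r := by
    rw [← LinearMap.range_comp]
    set f := (LinearMap.range Λ.bundle.ρlin).mkQ ∘ₗ ι
    have hker : LinearMap.ker f = LinearMap.ker Λ.defect := by
      ext s
      rw [Λ.mem_ker_defect, LinearMap.mem_ker, LinearMap.comp_apply, Submodule.mkQ_apply,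
        Submodule.Quotient.mk_eq_zero]
      constructor
      · rintro ⟨m, hm⟩
        rw [QCoh.ρlin_apply] at hm
        have : m.1 = s := polyVec_injective hm
        exact this ▸ m.2
      · exact fun hs => ⟨⟨s, hs⟩, Λ.bundle.ρlin_apply _⟩
    rw [← f.quotKerEquivRange.finrank_eq, hker,
      (Λ.defect.quotKerEquivOfSurjective Λ.defect_surjective).finrank_eq,
      Module.finrank_pi_fintype]
    simp only [Module.finrank_fin_fun, Finset.sum_const, Finset.card_univ, smul_eq_mul]
    rw [Set.card_ne_eq]
    simp
  rw [h2, h3] at h1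
  have hpos : 1 ≤ ∑ i, D.n i :=
    (D.n_pos 0).trans_le (Finset.single_le_sum (f := D.n) (fun _ _ => Nat.zero_le _)
      (Finset.mem_univ 0))
  push_cast [hpos] at h1
  push_cast
  linarith

/-- The rank may be computed over the overlap, where the bundle is free by definition. -/
theorem Tuple.rank_bundle (Λ : Tuple D r ℂ) : Λ.bundle.rank = r := by
  have h := Λ.bundle.isBaseChangeAlong_ρ.finrank_eq (isUnitLocalization_affToOverlap D).1
  rw [QCoh.rank, ← h]
  exact Module.finrank_fin_fun (overlapRing D ℂ)

/-- The structure sheaf is the sheaf `M_Λ` of the trivial tuple of rank one. -/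
theorem structureSheaf_iso (D : Divisor) : (structureSheaf D R).Iso
    (Tuple.bundle (D := D) (r := 1) (R := R) ⟨fun _ => 1, fun _ _ => 0⟩) := by
  set Λ : Tuple D 1 R := ⟨fun _ => 1, fun _ _ => 0⟩ with hΛ
  have hmem : ∀ s : Fin 1 → R[X], s ∈ Λ.module ↔ s 0 ∈ affRing D R := by
    intro s
    constructor
    · rintro ⟨h1, h2⟩
      have h3 : ∀ i, jet D R 0 0 (s 0) = jet D R i 0 (s 0) := fun i => by
        obtain rfl | ⟨j, rfl⟩ := i.eq_zero_or_eq_succ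
        · rfl
        · have := congrFun (h1 j) 0
          rwa [hΛ, Units.val_one, Matrix.one_mulVec] at this
      refine ⟨fun i j => (h3 i).symm.trans (h3 j), fun i l hl1 hl => ?_⟩
      have := congrFun (h2 i ⟨l - 1, by omega⟩) 0
      rw [hΛ, Matrix.zero_mulVec] at this
      simpa [vjet, Nat.sub_add_cancel hl1] using this
    · rintro ⟨h1, h2⟩
      refine ⟨fun i => ?_, fun i l => ?_⟩
      · rw [hΛ, Units.val_one, Matrix.one_mulVec]
        exact funext fun a => by rw [Subsingleton.elim a 0]; exact h1 _ _
      · rw [hΛ, Matrix.zero_mulVec]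
        exact funext fun a => by
          rw [Subsingleton.elim a 0]; exact h2 i _ (by omega) (by have := l.2; omega)
  let u : affRing D R ≃ₗ[affRing D R] Λ.module :=
    { toFun := fun f => ⟨fun _ => f.1, (hmem _).mpr f.2⟩
      map_add' := fun f g => rfl
      map_smul' := fun f g => rfl
      invFun := fun s => ⟨s.1 0, (hmem _).mp s.2⟩
      left_inv := fun f => rfl
      right_inv := fun s => Subtype.ext (funext fun a => by rw [Subsingleton.elim a 0]) }
  exact ⟨u, (LinearEquiv.funUnique (Fin 1) (infRing D R) (infRing D R)).symm,
    (LinearEquiv.funUnique (Fin 1) (overlapRing D R) (overlapRing D R)).symm,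
    fun m => rfl, fun m => rfl⟩

theorem eulerChar_structureSheaf (D : Divisor) :
    (structureSheaf D ℂ).eulerChar = 2 - ((∑ i, D.n i : ℕ) : ℤ) := by
  rw [(structureSheaf_iso D).eulerChar_eq, Tuple.eulerChar_bundle]
  simp

theorem Tuple.degree_bundle (Λ : Tuple D r ℂ) : Λ.bundle.degree = 0 := by
  rw [QCoh.degree, Λ.eulerChar_bundle, Λ.rank_bundle, eulerChar_structureSheaf, sub_self]

end Degree

/-! ### Semistability of M_Λ -/

section Semistability

variable {D : Divisor} {r : ℕ}

theorem isUnit_algebraMap_fatPoly (D : Divisor) (R : Type) [CommRing R] [Algebra ℂ R] :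
    IsUnit (algebraMap R[X] (overlapRing D R) (fatPoly D R)) := by
  refine isUnit_of_dvd_unit (y := algebraMap R[X] (overlapRing D R)
    (nodePoly D R ^ ∑ i, D.n i)) (map_dvd _ ?_) ?_
  · rw [nodePoly, ← Finset.prod_pow]
    exact Finset.prod_dvd_prod_of_dvd _ _ fun i _ => pow_dvd_pow _
      (Finset.single_le_sum (f := D.n) (fun _ _ => Nat.zero_le _) (Finset.mem_univ i))
  · rw [map_pow]
    exact (isUnit_algebraMap_nodePoly D).pow _

/-- A coherent subsheaf of rank `s` of a bundle `M_Λ` has Euler characteristic at most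
`s (2 - ∑ n_i)`. -/
theorem Tuple.eulerChar_le_of_embeds (Λ : Tuple D r ℂ) {F : QCoh D ℂ} (hF : F.IsCoherent)
    (h : F.Embeds Λ.bundle) : F.eulerChar ≤ F.rank * (2 - ((∑ i, D.n i : ℕ) : ℤ)) := by
  obtain ⟨u, v, w₀, h1, h2, hu, hv⟩ := h
  have := hF.1
  let w : F.L →ₗ[overlapRing D ℂ] (Fin r → overlapRing D ℂ) := w₀
  have h1' : ∀ m, w (F.ρ m) = polyVec D ℂ r (u m).1 := fun m => (h1 m).symm
  have h2' : ∀ n, w (F.σ n) = fun a => infToOverlap D ℂ ((v n : Fin r → infRing D ℂ) a) :=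
    fun n => (h2 n).symm
  have hρ : Function.Injective F.ρ := fun x y hxy => hu (Λ.ρ_injective (by rw [h1, h1, hxy]))
  have hσ : Function.Injective F.σ := fun x y hxy => hv (Λ.σ_injective (by rw [h2, h2, hxy]))
  have hw : Function.Injective w := by
    rw [injective_iff_map_eq_zero]
    intro l hl
    obtain ⟨a, ha, m, hm⟩ := F.ρ_surj l
    have hl' : w (affToOverlap D ℂ a • l) = 0 := by rw [map_smul, hl, smul_zero]
    have h3 : u m = 0 := Λ.ρ_injective (by
      rw [h1, hm, map_zero]
      exact hl')
    obtain rfl : m = 0 := hu (h3.trans (map_zero u).symm)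
    rw [map_zero] at hm
    exact (ha.smul_eq_zero.mp hm.symm)
  -- the polynomial vectors generically contained in the subsheaf
  let Pp : Submodule ℂ[X] (Fin r → ℂ[X]) :=
    ((LinearMap.range w).restrictScalars ℂ[X]).comap (polyVec D ℂ r)
  have hPp : ∀ s, s ∈ Pp ↔ ∃ l, w l = polyVec D ℂ r s := fun s => Iff.rfl
  choose e₀ he₀ using fun s : Pp => (hPp s.1).mp s.2
  let e : Pp →ₛₗ[algebraMap ℂ[X] (overlapRing D ℂ)] F.L :=
    { toFun := e₀
      map_add' := fun s t => hw (by rw [he₀, map_add, he₀, he₀]; exact map_add _ _ _)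
      map_smul' := fun f s => hw (by
        rw [he₀, map_smul, he₀]
        exact ((polyVec D ℂ r).map_smul f s.1).trans (algebraMap_smul _ _ _).symm) }
  have he : ∀ s, w (e s) = polyVec D ℂ r s.1 := he₀
  -- Powers of q clear denominators, so `Pp` localizes to the module of F over the overlap, which
  -- has the same rank as F.
  have hrank : Module.finrank ℂ[X] Pp = F.rank := by
    have hsurj : ∀ x : F.L, ∃ f : ℂ[X], IsUnit (algebraMap ℂ[X] (overlapRing D ℂ) f) ∧
        ∃ s, e s = algebraMap ℂ[X] (overlapRing D ℂ) f • x := fun x => by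
      obtain ⟨n, hn⟩ := exists_nodePoly_pow_mul_eq D (w x)
      choose f hf using hn
      have hx : w (algebraMap ℂ[X] (overlapRing D ℂ) (nodePoly D ℂ ^ n) • x) =
          polyVec D ℂ r f := (map_smul w _ x).trans (funext hf)
      refine ⟨nodePoly D ℂ ^ n, ?_, ⟨f, (hPp f).mpr ⟨_, hx⟩⟩, hw ((he _).trans hx.symm)⟩
      rw [map_pow]
      exact (isUnit_algebraMap_nodePoly D).pow n
    have hinj : ∀ s, e s = 0 → s = 0 := fun s hs => by
      refine Subtype.ext (polyVec_injective (D := D) ?_)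
      rw [← he, hs, map_zero]
      exact (map_zero (polyVec D ℂ r)).symm
    have hbc : IsBaseChangeAlong _ e :=
      (isUnitLocalization_algebraMap D ℂ).isBaseChangeAlong_iff.mpr
        ⟨hsurj, fun s hs => ⟨1, by simp, by rw [one_smul, hinj s hs]⟩⟩
    rw [← hbc.finrank_eq (algebraMap_overlapRing_injective D),
      F.isBaseChangeAlong_ρ.finrank_eq (isUnitLocalization_affToOverlap D).1, QCoh.rank]
  -- The same polynomial vectors, seen inside F over the overlap. With `rank F` bounding the global
  -- sections of P, and `rank F` times ∑ n_i - 1 bounding the codimension of F in P from below, the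
  -- comparison of Euler characteristics gives the claim.
  let P : Submodule ℂ F.L :=
    ((LinearMap.range (polyVec D ℂ r)).restrictScalars ℂ).comap (w.restrictScalars ℂ)
  have hle : LinearMap.range F.ρlin ≤ P := by
    rintro _ ⟨m, rfl⟩
    exact ⟨(u m).1, by rw [F.ρlin_apply]; exact (h1' m).symm⟩
  -- global sections
  have hH : ∀ x : (P ⊓ LinearMap.range F.σlin : Submodule ℂ F.L), ∃ c : Fin r → ℂ,
      w x = polyVec D ℂ r fun a => C (c a) := by
    rintro ⟨l, ⟨s, hs⟩, n, hn⟩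
    rw [F.σlin_apply] at hn
    have hs' : polyVec D ℂ r s = w l := hs
    rw [← hn, h2'] at hs'
    obtain ⟨c, rfl⟩ := exists_eq_C_of_polyVec_eq hs'.symm
    exact ⟨c, hs.symm⟩
  choose c hc using hH
  have hcadd : ∀ x y, c (x + y) = c x + c y := fun x y => by
    refine funext fun a => C_injective (congrFun (polyVec_injective (D := D) (R := ℂ)
      (a₁ := fun a => C (c (x + y) a)) (a₂ := fun a => C ((c x + c y) a)) ?_) a)
    rw [← hc, Submodule.coe_add, map_add, hc, hc, ← map_add]
    exact congrArg _ (funext fun a => C_add.symm)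
  have hcsmul : ∀ (k : ℂ) x, c (k • x) = k • c x := fun k x => by
    refine funext fun a => C_injective (congrFun (polyVec_injective (D := D) (R := ℂ)
      (a₁ := fun a => C (c (k • x) a)) (a₂ := fun a => C ((k • c x) a)) ?_) a)
    rw [← hc, Submodule.coe_smul, smul_eq_of_tower (A := overlapRing D ℂ), map_smul, hc]
    refine funext fun a => ?_
    rw [Pi.smul_apply, polyVec_apply, polyVec_apply, smul_eq_mul, Pi.smul_apply, smul_eq_mul,
      C_mul, map_mul, IsScalarTower.algebraMap_apply ℂ ℂ[X] (overlapRing D ℂ)]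
    rfl
  let g : (P ⊓ LinearMap.range F.σlin : Submodule ℂ F.L) →ₗ[ℂ] (Fin r → ℂ) :=
    { toFun := c, map_add' := hcadd, map_smul' := hcsmul }
  have hg : Function.Injective g := fun x y hxy => Subtype.ext (hw (by
    have hxy' : c x = c y := hxy
    rw [hc, hc, hxy']))
  have hfin : Module.Finite ℂ (P ⊓ LinearMap.range F.σlin : Submodule ℂ F.L) :=
    .of_injective g hg
  -- Global sections are constant vectors, and vectors independent over ℂ stay independent over
  -- ℂ[z]; so their number is bounded by the rank of `Pp`.
  have hHle : Module.finrank ℂ (P ⊓ LinearMap.range F.σlin : Submodule ℂ F.L) ≤ F.rank := by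
    have b := Module.finBasis ℂ (P ⊓ LinearMap.range F.σlin : Submodule ℂ F.L)
    have hb : LinearIndependent ℂ (g ∘ b) := b.linearIndependent.map' g
      (LinearMap.ker_eq_bot.mpr hg)
    have hb' := linearIndependent_C_comp hb
    have hb'' : LinearIndependent ℂ[X] (fun i => (⟨fun a => C (g (b i) a),
        (hPp _).mpr ⟨_, hc (b i)⟩⟩ : Pp)) := LinearIndependent.of_comp Pp.subtype hb'
    have := hb''.fintype_card_le_finrank
    rwa [Fintype.card_fin, hrank] at this
  obtain ⟨hfin', hbound, -⟩ := F.eulerChar_bound hρ hσ P hle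
  have hpos : 1 ≤ ∑ i, D.n i :=
    (D.n_pos 0).trans_le (Finset.single_le_sum (f := D.n) (fun _ _ => Nat.zero_le _)
      (Finset.mem_univ 0))
  have hlow : F.rank * (∑ i, D.n i - 1) ≤
      Module.finrank ℂ (P.map (LinearMap.range F.ρlin).mkQ) := by
    have b := Module.finBasis ℂ[X] Pp
    -- Test vectors in a basis of `Pp` have coordinates x₀ p_j with deg p_j < ∑ n_i - 1. If one of
    -- them comes from F it is a section of M_Λ that vanishes at P_1, so all its jets along D vanish
    -- and it is divisible by Q. Its coordinates have degree less than deg Q, hence are zero.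
    let x₀ : ℂ[X] := X - C (D.P 0)
    let y : (Fin (Module.finrank ℂ[X] Pp) → degreeLT ℂ (∑ i, D.n i - 1)) → Pp :=
      fun p => ∑ j, (x₀ * (p j).1) • b j
    let T : (Fin (Module.finrank ℂ[X] Pp) → degreeLT ℂ (∑ i, D.n i - 1)) →ₗ[ℂ] F.L :=
      { toFun := fun p => e (y p)
        map_add' := fun p p' => by
          rw [← map_add]
          congr 1
          simp only [y, Pi.add_apply, Submodule.coe_add, mul_add, add_smul,
            Finset.sum_add_distrib]
        map_smul' := fun k p => by
          have : y (k • p) = (C k : ℂ[X]) • y p := by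
            simp only [y, Pi.smul_apply, Submodule.coe_smul, smul_eq_C_mul, Finset.smul_sum,
              smul_smul]
            exact Finset.sum_congr rfl fun j _ => by ring_nf
          rw [this, map_smulₛₗ, RingHom.id_apply, smul_eq_of_tower (A := overlapRing D ℂ) k,
            IsScalarTower.algebraMap_apply ℂ ℂ[X] (overlapRing D ℂ)]
          rfl }
    let T' := (LinearMap.range F.ρlin).mkQ ∘ₗ T
    have hT' : LinearMap.range T' ≤ P.map (LinearMap.range F.ρlin).mkQ := by
      rintro _ ⟨p, rfl⟩
      exact ⟨T p, ⟨(y p).1, (he _).symm⟩, rfl⟩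
    have hinj : Function.Injective T' := by
      rw [injective_iff_map_eq_zero]
      intro p hp
      obtain ⟨m, hm⟩ := (Submodule.Quotient.mk_eq_zero _).mp hp
      rw [F.ρlin_apply] at hm
      have hm' : (u m).1 = (y p).1 := polyVec_injective (by
        rw [← h1', hm, ← he]
        rfl)
      have hy : ∃ t : Pp, y p = x₀ • t :=
        ⟨∑ j, (p j).1 • b j, by simp only [y, Finset.smul_sum, smul_smul]⟩
      have h0 : vjet D 0 0 (u m).1 = 0 := by
        obtain ⟨t, ht⟩ := hy
        rw [hm', ht]
        refine funext fun a => ?_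
        change jet D ℂ 0 0 (x₀ * t.1 a) = 0
        simp [jet, x₀]
      have hall : ∀ i l, l < D.n i → vjet D i l (u m).1 = 0 := fun i l hl => by
        rw [(Λ.mem_module_iff _).mp (u m).2 i l hl, h0, Matrix.mulVec_zero]
      obtain ⟨t, ht⟩ := (vjet_eq_zero_iff _).mp hall
      -- Q is a unit on the overlap, so the quotient by Q still lies in F there; divisibility
      -- therefore passes to the coordinates in the basis.
      have htP : t ∈ Pp := by
        obtain ⟨c', hc'⟩ := (isUnit_algebraMap_fatPoly D ℂ).exists_left_inv
        refine (hPp t).mpr ⟨c' • F.ρ m, ?_⟩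
        rw [map_smul, h1', ht]
        refine funext fun a => ?_
        change c' * algebraMap _ _ (fatPoly D ℂ * t a) = algebraMap _ _ (t a)
        rw [map_mul, ← mul_assoc, hc', one_mul]
      have hyt : y p = fatPoly D ℂ • (⟨t, htP⟩ : Pp) := Subtype.ext (hm'.symm.trans ht)
      refine funext fun j => Subtype.ext ?_
      have hj : x₀ * (p j).1 = fatPoly D ℂ * b.repr ⟨t, htP⟩ j := by
        have h3 := congrArg (fun z => b.repr z j) hyt
        simp only [map_smul, Finsupp.smul_apply, smul_eq_mul] at h3
        rw [← h3]
        simp only [y]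
        rw [Module.Basis.repr_sum_self]
      by_contra hne
      have hne' : (p j).1 ≠ 0 := hne
      have hx₀ : x₀ ≠ 0 := X_sub_C_ne_zero _
      have hr : b.repr ⟨t, htP⟩ j ≠ 0 := by
        intro h4
        rw [h4, mul_zero] at hj
        exact mul_ne_zero hx₀ hne' hj
      have hd := congrArg natDegree hj
      have hlt : (p j).1.natDegree < ∑ i, D.n i - 1 :=
        (natDegree_lt_iff_degree_lt hne').mpr (mem_degreeLT.mp (p j).2)
      rw [natDegree_mul hx₀ hne', natDegree_mul (monic_fatPoly D ℂ).ne_zero hr,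
        natDegree_fatPoly, natDegree_X_sub_C] at hd
      omega
    have h5 := Submodule.finrank_mono hT'
    rw [LinearMap.finrank_range_of_inj hinj, Module.finrank_pi_fintype] at h5
    simpa [(degreeLTEquiv ℂ (∑ i, D.n i - 1)).finrank_eq, hrank] using h5
  zify [hpos] at hlow hHle
  push_cast at hlow ⊢
  nlinarith

theorem Tuple.bundle_isSemistable (Λ : Tuple D r ℂ) : Λ.bundle.IsSemistable := by
  intro F hF h
  rw [Λ.degree_bundle, zero_mul]
  refine mul_nonpos_of_nonpos_of_nonneg ?_ (Nat.cast_nonneg _)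
  rw [QCoh.degree, eulerChar_structureSheaf, sub_nonpos]
  exact Λ.eulerChar_le_of_embeds hF h

end Semistability

/-! ### Scalars from the base; injectivity of restriction -/

section BaseScalars

theorem semilinear_map_base_smul {R S A A' M M' : Type} [CommRing R] [CommRing S] [CommRing A]
    [CommRing A'] [Algebra R A] [Algebra S A'] [AddCommGroup M] [AddCommGroup M'] [Module A M]
    [Module A' M'] [Module R M] [Module S M'] [IsScalarTower R A M] [IsScalarTower S A' M']
    {θ : A →+* A'} (u : M →ₛₗ[θ] M') {c : R} {d : S}
    (h : θ (algebraMap R A c) = algebraMap S A' d) (m : M) : u (c • m) = d • u m := by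
  rw [smul_eq_of_tower (A := A), map_smulₛₗ, h, ← smul_eq_of_tower]

/-- Sections of a projective module inject into the sections over a localization. -/
theorem IsUnitLocalization.injective_of_projective {A A' M M' : Type} [CommRing A] [CommRing A']
    [AddCommGroup M] [AddCommGroup M'] [Module A M] [Module A' M'] {θ : A →+* A'}
    {u : M →ₛₗ[θ] M'} (hθ : IsUnitLocalization θ) (hu : IsBaseChangeAlong θ u)
    [Module.Projective A M] : Function.Injective u := by
  rw [injective_iff_map_eq_zero]
  intro m hm
  obtain ⟨a, ha, h⟩ := (hθ.isBaseChangeAlong_iff.mp hu).2 m hm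
  obtain ⟨s, hs⟩ := Module.projective_def'.mp ‹Module.Projective A M›
  have h1 : s m = 0 := Finsupp.ext fun x => by
    have h2 : a * s m x = 0 := by
      rw [← smul_eq_mul, ← Finsupp.smul_apply, ← map_smul, h, map_zero, Finsupp.zero_apply]
    have h3 : θ a * θ (s m x) = 0 := by rw [← map_mul, h2, map_zero]
    exact hθ.1 ((ha.mul_right_eq_zero.mp h3).trans (map_zero θ).symm)
  have := LinearMap.congr_fun hs m
  rw [LinearMap.comp_apply, h1, map_zero] at this
  exact this.symm

end BaseScalars

/-! ### Bundles with a frame are of the form M_Λ -/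

section LocalFrames

variable {D : Divisor} {R : Type} [CommRing R] [Algebra ℂ R]

variable (D R) in
/-- The functions vanishing on the divisor `D`, as an ideal of the ring of the affine chart. -/
def fatIdeal : Ideal (affRing D R) where
  carrier := {a | ∃ g, a.1 = fatPoly D R * g}
  zero_mem' := ⟨0, (mul_zero _).symm⟩
  add_mem' := by
    rintro a b ⟨g, hg⟩ ⟨h, hh⟩
    exact ⟨g + h, by rw [mul_add, ← hg, ← hh]; rfl⟩
  smul_mem' := by
    rintro c a ⟨g, hg⟩
    exact ⟨c.1 * g, by rw [mul_left_comm, ← hg]; rfl⟩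

/-- Modulo `fatIdeal` only the constants R remain, so a finite module on the affine chart becomes
finite over R after reduction along D. -/
theorem exists_algebraMap_add_fatIdeal (a : affRing D R) :
    ∃ c, ∃ j ∈ fatIdeal D R, a = algebraMap R (affRing D R) c + j := by
  obtain ⟨g, hg⟩ := (mem_affRing_iff D a.1).mp a.2
  exact ⟨_, ⟨_, fatPoly_mul_mem D g⟩, ⟨g, rfl⟩, Subtype.ext hg⟩

instance (E : QCoh D R) : Module R[X] E.L :=
  Module.compHom E.L (algebraMap R[X] (overlapRing D R))

instance (E : QCoh D R) : IsScalarTower R[X] (overlapRing D R) E.L :=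
  ⟨fun f x l => by rw [Algebra.smul_def, mul_smul]; rfl⟩

instance (E : QCoh D R) : IsScalarTower R R[X] E.L :=
  ⟨fun c f l => by
    rw [← algebraMap_smul (overlapRing D R) (c • f) l, ← algebraMap_smul (overlapRing D R) f l,
      Algebra.smul_def, map_mul, mul_smul, ← IsScalarTower.algebraMap_apply R R[X]]
    exact algebraMap_smul (overlapRing D R) c (M := E.L) _⟩

/-- The `R[z]`-module generated by the sections over the affine chart. -/
def QCoh.polySpan (E : QCoh D R) : Submodule R[X] E.L := Submodule.span R[X] (Set.range E.ρ)

theorem QCoh.ρ_smul (E : QCoh D R) (a : affRing D R) (m : E.M) : E.ρ (a • m) = a.1 • E.ρ m := by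
  rw [map_smulₛₗ]
  exact algebraMap_smul (overlapRing D R) a.1 (E.ρ m)

/-- Sections of `E` which generate it up to multiplication by `x`: the `n a` over the chart at
infinity, where they are also polynomial over the affine chart, and the `m a` modulo functions
vanishing on the divisor `D`. -/
structure QCoh.LocalFrame (E : QCoh D R) (r : ℕ) (x : R) where
  n : Fin r → E.N
  m : Fin r → E.M
  σ_mem : ∀ a, E.σ (n a) ∈ E.polySpan
  smul_ρ_mem : ∀ y, x • E.ρ y ∈ Submodule.span R[X] (Set.range fun a => E.σ (n a))
  smul_mem : ∀ y, x • y ∈ Submodule.span (infRing D R) (Set.range n)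
  smul_mem_sup : ∀ y, x • y ∈ Submodule.span R (Set.range m) ⊔
    (fatIdeal D R • (⊤ : Submodule (affRing D R) E.M)).restrictScalars R

variable {S : Type} [CommRing S] [Algebra ℂ S]

theorem semilinear_map_poly_smul {E : QCoh D R} {F : QCoh D S} {φ : R →ₐ[ℂ] S}
    (w : E.L →ₛₗ[overlapMap D φ] F.L) (f : R[X]) (l : E.L) :
    w (f • l) = f.map φ.toRingHom • w l := by
  rw [← algebraMap_smul (overlapRing D R) f l, map_smulₛₗ, overlapMap_algebraMap, algebraMap_smul]

theorem semilinear_map_mem_span {E : QCoh D R} {F : QCoh D S} {φ : R →ₐ[ℂ] S}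
    (w : E.L →ₛₗ[overlapMap D φ] F.L) {s : Set E.L} {V : Submodule S[X] F.L}
    (h : ∀ l ∈ s, w l ∈ V) {l : E.L} (hl : l ∈ Submodule.span R[X] s) : w l ∈ V := by
  induction hl using Submodule.span_induction with
  | mem x hx => exact h x hx
  | zero => rw [map_zero]; exact zero_mem _
  | add x y _ _ hx hy => rw [map_add]; exact add_mem hx hy
  | smul f x _ hx => rw [semilinear_map_poly_smul]; exact V.smul_mem _ hx

/-- Sections over a pullback which generate locally generate globally where `x` is invertible. -/
theorem QCoh.LocalFrame.map {E : QCoh D R} {F : QCoh D S} {φ : R →ₐ[ℂ] S} {r : ℕ} {x : R}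
    (K : E.LocalFrame r x) (h : IsPullback φ E F) (hx : IsUnit (φ x)) :
    Nonempty (F.LocalFrame r 1) := by
  obtain ⟨u, v, w, h1, h2, hu, hv, hw⟩ := h
  -- Images of sections of E generate the pullback. On them each property holds up to the factor φ
  -- x, which y cancels.
  obtain ⟨y, hy⟩ := hx.exists_left_inv
  have hL : ∀ (c : R) l, w (c • l) = φ c • w l := fun c l =>
    semilinear_map_base_smul w (overlapMap_algebraMap_base D φ c) l
  have hM : ∀ (c : R) l, u (c • l) = φ c • u l := fun c l =>
    semilinear_map_base_smul u (affMap_algebraMap D φ c) l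
  have hN : ∀ (c : R) l, v (c • l) = φ c • v l := fun c l =>
    semilinear_map_base_smul v (infMap_algebraMap D φ c) l
  refine ⟨⟨fun a => v (K.n a), fun a => u (K.m a), fun a => ?_, fun z => ?_, fun z => ?_,
    fun z => ?_⟩⟩
  · rw [h2]
    refine semilinear_map_mem_span w ?_ (K.σ_mem a)
    rintro _ ⟨m, rfl⟩
    rw [← h1]
    exact Submodule.subset_span ⟨_, rfl⟩
  · set V := Submodule.span S[X] (Set.range fun a => F.σ (v (K.n a))) with hV
    rw [one_smul]
    have hz : z ∈ Submodule.span (affRing D S) (Set.range u) := by rw [hu.span_range]; trivial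
    induction hz using Submodule.span_induction with
    | mem z hz =>
      obtain ⟨m, rfl⟩ := hz
      have h3 : w (x • E.ρ m) ∈ V := semilinear_map_mem_span w (by
        rintro _ ⟨a, rfl⟩
        rw [← h2]
        exact Submodule.subset_span ⟨a, rfl⟩) (K.smul_ρ_mem m)
      rw [hL, ← h1] at h3
      have h4 := V.smul_of_tower_mem y h3
      rwa [smul_smul, hy, one_smul] at h4
    | zero => rw [map_zero]; exact zero_mem _
    | add z z' _ _ hz hz' => rw [map_add]; exact add_mem hz hz'
    | smul a z _ hz => rw [QCoh.ρ_smul]; exact V.smul_mem _ hz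
  · set V := Submodule.span (infRing D S) (Set.range fun a => v (K.n a)) with hV
    rw [one_smul]
    have hz : z ∈ Submodule.span (infRing D S) (Set.range v) := by rw [hv.span_range]; trivial
    induction hz using Submodule.span_induction with
    | mem z hz =>
      obtain ⟨m, rfl⟩ := hz
      have h3 : v (x • m) ∈ V := by
        have h5 := K.smul_mem m
        generalize x • m = z at h5 ⊢
        induction h5 using Submodule.span_induction with
        | mem _ hz => obtain ⟨a, rfl⟩ := hz; exact Submodule.subset_span ⟨a, rfl⟩
        | zero => rw [map_zero]; exact zero_mem _
        | add z z' _ _ hz hz' => rw [map_add]; exact add_mem hz hz'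
        | smul a z _ hz => rw [map_smulₛₗ]; exact V.smul_mem _ hz
      rw [hN] at h3
      have h4 := V.smul_of_tower_mem y h3
      rwa [smul_smul, hy, one_smul] at h4
    | zero => exact zero_mem _
    | add z z' _ _ hz hz' => exact add_mem hz hz'
    | smul a z _ hz => exact V.smul_mem _ hz
  · set V := Submodule.span S (Set.range fun a => u (K.m a)) ⊔
      (fatIdeal D S • (⊤ : Submodule (affRing D S) F.M)).restrictScalars S with hV
    rw [one_smul]
    have hz : z ∈ Submodule.span (affRing D S) (Set.range u) := by rw [hu.span_range]; trivial
    induction hz using Submodule.span_induction with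
    | mem z hz =>
      obtain ⟨m, rfl⟩ := hz
      have h3 : u (x • m) ∈ V := by
        obtain ⟨p, hp, q, hq, hpq⟩ := Submodule.mem_sup.mp (K.smul_mem_sup m)
        rw [← hpq, map_add]
        refine add_mem (Submodule.mem_sup_left ?_) (Submodule.mem_sup_right ?_)
        · clear hpq
          induction hp using Submodule.span_induction with
          | mem _ hz => obtain ⟨a, rfl⟩ := hz; exact Submodule.subset_span ⟨a, rfl⟩
          | zero => rw [map_zero]; exact zero_mem _
          | add z z' _ _ hz hz' => rw [map_add]; exact add_mem hz hz'
          | smul a z _ hz => rw [hM]; exact Submodule.smul_mem _ _ hz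
        · clear hpq
          have hq' : q ∈ fatIdeal D R • (⊤ : Submodule (affRing D R) E.M) := hq
          change u q ∈ fatIdeal D S • (⊤ : Submodule (affRing D S) F.M)
          refine Submodule.smul_induction_on hq' ?_ fun a b ha hb => ?_
          · rintro j ⟨g, hg⟩ b -
            rw [map_smulₛₗ]
            refine Submodule.smul_mem_smul ⟨g.map φ.toRingHom, ?_⟩ trivial
            rw [← fatPoly_map D φ, ← Polynomial.map_mul, ← hg]
            rfl
          · rw [map_add]
            exact add_mem ha hb
      rw [hM] at h3
      have h4 := V.smul_mem y h3
      rwa [smul_smul, hy, one_smul] at h4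
    | zero => exact zero_mem _
    | add z z' _ _ hz hz' => exact add_mem hz hz'
    | smul a z _ hz =>
      -- V is a module over S only. A function on the affine chart splits into a constant, which
      -- acts on V, and an element of `fatIdeal`, whose multiples lie in V anyway.
      obtain ⟨c, j, hj, rfl⟩ := exists_algebraMap_add_fatIdeal a
      rw [add_smul, ← smul_eq_of_tower]
      have h3 : j • z ∈ fatIdeal D S • (⊤ : Submodule (affRing D S) F.M) :=
        Submodule.smul_mem_smul hj Submodule.mem_top
      have h4 : j • z ∈ (fatIdeal D S • (⊤ : Submodule (affRing D S) F.M)).restrictScalars S := h3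
      exact add_mem (V.smul_mem _ hz) (Submodule.mem_sup_right h4)

theorem QCoh.fatPoly_smul_mem_range_ρ (E : QCoh D R) {l : E.L} (hl : l ∈ E.polySpan) :
    ∃ m, E.ρ m = fatPoly D R • l := by
  -- The extra factor f lets the induction absorb scalars from R[z]: Q f lies in the affine
  -- coordinate ring, while f need not.
  suffices ∀ f : R[X], ∃ m, E.ρ m = (fatPoly D R * f) • l by simpa using this 1
  induction hl using Submodule.span_induction with
  | mem x hx =>
    obtain ⟨m, rfl⟩ := hx
    exact fun f => ⟨(⟨_, fatPoly_mul_mem D f⟩ : affRing D R) • m, E.ρ_smul _ _⟩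
  | zero => exact fun f => ⟨0, by rw [map_zero, smul_zero]⟩
  | add x y _ _ hx hy =>
    intro f
    obtain ⟨m, hm⟩ := hx f
    obtain ⟨m', hm'⟩ := hy f
    exact ⟨m + m', by rw [map_add, hm, hm', smul_add]⟩
  | smul g x _ hx =>
    intro f
    obtain ⟨m, hm⟩ := hx (f * g)
    exact ⟨m, by rw [hm, smul_smul, mul_assoc]⟩

/-- The tuple with prescribed jets. -/
theorem exists_tuple_of_jets {r : ℕ} (S₀ : Matrix (Fin r) (Fin r) R[X])
    (h : ∀ i, IsUnit (S₀.map (jet D R i 0))) : ∃ Λ : Tuple D r R, ∀ s : Fin r → R[X],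
      s ∈ Λ.module ↔ ∃ (c : Fin r → R) (t : Fin r → R[X]),
        s = S₀.mulVec (fun b => C (c b)) + fatPoly D R • t := by
  choose G hG using h
  -- Multiplication of S₀ on the right by the inverse of its value at P_1 normalizes it to 1 there.
  -- This changes only the parametrization by constants c, and the tuple is read off the jets of the
  -- normalized matrix.
  let Λ : Tuple D r R := ⟨fun i => (G i.succ * (G 0)⁻¹)⁻¹,
    fun i l => S₀.map (jet D R i (l + 1)) * ((G i)⁻¹).1⟩
  have hval : ∀ i, Λ.val i = G i * (G 0)⁻¹ := fun i => by
    obtain rfl | ⟨j, rfl⟩ := i.eq_zero_or_eq_succ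
    · rw [mul_inv_cancel]
      rfl
    · exact inv_inv _
  let H : Matrix (Fin r) (Fin r) R := ((G 0)⁻¹).1
  have hjet : ∀ i l, (S₀ * H.map C).map (jet D R i l) = S₀.map (jet D R i l) * H := fun i l => by
    ext a b
    simp only [Matrix.map_apply, Matrix.mul_apply, jet_sum, jet_mul_C]
  have hS : ∀ i l, l < D.n i → (S₀ * H.map C).map (jet D R i l) = Λ.jetMat i l := by
    rintro i (_ | l) hl
    · rw [hjet, ← hG, Tuple.jetMat, hval]
      rfl
    · rw [hjet, Tuple.jetMat, dif_pos (by omega), hval]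
      change _ = S₀.map (jet D R i (l + 1)) * ((G i)⁻¹).1 * ((G i).1 * H)
      rw [mul_assoc, ← mul_assoc _ _ H, Units.inv_mul, one_mul]
  have hC : ∀ (A : Matrix (Fin r) (Fin r) R) (c : Fin r → R),
      (A.map C).mulVec (fun b => C (c b)) = fun a => C (A.mulVec c a) := fun A c => by
    refine funext fun a => ?_
    simp only [Matrix.mulVec, dotProduct, Matrix.map_apply, map_sum, C_mul]
  refine ⟨Λ, fun s => (Λ.mem_module_iff_exists hS s).trans ⟨?_, ?_⟩⟩
  · rintro ⟨c, t, rfl⟩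
    exact ⟨H.mulVec c, t, by rw [← Matrix.mulVec_mulVec, hC]⟩
  · rintro ⟨c, t, rfl⟩
    refine ⟨(G 0).1.mulVec c, t, ?_⟩
    rw [← Matrix.mulVec_mulVec, hC, Matrix.mulVec_mulVec]
    change _ = S₀.mulVec (fun a => C ((((G 0)⁻¹).1 * (G 0).1).mulVec c a)) + _
    rw [Units.inv_mul, Matrix.one_mulVec]

/-- A vector bundle with a frame of this kind is of the form `M_Λ`. -/
theorem QCoh.LocalFrame.exists_iso {E : QCoh D R} {r : ℕ} (K : E.LocalFrame r 1)
    (hE : E.IsVectorBundle r) : ∃ Λ : Tuple D r R, E.Iso Λ.bundle := by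
  obtain ⟨⟨_, _, -⟩, ⟨_, _, hr⟩⟩ := hE
  have hρinj : Function.Injective E.ρ :=
    (isUnitLocalization_affToOverlap D).injective_of_projective E.isBaseChangeAlong_ρ
  obtain ⟨_, _, hrL⟩ := E.isBaseChangeAlong_σ.projective hr
  -- trivializations over the chart at infinity and the overlap
  let fN := Fintype.linearCombination (infRing D R) K.n
  have hfN : Function.Surjective fN := fun y => by
    have := K.smul_mem y
    rw [one_smul] at this
    exact (Submodule.mem_span_range_iff_exists_fun _).mp this
  -- As many generators as the rank of a projective module form a basis.
  let v := LinearEquiv.ofBijective fN ⟨injective_of_surjective_of_rankAtStalk hr fN hfN, hfN⟩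
  let fL := Fintype.linearCombination (overlapRing D R) fun a => E.σ (K.n a)
  have hσ : ∀ b, fL (fun a => infToOverlap D R (b a)) = E.σ (fN b) := fun b => by
    simp only [fL, fN, Fintype.linearCombination_apply, map_sum, map_smulₛₗ]
  have hfL : Function.Surjective fL := by
    rw [← LinearMap.range_eq_top, eq_top_iff, ← E.isBaseChangeAlong_σ.span_range,
      Submodule.span_le]
    rintro _ ⟨y, rfl⟩
    obtain ⟨b, rfl⟩ := hfN y
    exact ⟨_, hσ b⟩
  let w := LinearEquiv.ofBijective fL ⟨injective_of_surjective_of_rankAtStalk hrL fL hfL, hfL⟩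
  have hfL' : Function.Injective fL := w.injective
  -- sections over the affine chart as vectors of polynomials
  have hpoly : ∀ t : Fin r → R[X], fL (polyVec D R r t) = ∑ a, t a • E.σ (K.n a) := fun t => by
    simp only [fL, Fintype.linearCombination_apply, polyVec_apply, algebraMap_smul]
  have hpoly_smul : ∀ (f : R[X]) t, fL (polyVec D R r (f • t)) = f • fL (polyVec D R r t) :=
    fun f t => by
      rw [hpoly, hpoly, Finset.smul_sum]
      exact Finset.sum_congr rfl fun a _ => mul_smul _ _ _
  have hmem : ∀ t, fL (polyVec D R r t) ∈ E.polySpan := fun t => by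
    rw [hpoly]
    exact sum_mem fun a _ => Submodule.smul_mem _ _ (K.σ_mem a)
  have hex : ∀ m, ∃ t, fL (polyVec D R r t) = E.ρ m := fun m => by
    have := K.smul_ρ_mem m
    rw [one_smul] at this
    obtain ⟨t, ht⟩ := (Submodule.mem_span_range_iff_exists_fun _).mp this
    exact ⟨t, (hpoly t).trans ht⟩
  choose s hs using hex
  have huniq : ∀ t m, fL (polyVec D R r t) = E.ρ m → t = s m := fun t m h =>
    polyVec_injective (hfL' (h.trans (hs m).symm))
  have hadd : ∀ m m', s (m + m') = s m + s m' := fun m m' => by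
    refine (huniq _ _ ?_).symm
    rw [map_add, map_add, hs, hs, map_add]
  have hsmul : ∀ (a : affRing D R) m, s (a • m) = a.1 • s m := fun a m => by
    refine (huniq _ _ ?_).symm
    rw [hpoly_smul, hs, E.ρ_smul]
  -- Its columns are the sections `K.m b` in polynomial coordinates. They generate the affine
  -- sections modulo Q over R, so it plays the part of the matrix S.
  let S₀ : Matrix (Fin r) (Fin r) R[X] := Matrix.of fun a b => s (K.m b) a
  let f : E.M →ₗ[affRing D R] (Fin r → R[X]) := { toFun := s, map_add' := hadd, map_smul' := hsmul }
  have hS₀ : ∀ c : Fin r → R, S₀.mulVec (fun b => C (c b)) = s (∑ b, c b • K.m b) := fun c => by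
    have h1 : ∀ b, s (c b • K.m b) = C (c b) • s (K.m b) := fun b => by
      rw [smul_eq_of_tower (A := affRing D R), hsmul]
      rfl
    have h2 : s (∑ b, c b • K.m b) = ∑ b, s (c b • K.m b) := map_sum f _ _
    rw [h2]
    refine funext fun a => ?_
    rw [Finset.sum_apply]
    change ∑ b, s (K.m b) a * C (c b) = _
    refine Finset.sum_congr rfl fun b _ => ?_
    rw [h1]
    exact mul_comm _ _
  have hrange : ∀ t : Fin r → R[X], (∃ m, s m = t) ↔
      ∃ (c : Fin r → R) (t' : Fin r → R[X]),
        t = S₀.mulVec (fun b => C (c b)) + fatPoly D R • t' := by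
    have hfat : ∀ t', ∃ m, s m = fatPoly D R • t' := fun t' => by
      obtain ⟨m, hm⟩ := E.fatPoly_smul_mem_range_ρ (hmem t')
      exact ⟨m, (huniq _ _ (by rw [hpoly_smul, hm])).symm⟩
    intro t
    constructor
    · rintro ⟨m, rfl⟩
      have := K.smul_mem_sup m
      rw [one_smul] at this
      obtain ⟨p, hp, q, hq, rfl⟩ := Submodule.mem_sup.mp this
      obtain ⟨c, rfl⟩ := (Submodule.mem_span_range_iff_exists_fun _).mp hp
      have hq' : q ∈ fatIdeal D R • (⊤ : Submodule (affRing D R) E.M) := hq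
      have : ∃ t', s q = fatPoly D R • t' := by
        refine Submodule.smul_induction_on hq' ?_ ?_
        · rintro j ⟨g, hg⟩ b -
          exact ⟨g • s b, by rw [hsmul, hg, mul_smul]⟩
        · rintro x y ⟨t₁, h₁⟩ ⟨t₂, h₂⟩
          exact ⟨t₁ + t₂, by rw [hadd, h₁, h₂, smul_add]⟩
      obtain ⟨t', ht'⟩ := this
      exact ⟨c, t', by rw [hS₀, hadd, ht']⟩
    · rintro ⟨c, t', rfl⟩
      obtain ⟨m, hm⟩ := hfat t'
      exact ⟨∑ b, c b • K.m b + m, by rw [hadd, hS₀, hm]⟩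
  -- The affine sections generate R[z]^r over R[z], and evaluation of R[z]^r at P_i is onto R^r. The
  -- values of affine sections at P_i are combinations of the columns of S₀(P_i), so this matrix is
  -- onto, hence invertible.
  have hunit : ∀ i, IsUnit (S₀.map (jet D R i 0)) := fun i => by
    rw [← Matrix.mulVec_surjective_iff_isUnit]
    have key : ∀ l ∈ E.polySpan, ∃ t, fL (polyVec D R r t) = l ∧
        vjet D i 0 t ∈ LinearMap.range (S₀.map (jet D R i 0)).mulVecLin := by
      intro l hl
      induction hl using Submodule.span_induction with
      | mem x hx =>
        obtain ⟨m, rfl⟩ := hx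
        obtain ⟨c, t', h⟩ := (hrange _).mp ⟨m, rfl⟩
        refine ⟨s m, hs m, c, ?_⟩
        have h0 : vjet D i 0 (fatPoly D R • t') = 0 :=
          (vjet_eq_zero_iff _).mpr ⟨t', rfl⟩ i 0 (D.n_pos i)
        rw [h, vjet_add, h0, add_zero, vjet_mulVec_C]
        rfl
      | zero =>
        refine ⟨0, by rw [map_zero, map_zero], 0, ?_⟩
        rw [map_zero]
        exact funext fun a => by simp [vjet, jet]
      | add x y _ _ hx hy =>
        obtain ⟨t, rfl, ht⟩ := hx
        obtain ⟨t', rfl, ht'⟩ := hy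
        exact ⟨t + t', by rw [map_add, map_add], by rw [vjet_add]; exact add_mem ht ht'⟩
      | smul g x _ hx =>
        obtain ⟨t, rfl, ht⟩ := hx
        refine ⟨g • t, hpoly_smul g t, ?_⟩
        have : vjet D i 0 (g • t) = jet D R i 0 g • vjet D i 0 t := funext fun a => by
          simp [vjet, jet]
        rw [this]
        exact Submodule.smul_mem _ _ ht
    intro c
    obtain ⟨t, ht, c', hc'⟩ := key _ (hmem fun a => C (c a))
    obtain rfl := polyVec_injective (hfL' ht)
    refine ⟨c', hc'.trans (funext fun a => ?_)⟩
    simp [vjet, jet]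
  obtain ⟨Λ, hΛ⟩ := exists_tuple_of_jets S₀ hunit
  have hsΛ : ∀ m, f m ∈ Λ.module := fun m => (hΛ _).mpr ((hrange _).mp ⟨m, rfl⟩)
  let u : E.M ≃ₗ[affRing D R] Λ.module := LinearEquiv.ofBijective (f.codRestrict _ hsΛ) (by
    constructor
    · intro m m' h
      have h' : s m = s m' := congrArg Subtype.val h
      exact hρinj (by rw [← hs, h', hs])
    · rintro ⟨t, ht⟩
      obtain ⟨m, hm⟩ := (hrange _).mpr ((hΛ _).mp ht)
      exact ⟨m, Subtype.ext hm⟩)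
  refine ⟨Λ, u, v.symm, w.symm, fun m => ?_, fun y => ?_⟩
  · exact w.eq_symm_apply.mpr (hs m)
  · refine w.eq_symm_apply.mpr ?_
    obtain ⟨b, rfl⟩ := v.surjective y
    have h : v.symm (v b) = b := v.symm_apply_apply b
    exact (congrArg (fun b : Fin r → infRing D R => fL fun a => infToOverlap D R (b a)) h).trans
      (hσ b)

end LocalFrames

/-! ### Nakayama's lemma and elimination -/

section Nakayama

/-- Nakayama's lemma for a quotient that need not be presented as a finite module. -/
theorem exists_sub_one_mem_and_smul_mem_of_fg {R M : Type} [CommRing R] [AddCommGroup M]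
    [Module R M] {I : Ideal R} {P U : Submodule R M} (hU : U.FG) (h : P ⊔ U = ⊤)
    (hI : ⊤ ≤ P ⊔ I • (⊤ : Submodule R M)) : ∃ x : R, x - 1 ∈ I ∧ ∀ m : M, x • m ∈ P := by
  obtain ⟨x, hx, hP⟩ := Submodule.exists_sub_one_mem_and_smul_le_of_fg_of_le_sup (I := I)
    (N := P) (P := ⊤) hU le_top (by
      refine hI.trans ?_
      rw [← h, Submodule.smul_sup, ← sup_assoc]
      exact sup_le_sup_right (sup_le le_rfl Submodule.smul_le_right) _)
  exact ⟨x, hx, fun m => hP (Submodule.smul_mem_pointwise_smul m x ⊤ trivial)⟩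

theorem IsBaseChangeAlong.mem_base_smul_of_eq_zero {R A A' M M' : Type} [CommRing R] [CommRing A]
    [CommRing A'] [Algebra R A] [AddCommGroup M] [AddCommGroup M'] [Module A M] [Module A' M']
    [Module R M] [IsScalarTower R A M] {θ : A →+* A'} {u : M →ₛₗ[θ] M'}
    (h : IsBaseChangeAlong θ u) (hθ : Function.Surjective θ) {I : Ideal R}
    (hI : RingHom.ker θ ≤ I.map (algebraMap R A)) {m : M} (hm : u m = 0) :
    m ∈ I • (⊤ : Submodule R M) := by
  have h1 : m ∈ I.map (algebraMap R A) • (⊤ : Submodule A M) :=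
    Submodule.smul_mono_left hI (h.mem_smul_of_eq_zero hθ hm)
  have h2 : m ∈ (I.map (algebraMap R A) • (⊤ : Submodule A M)).restrictScalars R := h1
  rwa [Ideal.smul_restrictScalars] at h2

/-- A resultant produces a constant in an ideal of polynomials. -/
theorem exists_mul_add_mul_eq_C {R : Type} [CommRing R] (φ : R →+* ℂ) {h f : R[X]} {n : ℕ}
    (hh : h.map φ = 1) (hf : f.natDegree ≤ n) (hn : φ (f.coeff n) = 1) :
    ∃ (p q : R[X]) (x : R), φ x ≠ 0 ∧ p * h + q * f = C x := by
  -- Formal degrees make the resultant commute with φ, and the added 1 keeps one of them nonzero. In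
  -- the fibre it becomes the resultant of 1 with a polynomial whose coefficient in degree n is 1,
  -- which is not zero.
  obtain ⟨p, q, -, -, hpq⟩ := exists_mul_add_mul_eq_C_resultant (m := h.natDegree + 1) (n := n) h f
    (Nat.le_succ _) hf (Or.inl (Nat.succ_ne_zero _))
  refine ⟨p, q, _, ?_, by rw [← hpq]; ring⟩
  rw [← resultant_map_map, hh, ← C_1, resultant_C_left, coeff_map, hn]
  simp

end Nakayama

/-! ### The polynomial lattice of a bundle -/

section PolySpan

theorem LinearMap.pi_apply_eq_sum_single {A M : Type} [CommRing A] [AddCommGroup M] [Module A M]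
    {n : ℕ} (p : (Fin n → A) →ₗ[A] M) (x : Fin n → A) :
    p x = ∑ b, x b • p (Pi.single b 1) := by
  rw [p.pi_apply_eq_sum_univ x]
  refine Finset.sum_congr rfl fun b _ => ?_
  congr 2
  ext j
  simp [Pi.single_apply, eq_comm]

variable {D : Divisor} {R : Type} [CommRing R] [Algebra ℂ R]

theorem QCoh.polySpan_eq_span (E : QCoh D R) {s : Set E.M} (hs : Submodule.span (affRing D R) s = ⊤) :
    E.polySpan = Submodule.span R[X] (E.ρ '' s) := by
  apply le_antisymm
  · rw [polySpan, Submodule.span_le]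
    rintro _ ⟨y, rfl⟩
    have hy : y ∈ Submodule.span (affRing D R) s := hs ▸ Submodule.mem_top
    induction hy using Submodule.span_induction with
    | mem x hx => exact Submodule.subset_span ⟨x, hx, rfl⟩
    | zero => rw [map_zero]; exact zero_mem _
    | add x y _ _ hx hy => rw [map_add]; exact add_mem hx hy
    | smul a x _ hx => rw [ρ_smul]; exact Submodule.smul_mem _ _ hx
  · exact Submodule.span_mono (Set.image_subset_range _ _)

theorem QCoh.polySpan_fg (E : QCoh D R) [Module.Finite (affRing D R) E.M] : E.polySpan.FG := by
  obtain ⟨s, hs⟩ := Module.Finite.fg_top (R := affRing D R) (M := E.M)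
  rw [E.polySpan_eq_span hs]
  exact Submodule.fg_span (s.finite_toSet.image _)

/-- A bundle is locally a direct summand of a trivial bundle. -/
theorem QCoh.exists_retract (E : QCoh D R) [Module.Finite (affRing D R) E.M]
    [Module.Projective (affRing D R) E.M] :
    ∃ (n : ℕ) (i : E.L →ₗ[overlapRing D R] (Fin n → overlapRing D R))
      (p : (Fin n → overlapRing D R) →ₗ[overlapRing D R] E.L), (∀ l, p (i l) = l) ∧
      (∀ l ∈ E.polySpan, ∃ t : Fin n → R[X], i l = polyVec D R n t) ∧
      (∀ t, p (polyVec D R n t) = ∑ b, t b • p (Pi.single b 1)) ∧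
      ∀ b, p (Pi.single b 1) ∈ E.polySpan := by
  obtain ⟨n, f, hf⟩ := Module.Finite.exists_fin' (affRing D R) E.M
  obtain ⟨g, hg⟩ := Module.projective_lifting_property f LinearMap.id hf
  -- Both the splitting and the projection are extended from the affine chart. This is why they
  -- respect polynomial vectors, and not only the modules over the overlap.
  obtain ⟨i, hi⟩ := E.isBaseChangeAlong_ρ.exists_lift
    ({ toFun := fun m b => affToOverlap D R (g m b)
       map_add' := fun x y => funext fun b => by rw [map_add, Pi.add_apply, map_add]; rfl
       map_smul' := fun a x => funext fun b => by
        rw [map_smul, Pi.smul_apply, smul_eq_mul, map_mul]; rfl } :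
      E.M →ₛₗ[affToOverlap D R] (Fin n → overlapRing D R))
  let p := Fintype.linearCombination (overlapRing D R) fun b => E.ρ (f (Pi.single b 1))
  have hp : ∀ b, p (Pi.single b 1) = E.ρ (f (Pi.single b 1)) := fun b => by
    simp only [p, Fintype.linearCombination_apply_single, one_smul]
  have hpi : ∀ m, p (i (E.ρ m)) = E.ρ m := fun m => by
    have h1 : f (g m) = m := LinearMap.congr_fun hg m
    have h2 : i (E.ρ m) = fun b => affToOverlap D R (g m b) := hi m
    conv_rhs => rw [← h1, LinearMap.pi_apply_eq_sum_single f (g m), map_sum]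
    rw [h2]
    simp only [p, Fintype.linearCombination_apply, map_smulₛₗ]
  refine ⟨n, i, p, fun l => E.isBaseChangeAlong_ρ.ext (g := p ∘ₗ i) (g' := LinearMap.id) hpi l,
    fun l hl => ?_, fun t => ?_, fun b => ?_⟩
  · induction hl using Submodule.span_induction with
    | mem x hx =>
      obtain ⟨m, rfl⟩ := hx
      exact ⟨fun b => (g m b).1, hi m⟩
    | zero => exact ⟨0, by rw [map_zero, map_zero]⟩
    | add x y _ _ hx hy =>
      obtain ⟨t, ht⟩ := hx
      obtain ⟨t', ht'⟩ := hy
      exact ⟨t + t', by rw [map_add, map_add, ht, ht']⟩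
    | smul c x _ hx =>
      obtain ⟨t, ht⟩ := hx
      refine ⟨c • t, ?_⟩
      rw [← algebraMap_smul (overlapRing D R) c x, map_smul, ht, map_smul, algebraMap_smul]
  · rw [LinearMap.pi_apply_eq_sum_single p]
    exact Finset.sum_congr rfl fun b _ => by rw [polyVec_apply, algebraMap_smul]
  · rw [hp]
    exact Submodule.subset_span ⟨_, rfl⟩

end PolySpan

/-! ### Lifting sections from a fibre M_Λ -/

section FibreLift

variable {D : Divisor} {R : Type} [CommRing R] [Algebra ℂ R] {r : ℕ} {φ : R →ₐ[ℂ] ℂ}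
  {E : QCoh D R} {Λ : Tuple D r ℂ} {u : E.M →ₛₗ[affMap D φ] Λ.bundle.M}
  {v : E.N →ₛₗ[infMap D φ] Λ.bundle.N} {w : E.L →ₛₗ[overlapMap D φ] Λ.bundle.L}

/-- Vectors of polynomials as sections of `M_Λ` over the overlap. -/
def Tuple.ofPoly (Λ : Tuple D r R) : (Fin r → R[X]) →ₗ[R[X]] Λ.bundle.L where
  toFun t := polyVec D R r t
  map_add' := map_add (polyVec D R r)
  map_smul' f t := _root_.funext fun a => map_mul (algebraMap R[X] (overlapRing D R)) f (t a)

/-- The basis sections of `M_Λ` over the chart at infinity. -/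
def Tuple.single (Λ : Tuple D r R) (a : Fin r) : Λ.bundle.N :=
  (Pi.single a 1 : Fin r → infRing D R)

theorem Tuple.σ_single (Λ : Tuple D r R) (a : Fin r) :
    Λ.bundle.σ (Λ.single a) = Λ.ofPoly (Pi.single a 1) := by
  refine funext fun b => ?_
  change infToOverlap D R ((Pi.single a 1 : Fin r → infRing D R) b) =
    algebraMap R[X] (overlapRing D R) ((Pi.single a 1 : Fin r → R[X]) b)
  obtain rfl | hb := eq_or_ne b a
  · rw [Pi.single_eq_same, Pi.single_eq_same, map_one, map_one]
  · rw [Pi.single_eq_of_ne hb, Pi.single_eq_of_ne hb, map_zero, map_zero]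

theorem overlap_map_base_smul {S : Type} [CommRing S] [Algebra ℂ S] {ψ : R →ₐ[ℂ] S}
    {F : QCoh D S} (w : E.L →ₛₗ[overlapMap D ψ] F.L) (c : R) (l : E.L) :
    w (c • l) = ψ c • w l :=
  semilinear_map_base_smul w (overlapMap_algebraMap_base D ψ c) l

/-- Vectors of polynomials lift from a fibre of the form `M_Λ`. -/
theorem exists_polySpan_eq_polyVec (h1 : ∀ m, Λ.bundle.ρ (u m) = w (E.ρ m))
    (hu : Function.Surjective u) (t : Fin r → ℂ[X]) :
    ∃ l ∈ E.polySpan, w l = Λ.ofPoly t := by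
  have ht := Λ.span_module t
  induction ht using Submodule.span_induction with
  | mem s hs =>
    obtain ⟨m, hm⟩ := hu ⟨s, hs⟩
    exact ⟨E.ρ m, Submodule.subset_span ⟨m, rfl⟩, by rw [← h1, hm]; rfl⟩
  | zero => exact ⟨0, zero_mem _, by rw [map_zero, map_zero]⟩
  | add s s' _ _ hs hs' =>
    obtain ⟨l, hl, h⟩ := hs
    obtain ⟨l', hl', h'⟩ := hs'
    exact ⟨l + l', add_mem hl hl', by rw [map_add, h, h', map_add]⟩
  | smul f s _ hs =>
    obtain ⟨l, hl, h⟩ := hs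
    obtain ⟨g, rfl⟩ := exists_map_eq φ f
    exact ⟨g • l, Submodule.smul_mem _ _ hl, by
      rw [semilinear_map_poly_smul, h, map_smul]⟩

theorem exists_polyVec_eq (h1 : ∀ m, Λ.bundle.ρ (u m) = w (E.ρ m)) {l : E.L}
    (hl : l ∈ E.polySpan) : ∃ t, w l = Λ.ofPoly t := by
  induction hl using Submodule.span_induction with
  | mem x hx =>
    obtain ⟨m, rfl⟩ := hx
    exact ⟨(u m).1, (h1 m).symm⟩
  | zero => exact ⟨0, by rw [map_zero, map_zero]⟩
  | add x y _ _ hx hy =>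
    obtain ⟨t, ht⟩ := hx
    obtain ⟨t', ht'⟩ := hy
    exact ⟨t + t', by rw [map_add, map_add, ht, ht']⟩
  | smul c x _ hx =>
    obtain ⟨t, ht⟩ := hx
    exact ⟨c.map φ.toRingHom • t, by rw [semilinear_map_poly_smul, ht, map_smul]⟩

theorem map_eq_zero_of_mem_ker_smul {l : E.L} (hl : l ∈ RingHom.ker φ • (⊤ : Submodule R E.L)) :
    w l = 0 := by
  refine Submodule.smul_induction_on hl (fun c hc l _ => ?_) fun x y hx hy => ?_
  · rw [overlap_map_base_smul, RingHom.mem_ker.mp hc, zero_smul]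
  · rw [map_add, hx, hy, add_zero]

/-- The first cohomology of the sheaf on the projective line defined by `E` vanishes near a fibre
of the form `M_Λ`. -/
theorem exists_smul_mem_polySpan_sup [Module.Finite (affRing D R) E.M]
    (h1 : ∀ m, Λ.bundle.ρ (u m) = w (E.ρ m)) (h2 : ∀ m, Λ.bundle.σ (v m) = w (E.σ m))
    (hu : Function.Surjective u) (hv : Function.Surjective v)
    (hw : IsBaseChangeAlong (overlapMap D φ) w) :
    ∃ x : R, φ x = 1 ∧ ∀ l, x • l ∈ E.polySpan.restrictScalars R ⊔ LinearMap.range E.σlin := by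
  obtain ⟨U, hU, hUtop⟩ := E.exists_fg_sup_range_cech
  obtain ⟨x, hx, h⟩ := exists_sub_one_mem_and_smul_mem_of_fg (I := RingHom.ker φ)
    (P := E.polySpan.restrictScalars R ⊔ LinearMap.range E.σlin) hU (by
      rw [eq_top_iff, ← hUtop, E.range_cech]
      refine sup_le_sup_right (sup_le_sup_right ?_ _) _
      rintro _ ⟨m, rfl⟩
      rw [E.ρlin_apply]
      exact Submodule.subset_span ⟨m, rfl⟩) (by
      intro l _
      -- In the fibre the first cohomology of the trivial bundle vanishes, and both parts of the
      -- decomposition of w l lift. The error lies in the kernel of w, that is in (ker φ) L, as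
      -- Nakayama requires.
      choose g k₁ k₂ b _ _ h using fun a => exists_overlap_decomposition D 0
        ((w l : Fin r → overlapRing D ℂ) a)
      obtain ⟨l', hl', h3⟩ := exists_polySpan_eq_polyVec h1 hu
        (fun a => fatPoly D ℂ * g a + k₁ a + k₂ a)
      obtain ⟨n, hn⟩ := hv b
      have h4 : w (l' + E.σ n) = w l := by
        rw [map_add, h3, ← h2, hn]
        refine funext fun a => ?_
        refine Eq.trans ?_ (h a).symm
        change algebraMap ℂ[X] (overlapRing D ℂ) (fatPoly D ℂ * g a + k₁ a + k₂ a) + (b a).1 = _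
        rw [map_add, map_add, pow_zero, one_mul, one_mul]
        ring
      have h5 : l - (l' + E.σ n) ∈ RingHom.ker φ • (⊤ : Submodule R E.L) :=
        hw.mem_base_smul_of_eq_zero (overlapMap_surjective D φ) (ker_overlapMap_le D φ)
          (by rw [map_sub, h4, sub_self])
      rw [← add_sub_cancel (l' + E.σ n) l]
      refine add_mem (Submodule.mem_sup_left (add_mem (Submodule.mem_sup_left hl')
        (Submodule.mem_sup_right ⟨n, E.σlin_apply n⟩))) (Submodule.mem_sup_right h5))
  rw [RingHom.mem_ker, map_sub, map_one, sub_eq_zero] at hx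
  exact ⟨x, hx, h⟩

/-- The constant sections of a fibre of the form `M_Λ` lift. -/
theorem exists_lift_single [Module.Finite (affRing D R) E.M]
    (h1 : ∀ m, Λ.bundle.ρ (u m) = w (E.ρ m)) (h2 : ∀ m, Λ.bundle.σ (v m) = w (E.σ m))
    (hu : Function.Surjective u) (hv : Function.Surjective v)
    (hw : IsBaseChangeAlong (overlapMap D φ) w) (a : Fin r) :
    ∃ n, E.σ n ∈ E.polySpan ∧ v n = Λ.single a := by
  obtain ⟨x, hx, hP⟩ := exists_smul_mem_polySpan_sup h1 h2 hu hv hw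
  obtain ⟨l, hl, hle⟩ := exists_polySpan_eq_polyVec h1 hu (Pi.single a 1)
  obtain ⟨n, hn⟩ := hv (Λ.single a)
  have hz : l - E.σ n ∈ RingHom.ker φ • (⊤ : Submodule R E.L) :=
    hw.mem_base_smul_of_eq_zero (overlapMap_surjective D φ) (ker_overlapMap_le D φ)
      (by rw [map_sub, hle, ← h2, hn, Λ.σ_single, sub_self])
  -- The lifts of the basis vector from the two charts differ by an element of (ker φ) L. After
  -- multiplication by x this is the sum of a correction to each lift, with coefficients in ker φ.
  -- The corrections are invisible in the fibre, and x is 1 there.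
  have hxz : x • (l - E.σ n) ∈ RingHom.ker φ •
      (E.polySpan.restrictScalars R ⊔ LinearMap.range E.σlin) := by
    refine Submodule.smul_induction_on hz (fun c hc l _ => ?_) fun y z hy hz => ?_
    · rw [smul_comm]
      exact Submodule.smul_mem_smul hc (hP l)
    · rw [smul_add]
      exact add_mem hy hz
  rw [Submodule.smul_sup] at hxz
  obtain ⟨p, hp, q, hq, hpq⟩ := Submodule.mem_sup.mp hxz
  obtain ⟨n', hn'⟩ := Submodule.smul_le_right hq
  rw [E.σlin_apply] at hn'
  have hσ : E.σ (x • n + n') = x • l - p := by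
    rw [map_add, semilinear_map_base_smul E.σ (θ := infToOverlap D R) (d := x) rfl, hn',
      eq_sub_iff_add_eq, add_assoc, add_comm q, hpq, smul_sub, add_sub_cancel]
  have hp' : w p = 0 := map_eq_zero_of_mem_ker_smul (Submodule.smul_mono le_rfl le_top hp)
  have key : Λ.bundle.σ (v (x • n + n')) = Λ.ofPoly (Pi.single a 1) := by
    rw [h2, hσ, map_sub, hp', sub_zero, overlap_map_base_smul, hx, one_smul, hle]
  refine ⟨x • n + n', ?_, Λ.σ_injective (key.trans (Λ.σ_single a).symm)⟩
  have hp2 : p ∈ E.polySpan.restrictScalars R :=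
    (Submodule.smul_le_right : RingHom.ker φ • E.polySpan.restrictScalars R ≤ _) hp
  rw [hσ]
  exact (E.polySpan.restrictScalars R).sub_mem
    ((E.polySpan.restrictScalars R).smul_mem x hl) hp2

/-- Polynomial sections vanishing in a fibre have coefficients vanishing there. -/
theorem mem_ker_smul_polySpan [Module.Finite (affRing D R) E.M]
    [Module.Projective (affRing D R) E.M] (hw : IsBaseChangeAlong (overlapMap D φ) w) {l : E.L}
    (hl : l ∈ E.polySpan) (hl0 : w l = 0) :
    l ∈ RingHom.ker (mapRingHom φ.toRingHom) • E.polySpan := by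
  obtain ⟨n, i, p, hpi, hi, hp, hp'⟩ := E.exists_retract
  -- Vanishing of w l by itself only gives coefficients in L, with powers of 1/q allowed. In the
  -- coordinates of the retract, l is a polynomial vector, so its coordinates are polynomials
  -- vanishing in the fibre.
  obtain ⟨t, ht⟩ := hi l hl
  have h1 : ∀ b, overlapMap D φ (i l b) = 0 := by
    refine Submodule.smul_induction_on (hw.mem_smul_of_eq_zero (overlapMap_surjective D φ) hl0)
      (fun c hc l _ b => ?_) fun x y hx hy b => ?_
    · rw [map_smul, Pi.smul_apply, smul_eq_mul, map_mul, RingHom.mem_ker.mp hc, zero_mul]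
    · rw [map_add, Pi.add_apply, map_add, hx, hy, add_zero]
  rw [← hpi l, ht, hp]
  refine sum_mem fun b _ => Submodule.smul_mem_smul ?_ (hp' b)
  have h2 := h1 b
  rw [ht, polyVec_apply, overlapMap_algebraMap] at h2
  exact algebraMap_overlapRing_injective D (h2.trans (map_zero _).symm)

end FibreLift

/-! ### Existence of frames near a fibre M_Λ -/

section LocalFrameExistence

variable {D : Divisor} {R : Type} [CommRing R] [Algebra ℂ R] {r : ℕ} {φ : R →ₐ[ℂ] ℂ}
  {E : QCoh D R} {Λ : Tuple D r ℂ} {u : E.M →ₛₗ[affMap D φ] Λ.bundle.M}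
  {v : E.N →ₛₗ[infMap D φ] Λ.bundle.N} {w : E.L →ₛₗ[overlapMap D φ] Λ.bundle.L}

theorem Tuple.sum_smul_single (Λ : Tuple D r R) (b : Fin r → infRing D R) :
    ∑ a, b a • Λ.single a = (b : Λ.bundle.N) :=
  (LinearMap.pi_apply_eq_sum_single LinearMap.id b).symm

theorem Tuple.sum_smul_ofPoly_single (Λ : Tuple D r R) (t : Fin r → R[X]) :
    ∑ a, t a • Λ.ofPoly (Pi.single a 1) = Λ.ofPoly t :=
  (LinearMap.pi_apply_eq_sum_single Λ.ofPoly t).symm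

/-- Nakayama over R[z], for the ideal of polynomials vanishing in the fibre. The multiplier is a
polynomial, and its zeros may tend to infinity near the fibre, so this alone gives no neighbourhood
in the base. -/
theorem exists_map_eq_one_smul_ρ_mem [Module.Finite (affRing D R) E.M]
    [Module.Projective (affRing D R) E.M] (h1 : ∀ m, Λ.bundle.ρ (u m) = w (E.ρ m))
    (h2 : ∀ m, Λ.bundle.σ (v m) = w (E.σ m)) (hw : IsBaseChangeAlong (overlapMap D φ) w)
    {n : Fin r → E.N} (hσ : ∀ a, E.σ (n a) ∈ E.polySpan) (hn : ∀ a, v (n a) = Λ.single a) :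
    ∃ h : R[X], h.map φ.toRingHom = 1 ∧
      ∀ y, h • E.ρ y ∈ Submodule.span R[X] (Set.range fun a => E.σ (n a)) := by
  set W := Submodule.span R[X] (Set.range fun a => E.σ (n a))
  have hWle : W ≤ E.polySpan := by
    rw [Submodule.span_le]
    rintro _ ⟨a, rfl⟩
    exact hσ a
  have hwσ : ∀ a, w (E.σ (n a)) = Λ.ofPoly (Pi.single a 1) := fun a => by
    rw [← h2, hn, Λ.σ_single]
  obtain ⟨h, hh, hP⟩ := Submodule.exists_sub_one_mem_and_smul_le_of_fg_of_le_sup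
    (I := RingHom.ker (mapRingHom φ.toRingHom)) (N := W) E.polySpan_fg le_rfl (by
      intro l hl
      obtain ⟨t, ht⟩ := exists_polyVec_eq h1 hl
      choose g hg using fun a => exists_map_eq φ (t a)
      have h3 : ∑ a, g a • E.σ (n a) ∈ W :=
        sum_mem fun a _ => W.smul_mem _ (Submodule.subset_span ⟨a, rfl⟩)
      have h4 : w (∑ a, g a • E.σ (n a)) = w l := by
        rw [map_sum, ht, ← Λ.sum_smul_ofPoly_single]
        refine Finset.sum_congr rfl fun a _ => ?_
        rw [semilinear_map_poly_smul, hg, hwσ]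
      have h5 := mem_ker_smul_polySpan hw (E.polySpan.sub_mem hl (hWle h3))
        (by rw [map_sub, h4, sub_self])
      rw [← add_sub_cancel (∑ a, g a • E.σ (n a)) l]
      exact Submodule.add_mem_sup h3 h5)
  refine ⟨h, ?_, fun y => hP (Submodule.smul_mem_pointwise_smul _ h _
    (Submodule.subset_span ⟨y, rfl⟩))⟩
  rw [RingHom.mem_ker, map_sub, map_one, sub_eq_zero] at hh
  exact hh

/-- The same use of Nakayama on the chart at infinity; it controls what the polynomial multiplier
cannot. -/
theorem exists_infMap_eq_one_smul_mem [Module.Finite (infRing D R) E.N]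
    (hv : IsBaseChangeAlong (infMap D φ) v) {n : Fin r → E.N} (hn : ∀ a, v (n a) = Λ.single a) :
    ∃ h : infRing D R, infMap D φ h = 1 ∧
      ∀ y, h • y ∈ Submodule.span (infRing D R) (Set.range n) := by
  set W := Submodule.span (infRing D R) (Set.range n)
  obtain ⟨h, hh, hP⟩ := Submodule.exists_sub_one_mem_and_smul_le_of_fg_of_le_sup
    (I := RingHom.ker (infMap D φ)) (N := W) (N' := ⊤) (P := ⊤) Module.Finite.fg_top le_rfl (by
      intro y _
      choose c hc using fun a => infMap_surjective D φ ((v y : Fin r → infRing D ℂ) a)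
      have h3 : ∑ a, c a • n a ∈ W :=
        sum_mem fun a _ => W.smul_mem _ (Submodule.subset_span ⟨a, rfl⟩)
      have h4 : v (∑ a, c a • n a) = v y := by
        rw [map_sum]
        refine Eq.trans ?_ (Λ.sum_smul_single (v y))
        refine Finset.sum_congr rfl fun a _ => ?_
        rw [map_smulₛₗ, hc, hn]
      have h5 := hv.mem_smul_of_eq_zero (infMap_surjective D φ)
        (m := y - ∑ a, c a • n a) (by rw [map_sub, h4, sub_self])
      rw [← add_sub_cancel (∑ a, c a • n a) y]
      exact Submodule.add_mem_sup h3 h5)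
  refine ⟨h, ?_, fun y => hP (Submodule.smul_mem_pointwise_smul _ h _ trivial)⟩
  rw [RingHom.mem_ker, map_sub, map_one, sub_eq_zero] at hh
  exact hh

/-- A function on the chart at infinity which is `1` in the fibre, as a fraction. -/
theorem exists_eq_nodeInv_pow_mul_of_infMap_eq_one {h : infRing D R} (hh : infMap D φ h = 1) :
    ∃ (n : ℕ) (f : R[X]), 1 ≤ n ∧ f.natDegree ≤ n * (D.k + 1) ∧
      f.map φ.toRingHom = nodePoly D ℂ ^ n ∧
      h.1 = nodeInv D R ^ n * algebraMap R[X] (overlapRing D R) f := by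
  obtain ⟨n, f, hf, hx⟩ := (mem_infRing_iff D h.1).mp h.2
  -- The extra factor q in numerator and denominator makes the exponent positive, as
  -- `exists_mul_add_mul_nodeInv_pow` requires.
  refine ⟨n + 1, f * nodePoly D R, Nat.le_add_left _ _, ?_, ?_, ?_⟩
  · have := natDegree_nodePoly_pow_le D R 1
    rw [pow_one, one_mul] at this
    rw [add_mul, one_mul]
    exact natDegree_mul_le.trans (Nat.add_le_add hf this)
  · have h1 : overlapMap D φ h.1 = 1 := congrArg Subtype.val hh
    rw [hx, map_mul, map_pow, overlapMap_nodeInv, overlapMap_algebraMap] at h1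
    have h2 : algebraMap ℂ[X] (overlapRing D ℂ) (f.map φ.toRingHom) =
        algebraMap ℂ[X] (overlapRing D ℂ) (nodePoly D ℂ ^ n) := by
      rw [map_pow]
      have h3 := algebraMap_nodePoly_pow_mul_nodeInv_pow D (R := ℂ) n
      linear_combination algebraMap ℂ[X] (overlapRing D ℂ) (nodePoly D ℂ) ^ n * h1 -
        algebraMap ℂ[X] (overlapRing D ℂ) (f.map φ.toRingHom) * h3
    rw [Polynomial.map_mul, nodePoly_map, algebraMap_overlapRing_injective D h2, pow_succ]
  · rw [hx, map_mul]
    have h3 := algebraMap_nodePoly_mul_nodeInv D (R := R)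
    linear_combination -(nodeInv D R ^ n * algebraMap R[X] (overlapRing D R) f) * h3

theorem map_coeff_eq_one {f : R[X]} {n : ℕ} (hf : f.map φ.toRingHom = nodePoly D ℂ ^ n) :
    φ (f.coeff (n * (D.k + 1))) = 1 := by
  have h1 : φ (f.coeff (n * (D.k + 1))) = (f.map φ.toRingHom).coeff (n * (D.k + 1)) :=
    (coeff_map φ.toRingHom _).symm
  have h2 : (nodePoly D ℂ ^ n).natDegree = n * (D.k + 1) := by
    rw [(monic_nodePoly D ℂ).natDegree_pow, natDegree_nodePoly]
  rw [h1, hf, ← h2]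
  exact ((monic_nodePoly D ℂ).pow n).coeff_natDegree

/-- The sections `σ (n a)` generate the polynomial sections near the given fibre. -/
theorem exists_smul_ρ_mem [Module.Finite (affRing D R) E.M]
    [Module.Projective (affRing D R) E.M] (h1 : ∀ m, Λ.bundle.ρ (u m) = w (E.ρ m))
    (h2 : ∀ m, Λ.bundle.σ (v m) = w (E.σ m)) (hw : IsBaseChangeAlong (overlapMap D φ) w)
    {n : Fin r → E.N} (hσ : ∀ a, E.σ (n a) ∈ E.polySpan) (hn : ∀ a, v (n a) = Λ.single a)
    {h : infRing D R} (hh : infMap D φ h = 1)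
    (hN : ∀ y, h • y ∈ Submodule.span (infRing D R) (Set.range n)) :
    ∃ x : R, φ x ≠ 0 ∧
      ∀ y, x • E.ρ y ∈ Submodule.span R[X] (Set.range fun a => E.σ (n a)) := by
  set W := Submodule.span R[X] (Set.range fun a => E.σ (n a)) with hW
  obtain ⟨K, m, hm⟩ := Module.Finite.exists_fin (R := affRing D R) (M := E.M)
  obtain ⟨k, f, -, hf, hfmap, hfh⟩ := exists_eq_nodeInv_pow_mul_of_infMap_eq_one hh
  obtain ⟨e, he⟩ := E.exists_nodeInv_pow_smul_mem fun j => E.ρ (m j)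
  choose y hy using fun j => he j 1
  choose b hb using fun j => (Submodule.mem_span_range_iff_exists_fun _).mp (hN (y j))
  obtain ⟨e', he'⟩ := exists_nodePoly_pow_mul_eq D fun i : Fin K × Fin r => (b i.1 i.2).1
  choose g hg using he'
  -- Transfer from infinity: a power of 1/q moves the affine generators to that chart, h moves them
  -- into the span there, and a power of q clears the denominators of the coefficients.
  have hF : ∀ j, (nodePoly D R ^ e' * f) • E.ρ (m j) ∈ W := fun j => by
    have h3 : (h.1 * nodeInv D R ^ e) • E.ρ (m j) = ∑ a, (b j a).1 • E.σ (n a) := by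
      have h4 := congrArg E.σ (hb j)
      rw [map_sum, map_smulₛₗ, hy, smul_smul] at h4
      simp only [map_smulₛₗ] at h4
      refine Eq.trans ?_ h4.symm
      change _ = (h.1 * (nodeInv D R ^ e * 1)) • E.ρ (m j)
      rw [mul_one]
    have h4 : (nodePoly D R ^ e' * f) • E.ρ (m j) =
        ∑ a, (nodePoly D R ^ (k + e) * g (j, a)) • E.σ (n a) := by
      rw [← algebraMap_smul (overlapRing D R) (nodePoly D R ^ e' * f) (E.ρ (m j))]
      have h5 : algebraMap R[X] (overlapRing D R) (nodePoly D R ^ e' * f) =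
          algebraMap R[X] (overlapRing D R) (nodePoly D R ^ (e' + (k + e))) *
            (h.1 * nodeInv D R ^ e) := by
        rw [hfh]
        simp only [map_mul, map_pow, pow_add]
        have h6 := algebraMap_nodePoly_pow_mul_nodeInv_pow D (R := R) k
        have h7 := algebraMap_nodePoly_pow_mul_nodeInv_pow D (R := R) e
        linear_combination -algebraMap R[X] (overlapRing D R) (nodePoly D R) ^ e' *
          algebraMap R[X] (overlapRing D R) f * (h7 +
          algebraMap R[X] (overlapRing D R) (nodePoly D R) ^ e * nodeInv D R ^ e * h6)
      rw [h5, mul_smul, h3, Finset.smul_sum]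
      refine Finset.sum_congr rfl fun a _ => ?_
      rw [smul_smul, add_comm e', pow_add, map_mul, mul_assoc, hg (j, a), ← map_mul,
        algebraMap_smul]
    rw [h4]
    exact sum_mem fun a _ => W.smul_mem _ (Submodule.subset_span ⟨a, rfl⟩)
  have hF' : ∀ l ∈ E.polySpan, (nodePoly D R ^ e' * f) • l ∈ W := fun l hl => by
    rw [E.polySpan_eq_span hm] at hl
    induction hl using Submodule.span_induction with
    | mem x hx =>
      obtain ⟨_, ⟨j, rfl⟩, rfl⟩ := hx
      exact hF j
    | zero => rw [smul_zero]; exact zero_mem _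
    | add x y _ _ hx hy => rw [smul_add]; exact add_mem hx hy
    | smul c x _ hx => rw [smul_comm]; exact W.smul_mem _ hx
  obtain ⟨h', hh', hW'⟩ := exists_map_eq_one_smul_ρ_mem h1 h2 hw hσ hn
  have hmap : (nodePoly D R ^ e' * f).map φ.toRingHom = nodePoly D ℂ ^ (e' + k) := by
    rw [Polynomial.map_mul, Polynomial.map_pow, nodePoly_map, hfmap, pow_add]
  have hdeg : (nodePoly D R ^ e' * f).natDegree ≤ (e' + k) * (D.k + 1) := by
    rw [add_mul]
    exact natDegree_mul_le.trans (Nat.add_le_add (natDegree_nodePoly_pow_le D R e') hf)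
  -- Two polynomials now move the lattice into W: one is 1 in the fibre, the other has top
  -- coefficient 1 there. Together they have no common zero on the projective line over φ, and
  -- elimination yields a scalar.
  obtain ⟨p, q, x, hx, hpq⟩ := exists_mul_add_mul_eq_C φ.toRingHom hh' hdeg
    (map_coeff_eq_one hmap)
  refine ⟨x, hx, fun y => ?_⟩
  have h3 : x • E.ρ y = (C x : R[X]) • E.ρ y := smul_eq_of_tower x _
  rw [h3, ← hpq, add_smul, mul_smul, mul_smul]
  exact add_mem (W.smul_mem _ (hW' y))
    (W.smul_mem _ (hF' _ (Submodule.subset_span ⟨y, rfl⟩)))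

/-- A function on the chart at infinity generates, together with a function vanishing only at
infinity, a power of its value at infinity. -/
theorem exists_mul_add_mul_nodeInv_pow {h : infRing D R} {n : ℕ} {f : R[X]} (hn : 1 ≤ n)
    (hf : f.natDegree ≤ n * (D.k + 1))
    (hh : h.1 = nodeInv D R ^ n * algebraMap R[X] (overlapRing D R) f) (e : ℕ) :
    ∃ (a b : infRing D R) (K : ℕ), algebraMap R (infRing D R) (f.coeff (n * (D.k + 1)) ^ K) =
      a * h + b * ⟨nodeInv D R, nodeInv_mem D⟩ ^ e := by
  set c := f.coeff (n * (D.k + 1))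
  set g := f - C c * nodePoly D R ^ n with hg
  obtain _ | _ := subsingleton_or_nontrivial R
  · have : Subsingleton (infRing D R) := Module.subsingleton R _
    exact ⟨0, 0, 0, Subsingleton.elim _ _⟩
  have hpos : 1 ≤ n * (D.k + 1) := Nat.mul_pos hn (Nat.succ_pos _)
  have hq : (nodePoly D R ^ n).natDegree = n * (D.k + 1) := by
    rw [(monic_nodePoly D R).natDegree_pow, natDegree_nodePoly]
  have hgdeg : g.natDegree ≤ n * (D.k + 1) - 1 := by
    refine natDegree_le_pred ((natDegree_sub_le_of_le hf
      ((natDegree_C_mul_le _ _).trans (natDegree_nodePoly_pow_le D R n))).trans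
      (max_self _).le) ?_
    rw [hg, coeff_sub, coeff_C_mul, ← hq, ((monic_nodePoly D R).pow n).coeff_natDegree, hq,
      mul_one, sub_self]
  -- The leading term cancels in g, so g / q^n vanishes at infinity to order at least one, while 1/q
  -- vanishes to order k + 1. This power of g / q^n is thus divisible by the e-th power of 1/q.
  set K := (D.k + 1) * e
  have hKe : e ≤ n * K := by
    calc e = 1 * (1 * e) := by ring
      _ ≤ n * ((D.k + 1) * e) := by gcongr; omega
  have hpow : (g ^ K).natDegree ≤ (n * K - e) * (D.k + 1) := by
    refine natDegree_pow_le.trans ((Nat.mul_le_mul_left K hgdeg).trans (le_of_eq ?_))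
    rw [Nat.mul_sub, Nat.sub_mul, mul_one]
    congr 1 <;> ring
  let b : infRing D R := ⟨_, nodeInv_pow_mul_mem D hpow⟩
  have hb : (algebraMap R (infRing D R) c - h) ^ K =
      (-1) ^ K * b * ⟨nodeInv D R, nodeInv_mem D⟩ ^ e := by
    have h1 : (h - algebraMap R (infRing D R) c) ^ K =
        b * ⟨nodeInv D R, nodeInv_mem D⟩ ^ e := by
      refine Subtype.ext ?_
      change (h.1 - algebraMap R (overlapRing D R) c) ^ K =
        nodeInv D R ^ (n * K - e) * algebraMap R[X] (overlapRing D R) (g ^ K) * nodeInv D R ^ e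
      have h2 : h.1 - algebraMap R (overlapRing D R) c =
          nodeInv D R ^ n * algebraMap R[X] (overlapRing D R) g := by
        have h3 := algebraMap_nodePoly_pow_mul_nodeInv_pow D (R := R) n
        rw [hh, hg, map_sub, map_mul, map_pow, IsScalarTower.algebraMap_apply R R[X]]
        change _ - algebraMap R[X] (overlapRing D R) (C c) = _
        linear_combination algebraMap R[X] (overlapRing D R) (C c) * h3
      rw [h2, mul_pow, ← pow_mul, map_pow, mul_right_comm, ← pow_add, Nat.sub_add_cancel hKe]
    rw [mul_assoc, ← h1, ← mul_pow]
    ring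
  -- With c the value of h at infinity, c^K - (c - h)^K is a multiple of c - (c - h) = h.
  obtain ⟨a, ha⟩ := sub_dvd_pow_sub_pow (algebraMap R (infRing D R) c)
    (algebraMap R (infRing D R) c - h) K
  refine ⟨a, (-1) ^ K * b, K, ?_⟩
  rw [← hb, map_pow]
  linear_combination ha

/-- The sections `n a` generate the sections over the chart at infinity near the given fibre. -/
theorem exists_smul_mem_span [Module.Finite (infRing D R) E.N]
    [Module.Projective (infRing D R) E.N] {n : Fin r → E.N} {x : R} (hx : φ x ≠ 0)
    (hρ : ∀ y, x • E.ρ y ∈ Submodule.span R[X] (Set.range fun a => E.σ (n a)))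
    {h : infRing D R} (hh : infMap D φ h = 1)
    (hN : ∀ y, h • y ∈ Submodule.span (infRing D R) (Set.range n)) :
    ∃ x' : R, φ x' ≠ 0 ∧ ∀ y, x' • y ∈ Submodule.span (infRing D R) (Set.range n) := by
  set W := Submodule.span (infRing D R) (Set.range n)
  have hσ : Function.Injective E.σ :=
    (isUnitLocalization_infToOverlap D).injective_of_projective E.isBaseChangeAlong_σ
  obtain ⟨K, y, hy⟩ := Module.Finite.exists_fin (R := infRing D R) (M := E.N)
  have h1 : ∀ j, ∃ c : Fin r → overlapRing D R, x • E.σ (y j) = ∑ a, c a • E.σ (n a) := fun j => by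
    obtain ⟨a, ha, m, hm⟩ := E.ρ_surj (E.σ (y j))
    obtain ⟨c, hc⟩ := ha.exists_left_inv
    obtain ⟨f, hf⟩ := (Submodule.mem_span_range_iff_exists_fun _).mp (hρ m)
    refine ⟨fun b => c * algebraMap R[X] (overlapRing D R) (f b), ?_⟩
    have h2 : E.σ (y j) = c • E.ρ m := by rw [hm, smul_smul, hc, one_smul]
    rw [h2, smul_comm, ← hf, Finset.smul_sum]
    refine Finset.sum_congr rfl fun b _ => ?_
    rw [mul_smul, algebraMap_smul]
  choose c hc using h1
  obtain ⟨e, he⟩ := exists_nodeInv_pow_mul_mem D fun i : Fin K × Fin r => c i.1 i.2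
  let ν : infRing D R := ⟨nodeInv D R, nodeInv_mem D⟩
  -- Over the overlap x y_j is a combination of the n_a; a power of 1/q makes the coefficients
  -- regular at infinity, and σ is injective.
  have h2 : ∀ j, (ν ^ e) • x • y j ∈ W := fun j => by
    have h3 : (ν ^ e) • x • y j = ∑ a, (⟨_, he e le_rfl (j, a)⟩ : infRing D R) • n a := by
      refine hσ ?_
      rw [map_sum, map_smulₛₗ, semilinear_map_base_smul E.σ (θ := infToOverlap D R) (d := x) rfl,
        hc, Finset.smul_sum]
      refine Finset.sum_congr rfl fun a _ => ?_
      rw [map_smulₛₗ, smul_smul]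
      rfl
    rw [h3]
    exact sum_mem fun a _ => W.smul_mem _ (Submodule.subset_span ⟨a, rfl⟩)
  have h3 : ∀ z, (ν ^ e) • x • z ∈ W := fun z => by
    have hz : z ∈ Submodule.span (infRing D R) (Set.range y) := hy ▸ Submodule.mem_top
    induction hz using Submodule.span_induction with
    | mem z hz => obtain ⟨j, rfl⟩ := hz; exact h2 j
    | zero => rw [smul_zero, smul_zero]; exact zero_mem _
    | add z z' _ _ hz hz' => rw [smul_add, smul_add]; exact add_mem hz hz'
    | smul a z _ hz => rw [smul_comm x a z, smul_comm (ν ^ e) a]; exact W.smul_mem _ hz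
  obtain ⟨k, f, hk, hf, hfmap, hfh⟩ := exists_eq_nodeInv_pow_mul_of_infMap_eq_one hh
  -- Both h and the e-th power of 1/q move x N into W. The ideal they generate contains a power of
  -- the value of h at infinity, a scalar equal to 1 at φ.
  obtain ⟨a, b, K', hab⟩ := exists_mul_add_mul_nodeInv_pow hk hf hfh e
  refine ⟨f.coeff (k * (D.k + 1)) ^ K' * x, ?_, fun z => ?_⟩
  · rw [map_mul, map_pow, map_coeff_eq_one hfmap, one_pow, one_mul]
    exact hx
  · rw [mul_smul, smul_eq_of_tower (A := infRing D R) (_ ^ K'), hab, add_smul, mul_smul, mul_smul]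
    exact add_mem (W.smul_mem _ (hN _)) (W.smul_mem _ (h3 z))

/-- Sections over the affine chart near a fibre of the form `M_Λ`, modulo those vanishing on
the divisor. -/
theorem exists_smul_mem_span_sup [Module.Finite (affRing D R) E.M]
    (hu : IsBaseChangeAlong (affMap D φ) u) :
    ∃ (m : Fin r → E.M) (x : R), φ x = 1 ∧ ∀ y, x • y ∈ Submodule.span R (Set.range m) ⊔
      (fatIdeal D R • (⊤ : Submodule (affRing D R) E.M)).restrictScalars R := by
  have husurj := hu.exists_of_surjective (affMap_surjective D φ)
  obtain ⟨F⟩ := Λ.nonempty_frame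
  choose m hm using fun a : Fin r =>
    husurj ⟨F.S.mulVec fun b => C ((Pi.single a 1 : Fin r → ℂ) b),
      (Λ.mem_module_iff_exists F.jet_S _).mpr ⟨Pi.single a 1, 0, by rw [smul_zero, add_zero]⟩⟩
  set J : Submodule R E.M :=
    (fatIdeal D R • (⊤ : Submodule (affRing D R) E.M)).restrictScalars R with hJ
  obtain ⟨K, g, hg⟩ := Module.Finite.exists_fin (R := affRing D R) (M := E.M)
  have hJ : ∀ j ∈ fatIdeal D R, ∀ y, j • y ∈ J := fun j hj y => by
    have : j • y ∈ fatIdeal D R • (⊤ : Submodule (affRing D R) E.M) :=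
      Submodule.smul_mem_smul hj Submodule.mem_top
    exact this
  -- The vector t need not be a section. Expand it in sections with polynomial coefficients;
  -- multiplied by Q, the coefficients lift to elements of `fatIdeal`.
  have hfat : ∀ t : Fin r → ℂ[X], ∃ y ∈ J, (u y : Λ.module).1 = fatPoly D ℂ • t := fun t => by
    suffices ∀ f : ℂ[X], ∃ y ∈ J, (u y : Λ.module).1 = (fatPoly D ℂ * f) • t by
      simpa using this 1
    have ht := Λ.span_module t
    induction ht using Submodule.span_induction with
    | mem s hs =>
      intro f
      obtain ⟨y, hy⟩ := husurj ⟨s, hs⟩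
      obtain ⟨f', rfl⟩ := exists_map_eq φ f
      refine ⟨_, hJ ⟨_, fatPoly_mul_mem D f'⟩ ⟨f', rfl⟩ y, ?_⟩
      rw [map_smulₛₗ, hy, ← fatPoly_map D φ, ← Polynomial.map_mul]
      rfl
    | zero =>
      intro f
      exact ⟨0, zero_mem _, by rw [map_zero, smul_zero]; rfl⟩
    | add s s' _ _ hs hs' =>
      intro f
      obtain ⟨y, hy, h⟩ := hs f
      obtain ⟨y', hy', h'⟩ := hs' f
      exact ⟨y + y', add_mem hy hy', by rw [map_add, smul_add, ← h, ← h']; rfl⟩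
    | smul f' s _ hs =>
      intro f
      obtain ⟨y, hy, h⟩ := hs (f * f')
      exact ⟨y, hy, by rw [h, smul_smul, mul_assoc]⟩
  -- The module M need not be finite over R, but M modulo J is, being generated by the g_i. In the
  -- fibre the columns of S and Q ℂ[z]^r give all sections, so Nakayama over R applies.
  obtain ⟨x, hx, h⟩ := exists_sub_one_mem_and_smul_mem_of_fg (I := RingHom.ker φ)
    (P := Submodule.span R (Set.range m) ⊔ J) (U := Submodule.span R (Set.range g))
    (Submodule.fg_span (Set.finite_range g)) (by
      rw [eq_top_iff]
      rintro y -
      have hy : y ∈ Submodule.span (affRing D R) (Set.range g) := hg ▸ Submodule.mem_top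
      induction hy using Submodule.span_induction with
      | mem y hy => exact Submodule.mem_sup_right (Submodule.subset_span hy)
      | zero => exact zero_mem _
      | add y y' _ _ hy hy' => exact add_mem hy hy'
      | smul a y _ hy =>
        obtain ⟨c, j, hj, rfl⟩ := exists_algebraMap_add_fatIdeal a
        rw [add_smul, ← smul_eq_of_tower]
        exact add_mem (Submodule.smul_mem _ _ hy)
          (Submodule.mem_sup_left (Submodule.mem_sup_right (hJ j hj y)))) (by
      intro y _
      obtain ⟨c, t, hct⟩ := (Λ.mem_module_iff_exists F.jet_S _).mp (u y).2
      obtain ⟨y', hy', ht⟩ := hfat t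
      let z := ∑ a, algebraMap ℂ R (c a) • m a
      have hz : z ∈ Submodule.span R (Set.range m) :=
        sum_mem fun a _ => Submodule.smul_mem _ _ (Submodule.subset_span ⟨a, rfl⟩)
      let kS : (Fin r → ℂ) →ₗ[ℂ] (Fin r → ℂ[X]) :=
        { toFun := fun c => F.S.mulVec fun b => C (c b)
          map_add' := fun c d => by
            rw [← Matrix.mulVec_add]
            exact congrArg _ (_root_.funext fun b => C_add)
          map_smul' := fun k c => by
            rw [RingHom.id_apply, ← Matrix.mulVec_smul]
            exact congrArg _ (_root_.funext fun b => by
              rw [Pi.smul_apply, Pi.smul_apply, smul_eq_mul, C_mul, smul_eq_C_mul]) }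
      have huz : (u z : Λ.module).1 = kS c := by
        have h1 : u z = ∑ a, c a • u (m a) := by
          rw [map_sum]
          refine Finset.sum_congr rfl fun a _ => ?_
          rw [semilinear_map_base_smul u (affMap_algebraMap D φ (algebraMap ℂ R (c a))),
            φ.commutes]
          rfl
        rw [h1, LinearMap.pi_apply_eq_sum_single kS c]
        refine (map_sum (Λ.module.subtype.restrictScalars ℂ) (fun a => c a • u (m a)) _).trans ?_
        refine Finset.sum_congr rfl fun a _ => ?_
        rw [hm]
        rfl
      have h2 : u (z + y') = u y := by
        refine Subtype.ext ?_
        rw [hct, ← ht, map_add]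
        exact congrArg (· + (u y' : Λ.module).1) huz
      have h3 := hu.mem_base_smul_of_eq_zero (affMap_surjective D φ) (ker_affMap_le D φ)
        (m := y - (z + y')) (by rw [map_sub, h2, sub_self])
      rw [← add_sub_cancel (z + y') y]
      exact Submodule.add_mem_sup (Submodule.add_mem_sup hz hy') h3)
  rw [RingHom.mem_ker, map_sub, map_one, sub_eq_zero] at hx
  exact ⟨m, x, hx, h⟩

/-- Near a fibre of the form `M_Λ`, a vector bundle has a frame. -/
theorem QCoh.IsVectorBundle.exists_localFrame (hE : E.IsVectorBundle r)
    (h : IsPullback φ E Λ.bundle) : ∃ x : R, φ x ≠ 0 ∧ Nonempty (E.LocalFrame r x) := by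
  obtain ⟨⟨_, _, -⟩, ⟨_, _, -⟩⟩ := hE
  obtain ⟨u, v, w, h1, h2, hu, hv, hw⟩ := h
  choose n hσ hn using exists_lift_single h1 h2
    (hu.exists_of_surjective (affMap_surjective D φ))
    (hv.exists_of_surjective (infMap_surjective D φ)) hw
  obtain ⟨b, hb, hN⟩ := exists_infMap_eq_one_smul_mem hv hn
  obtain ⟨x₁, hx₁, h₁⟩ := exists_smul_ρ_mem h1 h2 hw hσ hn hb hN
  obtain ⟨x₂, hx₂, h₂⟩ := exists_smul_mem_span hx₁ h₁ hb hN
  obtain ⟨m, x₃, hx₃, h₃⟩ := exists_smul_mem_span_sup hu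
  refine ⟨x₁ * x₂ * x₃, ?_, ⟨⟨n, m, hσ, fun y => ?_, fun y => ?_, fun y => ?_⟩⟩⟩
  · rw [map_mul, map_mul, hx₃, mul_one]
    exact mul_ne_zero hx₁ hx₂
  · rw [mul_assoc, mul_comm, mul_smul]
    exact Submodule.smul_of_tower_mem _ _ (h₁ y)
  · rw [mul_right_comm, mul_smul]
    exact Submodule.smul_of_tower_mem _ _ (h₂ y)
  · rw [mul_smul]
    exact Submodule.smul_mem _ _ (h₃ y)

/-- A vector bundle is of the form `M_Λ` near a fibre of this form. -/
theorem QCoh.IsVectorBundle.exists_isPullback_bundle (hE : E.IsVectorBundle r)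
    (h : IsPullback φ E Λ.bundle) : ∃ x : R, φ x ≠ 0 ∧ ∃ Λ' : Tuple D r (Localization.Away x),
      IsPullback (IsScalarTower.toAlgHom ℂ R (Localization.Away x)) E Λ'.bundle := by
  obtain ⟨x, hx, ⟨K⟩⟩ := hE.exists_localFrame h
  obtain ⟨F, hF⟩ := exists_isPullback (IsScalarTower.toAlgHom ℂ R (Localization.Away x)) E
  obtain ⟨K'⟩ := K.map hF (IsLocalization.Away.algebraMap_isUnit x)
  obtain ⟨Λ', hΛ'⟩ := K'.exists_iso (hF.isVectorBundle hE)
  exact ⟨x, hx, Λ', hF.trans_iso hΛ'⟩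

end LocalFrameExistence

/-! ### Zariski topology on closed points -/

section PointTopology

variable {D : Divisor} {r : ℕ} {R : Type} [CommRing R] [Algebra ℂ R]

/-- A closed point as a point of the prime spectrum. -/
def toSpec (R : Type) [CommRing R] [Algebra ℂ R] (φ : R →ₐ[ℂ] ℂ) : PrimeSpectrum R :=
  ⟨RingHom.ker φ, RingHom.ker_isPrime φ⟩

theorem isOpen_pointTopology_iff {U : Set (R →ₐ[ℂ] ℂ)} :
    IsOpen[pointTopology R] U ↔ ∃ V, IsOpen V ∧ toSpec R ⁻¹' V = U := isOpen_induced_iff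

theorem isOpen_setOf_ne_zero (a : R) : IsOpen[pointTopology R] {φ : R →ₐ[ℂ] ℂ | φ a ≠ 0} :=
  isOpen_pointTopology_iff.mpr ⟨_, (PrimeSpectrum.basicOpen a).isOpen, rfl⟩

/-- The matrix entries of a tuple. -/
def Tuple.entry (Λ : Tuple D r R) :
    (Fin D.k × Fin r × Fin r) ⊕ ((Σ i : Fin (D.k + 1), Fin (D.n i - 1)) × Fin r × Fin r) → R
  | .inl (i, a, b) => (Λ.glue i).1 a b
  | .inr (il, a, b) => Λ.deriv il.1 il.2 a b

theorem Tuple.coord_map (Λ : Tuple D r R) (φ : R →ₐ[ℂ] ℂ) :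
    (Λ.map φ.toRingHom).coord = φ ∘ Λ.entry := by
  ext (x | x) <;> rfl

theorem Tuple.coord_injective : Function.Injective (Tuple.coord (D := D) (r := r)) := by
  intro Λ Λ' h
  ext i : 2
  · exact Units.ext (Matrix.ext fun a b => congrFun h (.inl (i, a, b)))
  · exact _root_.funext fun l => Matrix.ext fun a b => congrFun h (.inr (⟨i, l⟩, a, b))

theorem Tuple.eval_coord_map (Λ : Tuple D r R) (φ : R →ₐ[ℂ] ℂ) (p : MvPolynomial _ ℂ) :
    MvPolynomial.eval (Λ.map φ.toRingHom).coord p = φ (MvPolynomial.aeval Λ.entry p) := by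
  rw [Λ.coord_map, ← AlgHom.comp_apply, MvPolynomial.comp_aeval]
  rfl

/-- The fibres of a family of tuples vary continuously. -/
theorem Tuple.isOpen_preimage_map (Λ : Tuple D r R) {U : Set (Tuple D r ℂ)} (hU : IsOpen U) :
    IsOpen[pointTopology R] {φ : R →ₐ[ℂ] ℂ | Λ.map φ.toRingHom ∈ U} := by
  let := pointTopology R
  refine IsOpen.preimage (f := fun φ : R →ₐ[ℂ] ℂ => Λ.map φ.toRingHom)
    (continuous_generateFrom_iff.mpr ?_) hU
  rintro _ ⟨p, rfl⟩
  have := isOpen_setOf_ne_zero (MvPolynomial.aeval Λ.entry p)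
  convert! this using 1
  ext φ
  exact not_congr (by rw [Λ.eval_coord_map])

/-- A closed point in a principal open subset. -/
theorem exists_comp_away_eq {x : R} {φ : R →ₐ[ℂ] ℂ} (hx : φ x ≠ 0) :
    ∃ ψ : Localization.Away x →ₐ[ℂ] ℂ,
      ψ.comp (IsScalarTower.toAlgHom ℂ R (Localization.Away x)) = φ := by
  have h : ∀ y : Submonoid.powers x, IsUnit (φ y) := by
    rintro ⟨_, n, rfl⟩
    rw [map_pow]
    exact (IsUnit.mk0 _ hx).pow n
  let ψ : Localization.Away x →ₐ[ℂ] ℂ :=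
    IsLocalization.liftAlgHom (M := Submonoid.powers x) (f := φ) h
  have hψ : ∀ a, ψ (algebraMap R (Localization.Away x) a) = φ a := fun a =>
    IsLocalization.lift_eq (M := Submonoid.powers x) (g := (φ : R →+* ℂ)) h a
  exact ⟨ψ, AlgHom.ext hψ⟩

/-- Restriction of closed points to a principal open subset is an open map. -/
theorem isOpen_image_comp_away (x : R) {U : Set (Localization.Away x →ₐ[ℂ] ℂ)}
    (hU : IsOpen[pointTopology (Localization.Away x)] U) :
    IsOpen[pointTopology R]
      ((fun ψ => ψ.comp (IsScalarTower.toAlgHom ℂ R (Localization.Away x))) '' U) := by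
  obtain ⟨V, hV, rfl⟩ := isOpen_pointTopology_iff.mp hU
  have hemb := PrimeSpectrum.localization_away_isOpenEmbedding (Localization.Away x) x
  refine isOpen_pointTopology_iff.mpr ⟨_, hemb.isOpenMap V hV, ?_⟩
  have hcomap : ∀ ψ : Localization.Away x →ₐ[ℂ] ℂ,
      PrimeSpectrum.comap (algebraMap R (Localization.Away x)) (toSpec _ ψ) =
        toSpec R (ψ.comp (IsScalarTower.toAlgHom ℂ R (Localization.Away x))) := fun ψ => rfl
  ext φ
  constructor
  · rintro ⟨P, hP, h⟩
    have hx : φ x ≠ 0 := fun h0 => by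
      have h1 : x ∈ (toSpec R φ).asIdeal := h0
      rw [← h] at h1
      have h2 : algebraMap R (Localization.Away x) x ∈ P.asIdeal := h1
      exact P.isPrime.ne_top (Ideal.eq_top_of_isUnit_mem _ h2
        (IsLocalization.Away.algebraMap_isUnit x))
    obtain ⟨ψ, rfl⟩ := exists_comp_away_eq hx
    refine ⟨ψ, ?_, rfl⟩
    have : P = toSpec _ ψ := hemb.injective (h.trans (hcomap ψ).symm)
    change toSpec _ ψ ∈ V
    rw [← this]
    exact hP
  · rintro ⟨ψ, hψ, rfl⟩
    exact ⟨_, hψ, hcomap ψ⟩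

end PointTopology

/-! ### The universal tuple -/

section UniversalTuple

variable (D : Divisor) (r : ℕ)

/-- The ring of polynomials in the entries of a tuple. -/
abbrev EntryRing : Type := MvPolynomial
  ((Fin D.k × Fin r × Fin r) ⊕ ((Σ i : Fin (D.k + 1), Fin (D.n i - 1)) × Fin r × Fin r)) ℂ

/-- The matrices of indeterminates. -/
def genericGlue (i : Fin D.k) : Matrix (Fin r) (Fin r) (EntryRing D r) :=
  Matrix.of fun a b => MvPolynomial.X (.inl (i, a, b))

/-- The product of the determinants of the matrices which have to be invertible. -/
def glueDet : EntryRing D r := ∏ i, (genericGlue D r i).det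

/-- The coordinate ring of the space of tuples. -/
abbrev TupleRing : Type := Localization.Away (glueDet D r)

theorem isUnit_genericGlue (i : Fin D.k) :
    IsUnit ((genericGlue D r i).map (algebraMap _ (TupleRing D r))) := by
  rw [Matrix.isUnit_iff_isUnit_det]
  have h := RingHom.map_det (algebraMap (EntryRing D r) (TupleRing D r)) (genericGlue D r i)
  rw [RingHom.mapMatrix_apply] at h
  rw [← h]
  have hd : (genericGlue D r i).det ∣ glueDet D r :=
    Finset.dvd_prod_of_mem (fun i => (genericGlue D r i).det) (Finset.mem_univ i)
  exact isUnit_of_dvd_unit (map_dvd _ hd) (IsLocalization.Away.algebraMap_isUnit (glueDet D r))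

/-- The universal tuple. -/
def universalTuple : Tuple D r (TupleRing D r) where
  glue i := (isUnit_genericGlue D r i).unit
  deriv i l := Matrix.of fun a b => algebraMap (EntryRing D r) (TupleRing D r)
    (MvPolynomial.X (Sum.inr (⟨i, l⟩, a, b)))

theorem entry_universalTuple (j) : (universalTuple D r).entry j =
    algebraMap (EntryRing D r) (TupleRing D r) (MvPolynomial.X j) := by
  obtain x | x := j <;> rfl

instance : Algebra.FiniteType ℂ (TupleRing D r) :=
  Algebra.FiniteType.trans (S := EntryRing D r) inferInstance
    (IsLocalization.finiteType_of_monoid_fg (Submonoid.powers (glueDet D r)) _)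

variable {D r}

theorem Tuple.eval_glueDet_ne_zero (Λ : Tuple D r ℂ) :
    MvPolynomial.eval Λ.coord (glueDet D r) ≠ 0 := by
  rw [glueDet, map_prod, Finset.prod_ne_zero_iff]
  intro i _
  have h : MvPolynomial.eval Λ.coord (genericGlue D r i).det = (Λ.glue i).1.det := by
    rw [RingHom.map_det]
    congr 1
    ext a b
    exact MvPolynomial.eval_X _
  rw [h]
  exact ((Matrix.isUnit_iff_isUnit_det _).mp (Λ.glue i).isUnit).ne_zero

/-- The closed point of the space of tuples defined by a complex tuple. -/
def Tuple.point (Λ : Tuple D r ℂ) : TupleRing D r →ₐ[ℂ] ℂ :=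
  IsLocalization.liftAlgHom (M := Submonoid.powers (glueDet D r))
    (f := MvPolynomial.aeval Λ.coord) (by
      rintro ⟨_, n, rfl⟩
      rw [map_pow]
      exact (IsUnit.mk0 _ Λ.eval_glueDet_ne_zero).pow n)

theorem Tuple.point_algebraMap (Λ : Tuple D r ℂ) (p : EntryRing D r) :
    Λ.point (algebraMap _ _ p) = MvPolynomial.eval Λ.coord p :=
  (IsLocalization.lift_eq _ p).trans rfl

theorem Tuple.universalTuple_map_point (Λ : Tuple D r ℂ) :
    (universalTuple D r).map Λ.point.toRingHom = Λ := by
  refine Tuple.coord_injective ?_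
  rw [Tuple.coord_map]
  refine _root_.funext fun j => ?_
  rw [Function.comp_apply, entry_universalTuple, Λ.point_algebraMap, MvPolynomial.eval_X]

/-- A function on the space of tuples is a polynomial divided by a power of `glueDet`, which
vanishes at no tuple. So its nonvanishing locus is that of its numerator, one of the generating open
sets. -/
theorem isOpen_preimage_point {U : Set (TupleRing D r →ₐ[ℂ] ℂ)}
    (hU : IsOpen[pointTopology (TupleRing D r)] U) :
    IsOpen {Λ : Tuple D r ℂ | Λ.point ∈ U} := by
  obtain ⟨V, hV, rfl⟩ := isOpen_pointTopology_iff.mp hU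
  refine IsOpen.preimage (f := fun Λ : Tuple D r ℂ => toSpec _ Λ.point) ?_ hV
  refine (PrimeSpectrum.isTopologicalBasis_basic_opens.continuous_iff).mpr ?_
  rintro _ ⟨a, rfl⟩
  obtain ⟨n, p, hp⟩ := IsLocalization.Away.surj (glueDet D r) a
  refine TopologicalSpace.isOpen_generateFrom_of_mem ⟨p, ?_⟩
  ext Λ
  have h : Λ.point a * MvPolynomial.eval Λ.coord (glueDet D r) ^ n =
      MvPolynomial.eval Λ.coord p := by
    rw [← Λ.point_algebraMap p, ← hp, map_mul, map_pow, Λ.point_algebraMap]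
  change Λ.point a ≠ 0 ↔ MvPolynomial.eval Λ.coord p ≠ 0
  rw [← h]
  simp [Λ.eval_glueDet_ne_zero]

end UniversalTuple

/-! ### The open embedding into the moduli space -/

section Moduli

variable {D : Divisor} {r : ℕ}

/-- The point of the moduli space defined by a tuple. -/
def Tuple.toModuli (Λ : Tuple D r ℂ) : ModuliSpace D r :=
  isoClass Λ.bundle ⟨Λ.bundle_isVectorBundle, Λ.degree_bundle, Λ.bundle_isSemistable⟩

theorem Tuple.toModuli_eq_iff (Λ Λ' : Tuple D r ℂ) :
    Λ.toModuli = Λ'.toModuli ↔ Λ.orbit = Λ'.orbit := by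
  have h1 : Λ.toModuli = Λ'.toModuli ↔ Λ.bundle.Iso Λ'.bundle := Quotient.eq
  have h2 : Λ.orbit = Λ'.orbit ↔ ∃ g : GL (Fin r) ℂ, g • Λ' = Λ := Quotient.eq
  rw [h1, h2, Tuple.iso_iff]
  exact exists_congr fun g => eq_comm

/-- The map from the quotient of the space of tuples to the moduli space. -/
def quotientToModuli (D : Divisor) (r : ℕ) : TupleQuotient D r → ModuliSpace D r :=
  Quotient.lift Tuple.toModuli fun Λ Λ' h =>
    (Tuple.toModuli_eq_iff Λ Λ').mpr (Quotient.sound h)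

theorem Tuple.isClassifyingMap {R : Type} [CommRing R] [Algebra ℂ R] (Λ : Tuple D r R) :
    IsClassifyingMap Λ.bundle fun φ => (Λ.map φ.toRingHom).toModuli :=
  ⟨Λ.bundle_isVectorBundle, fun φ => ⟨_, Λ.isPullback_bundle φ, rfl⟩⟩

/-- Fibres are unique up to isomorphism, so a classifying map may be computed with any model of the
fibre. -/
theorem IsClassifyingMap.eq_toModuli {R : Type} [CommRing R] [Algebra ℂ R] {E : QCoh D R}
    {c : (R →ₐ[ℂ] ℂ) → ModuliSpace D r} (hc : IsClassifyingMap E c) {φ : R →ₐ[ℂ] ℂ}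
    {Λ : Tuple D r ℂ} (h : IsPullback φ E Λ.bundle) : c φ = Λ.toModuli := by
  obtain ⟨F, hF, hcF⟩ := hc.2 φ
  rw [hcF]
  exact Quotient.sound (hF.iso h)

theorem isOpenEmbedding_quotientToModuli (D : Divisor) (r : ℕ) :
    Topology.IsOpenEmbedding (quotientToModuli D r) := by
  refine .of_continuous_injective_isOpenMap ?_ ?_ ?_
  -- Open sets of the moduli space are tested on families; the family of the universal tuple
  -- recovers each tuple at its closed point.
  · refine continuous_quot_lift _ (continuous_def.mpr fun U hU => ?_)
    have := isOpen_preimage_point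
      (hU (TupleRing D r) _ _ (universalTuple D r).isClassifyingMap)
    convert! this using 1
    ext Λ
    change _ ↔ ((universalTuple D r).map Λ.point.toRingHom).toModuli ∈ U
    rw [Λ.universalTuple_map_point]
    rfl
  · intro a b
    induction a using Quotient.inductionOn with | _ Λ
    induction b using Quotient.inductionOn with | _ Λ'
    exact (Tuple.toModuli_eq_iff Λ Λ').mp
  · intro V hV R _ _ _ E c hc
    let := pointTopology R
    -- Near a point of the preimage the family is M_Λ' for a tuple Λ' over a principal open set.
    -- Membership there is an open condition on the matrix entries of Λ', and the image in the base
    -- is open.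
    rw [isOpen_iff_forall_mem_open]
    rintro φ ⟨a, ha, hφ⟩
    induction a using Quotient.inductionOn with | _ Λ
    have hV' : IsOpen {Λ : Tuple D r ℂ | Λ.orbit ∈ V} := hV.preimage continuous_quotient_mk'
    have hpb : IsPullback φ E Λ.bundle := by
      obtain ⟨F, hF, hcF⟩ := hc.2 φ
      have h : Quotient.mk (semistableSetoid D r) _ = Quotient.mk _ F := hφ.trans hcF
      exact hF.trans_iso (QCoh.Iso.symm (Quotient.exact h))
    obtain ⟨x, hx, Λ', hΛ'⟩ := hc.1.exists_isPullback_bundle hpb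
    have hfib : ∀ ψ : Localization.Away x →ₐ[ℂ] ℂ,
        c (ψ.comp (IsScalarTower.toAlgHom ℂ R (Localization.Away x))) =
          (Λ'.map ψ.toRingHom).toModuli := fun ψ =>
      hc.eq_toModuli (hΛ'.comp (Λ'.isPullback_bundle ψ))
    refine ⟨_, ?_, isOpen_image_comp_away x (Λ'.isOpen_preimage_map hV'), ?_⟩
    · rintro _ ⟨ψ, hψ, rfl⟩
      exact ⟨_, hψ, (hfib ψ).symm⟩
    · obtain ⟨ψ, rfl⟩ := exists_comp_away_eq hx
      refine ⟨ψ, ?_, rfl⟩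
      have h : (Λ'.map ψ.toRingHom).orbit = Λ.orbit :=
        (Tuple.toModuli_eq_iff _ _).mp ((hfib ψ).symm.trans hφ.symm)
      change (Λ'.map ψ.toRingHom).orbit ∈ V
      rw [h]
      exact ha

end Moduli

end GluedCurve

end

theorem mainTheorem4 (D : GluedCurve.Divisor) (r : ℕ) :
    -- isomorphism of bundles is simultaneous conjugacy
    (∀ Λ Λ' : GluedCurve.Tuple D r ℂ,
      Λ.bundle.Iso Λ'.bundle ↔ ∃ g : GL (Fin r) ℂ, Λ = g • Λ') ∧
    -- the quotient is an open subspace of the moduli of semistable bundles via `Λ ↦ M_Λ`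
    (∃ f : GluedCurve.TupleQuotient D r → GluedCurve.ModuliSpace D r,
      (∀ Λ : GluedCurve.Tuple D r ℂ, ∃ h, f Λ.orbit = GluedCurve.isoClass Λ.bundle h) ∧
      Topology.IsOpenEmbedding f) ∧
    -- the identification is algebraic: tuples over `R` give families of bundles over `Spec R`,
    -- compatibly with base change,
    (∀ (R : Type) [CommRing R] [Algebra ℂ R] (Λ : GluedCurve.Tuple D r R),
      Λ.bundle.IsVectorBundle r ∧
      ∀ (S : Type) [CommRing S] [Algebra ℂ S] (φ : R →ₐ[ℂ] S),
        GluedCurve.IsPullback φ Λ.bundle (Λ.map φ.toRingHom).bundle) ∧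
    -- such families are isomorphic iff the tuples are conjugate over `R`,
    (∀ (R : Type) [CommRing R] [Algebra ℂ R] (Λ Λ' : GluedCurve.Tuple D r R),
      Λ.bundle.Iso Λ'.bundle ↔ ∃ g : GL (Fin r) R, Λ = g • Λ') ∧
    -- and every family with all fibres of the form `M_Λ` arises in this way locally on the base
    (∀ (R : Type) [CommRing R] [Algebra ℂ R] [Algebra.FiniteType ℂ R]
      (E : GluedCurve.QCoh D R), E.IsVectorBundle r →
      (∀ φ : R →ₐ[ℂ] ℂ, ∃ Λ : GluedCurve.Tuple D r ℂ, GluedCurve.IsPullback φ E Λ.bundle) →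
      ∀ φ : R →ₐ[ℂ] ℂ, ∃ x : R, φ x ≠ 0 ∧
        ∃ Λ : GluedCurve.Tuple D r (Localization.Away x),
          GluedCurve.IsPullback (IsScalarTower.toAlgHom ℂ R (Localization.Away x)) E
            Λ.bundle) := by
  refine ⟨GluedCurve.Tuple.iso_iff, ⟨GluedCurve.quotientToModuli D r, fun Λ => ⟨_, rfl⟩,
    GluedCurve.isOpenEmbedding_quotientToModuli D r⟩, fun R _ _ Λ => ⟨Λ.bundle_isVectorBundle,
    fun S _ _ φ => Λ.isPullback_bundle φ⟩, fun R _ _ => GluedCurve.Tuple.iso_iff, ?_⟩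
  intro R _ _ _ E hE h φ
  obtain ⟨Λ, hΛ⟩ := h φ
  exact hE.exists_isPullback_bundle hΛ
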